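/- Consider $N$ qubits in a chain, with Pauli matrices $\sigma_l^x,\sigma_l^y,\sigma_l^z$ on qubit $l$. Let $n\ge1$, $0=t_0<t_1<\dots<t_n=1$, $\alpha=(\alpha_j^u)\in\{0,1\}^{3n}$ and $\gamma=(\gamma_j^{u,v})\in\{0,1\}^{9n}$ ($1\le j\le n$; $u,v\in\{x,y,z\}$) with $\alpha_1^x=\alpha_1^z=\gamma_1^{zz}=1$. For real parameters $(\mathbf h,\mathbf J)=(h_{j,l}^u,J_{j,l}^{u,v})\in\mathbb R^{3nN}\times\mathbb R^{9n(N-1)}=\mathbb R^{12nN-9n}$ let $H(t)$ be the Hamiltonian of period $1$ with $$H(t)=\sum_{l=1}^N\sum_u\alpha_j^uh_{j,l}^u\sigma_l^u+\sum_{l=1}^{N-1}\sum_{u,v}\gamma_j^{u,v}J_{j,l}^{u,v}\sigma_l^u\sigma_{l+1}^v\qquad(t_{j-1}\le t<t_j),$$ let $|\psi(t)\rangle=\mathcal Te^{-i\int_0^tH(\tau)\,d\tau}|\psi(0)\rangle$ for $t\ge0$, where $|\psi(0)\rangle=\bigotimes_l|\phi_l\rangle$ is a Haar-random product state (the $|\phi_l\rangle$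 are independent and uniform on the unit sphere of $\mathbb C^2$), and for a set $S$ of qubits let $\psi(t)_S$ be the reduced density matrix of $|\psi(t)\rangle$ on $S$. A function $g$ of time with real values is called $\epsilon$-periodic if there is $\bar g:[0,1)\to\mathbb R$ with $$\liminf_{M\to\infty}\frac1M\Big|\Big\{m\in\{0,\dots,M-1\}:\int_0^1|g(m+x)-\bar g(x)|^2\,dx\le\epsilon\Big\}\Big|\ge1-\epsilon.$$ Let $f=(f_{N,S})$ be a family of real-valued functions on the density matrices of $S$, for $S\subseteq\{1,\dots,N\}$, such that perturbations of size $e^{-\Omega(N)}$ in trace norm change $f$ by $e^{-\Omega(N)}$: for every $c>0$ there are $c'>0$ and $N_0$ such that for all $N\ge N_0$, all $S$ with $|S|\le0.29248N$ and all density matrices $\rho_1,\rho_2$ of $S$, $\|\rho_1-\rho_2\|_1\le e^{-cN}$ implies $|f_{N,S}(\rho_1)-f_{N,S}(\rho_2)|\le e^{-c'N}$. Then there are $c>0$ and $N_0$, depending only on $f$, such that for all $N\ge N_0$, all $S$ with $|S|\le0.29248N$ and all $(n,(t_j),\alpha,\gamma)$ as above, for all $(\mathbf h,\mathbf J)\in\mathbb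 R^{12nN-9n}$ outside a set of Lebesgue measure zero, $$\Pr_{|\psi(0)\rangle}\big(f_{N,S}(\psi(t)_S)\text{ is }e^{-cN}\text{-periodic}\big)\ge1-e^{-cN}.$$ Moreover, the von Neumann entropy $f_{N,S}(\rho)=-\operatorname{tr}(\rho\ln\rho)$ satisfies the condition on $f$, so that the conclusion holds for the entanglement entropy $-\operatorname{tr}(\psi(t)_S\ln\psi(t)_S)$ between $S$ and its complement. -/

import Mathlib

open MeasureTheory Matrix
open scoped ComplexOrder

noncomputable section

namespace Floquet

/-! ### Qubits and Pauli matrices -/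

/-- The three spin directions. -/
inductive Axis
  | x
  | y
  | z
  deriving DecidableEq

instance : Fintype Axis := ⟨{.x, .y, .z}, by intro a; cases a <;> simp⟩

/-- The Pauli matrices. -/
def pauli : Axis → Matrix (Fin 2) (Fin 2) ℂ
  | .x => !![0, 1; 1, 0]
  | .y => !![0, -Complex.I; Complex.I, 0]
  | .z => !![1, 0; 0, -1]

/-- Basis labels of a system of qubits labelled by `ι`. -/
abbrev Config (ι : Type) : Type := ι → Fin 2

/-- Operators on a system of `N` qubits, as matrices in the computational basis. -/
abbrev Op (N : ℕ) : Type := Matrix (Config (Fin N)) (Config (Fin N)) ℂ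

/-- The single-qubit operator `A` acting on qubit `l` and as the identity on the other qubits. -/
def onSite {N : ℕ} (l : Fin N) (A : Matrix (Fin 2) (Fin 2) ℂ) : Op N :=
  fun s s' => if ∀ k, k ≠ l → s k = s' k then A (s l) (s' l) else 0

/-- Left end of the bond `l` of the chain. -/
def bondLeft {N : ℕ} (l : Fin (N - 1)) : Fin N := ⟨l, by have := l.2; omega⟩

/-- Right end of the bond `l` of the chain. -/
def bondRight {N : ℕ} (l : Fin (N - 1)) : Fin N := ⟨l + 1, by have := l.2; omega⟩

/-! ### Ensembles of piecewise time-independent Floquet systems -/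

/-- The tuple `(n, T, α, γ)` that defines an ensemble. The pieces are numbered from `0`, and piece
`j` is the time interval `[T j, T (j + 1))`. -/
structure Ensemble where
  /-- the number of pieces in one period -/
  n : ℕ
  n_pos : 0 < n
  /-- the times when the Hamiltonian can change abruptly -/
  T : Fin (n + 1) → ℝ
  T_strictMono : StrictMono T
  T_first : T 0 = 0
  T_last : T (Fin.last n) = 1
  /-- which on-site terms are present in each piece -/
  α : Fin n → Axis → Bool
  /-- which nearest-neighbor terms are present in each piece -/
  γ : Fin n → Axis → Axis → Bool

/-- The first piece of an ensemble. -/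
def Ensemble.first (E : Ensemble) : Fin E.n := ⟨0, E.n_pos⟩

/-- The parameter space of pairs `(h, J)`; its `volume` is Lebesgue measure in dimension
`3 n N + 9 n (N - 1)`. -/
abbrev Params (n N : ℕ) : Type :=
  (Fin n → Fin N → Axis → ℝ) × (Fin n → Fin (N - 1) → Axis → Axis → ℝ)

/-- The Hamiltonian of piece `j`. -/
def Ensemble.hamiltonian (E : Ensemble) {N : ℕ} (p : Params E.n N) (j : Fin E.n) : Op N :=
  (∑ l, ∑ u, (if E.α j u then ((p.1 j l u : ℝ) : ℂ) else 0) • onSite l (pauli u)) +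
    ∑ l, ∑ u, ∑ v, (if E.γ j u v then ((p.2 j l u v : ℝ) : ℂ) else 0) •
      (onSite (bondLeft l) (pauli u) * onSite (bondRight l) (pauli v))

/-- The length of the part of piece `j` that lies in `[0, x]`, for `0 ≤ x ≤ 1`. -/
def Ensemble.elapsed (E : Ensemble) (x : ℝ) (j : Fin E.n) : ℝ :=
  max 0 (min x (E.T j.succ) - E.T j.castSucc)

/-- The evolution operator `U(0, x)` within one period, `0 ≤ x ≤ 1`: the time-ordered product of
the exponentials of the pieces, later pieces standing to the left. -/
def Ensemble.partialEvolution (E : Ensemble) {N : ℕ} (p : Params E.n N) (x : ℝ) : Op N :=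
  (List.ofFn fun j : Fin E.n =>
    NormedSpace.exp ((-Complex.I * (E.elapsed x j : ℂ)) • E.hamiltonian p j)).reverse.prod

/-- The Floquet operator `U(0, 1)`. -/
def Ensemble.floquetOp (E : Ensemble) {N : ℕ} (p : Params E.n N) : Op N :=
  E.partialEvolution p 1

/-- The evolution operator `U(0, t)` for `t ≥ 0`; it is `U(0, x) U(0, 1) ^ m` if `t = m + x` with
`m` a natural number and `0 ≤ x < 1`. (Negative times are never used.) -/
def Ensemble.evolution (E : Ensemble) {N : ℕ} (p : Params E.n N) (t : ℝ) : Op N :=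
  E.partialEvolution p (Int.fract t) * E.floquetOp p ^ ⌊t⌋₊

/-! ### Haar-random product states -/

/-- The unit sphere of the state space of one qubit. -/
abbrev QubitState : Type := Metric.sphere (0 : EuclideanSpace ℂ (Fin 2)) 1

/-- The Haar measure on states of one qubit: the uniform probability measure on the sphere. -/
def haarQubit : Measure QubitState :=
  ((volume : Measure (EuclideanSpace ℂ (Fin 2))).toSphere Set.univ)⁻¹ •
    (volume : Measure (EuclideanSpace ℂ (Fin 2))).toSphere

/-- The law of the tuple of independent Haar-random states of the qubits. -/
def haarProduct (N : ℕ) : Measure (Fin N → QubitState) :=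
  Measure.pi fun _ => haarQubit

/-- The product state with the given factors. -/
def productState {N : ℕ} (φ : Fin N → QubitState) : Config (Fin N) → ℂ :=
  fun s => ∏ l, (φ l : EuclideanSpace ℂ (Fin 2)) (s l)

/-! ### Density matrices -/

/-- Density matrices: positive semidefinite matrices with unit trace. -/
def Density (ι : Type) [Fintype ι] : Type :=
  {ρ : Matrix ι ι ℂ // ρ.PosSemidef ∧ ρ.trace = 1}

/-- The trace norm: the sum of the singular values. -/
def traceNorm {ι : Type} [Fintype ι] [DecidableEq ι] (A : Matrix ι ι ℂ) : ℝ :=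
  ∑ i, Real.sqrt ((isHermitian_conjTranspose_mul_self A).eigenvalues i)

/-- The von Neumann entropy `- tr (ρ ln ρ)`, with `0 ln 0 = 0`. -/
def entropy {ι : Type} [Fintype ι] [DecidableEq ι] (ρ : Density ι) : ℝ :=
  -((ρ.1 * ρ.2.1.isHermitian.cfc Real.log).trace).re

/-- The configuration of all qubits made of a configuration on `S` and one on its complement. -/
def glue {N : ℕ} (S : Finset (Fin N)) (a : Config S) (c : Config {l // l ∉ S}) :
    Config (Fin N) :=
  fun l => if h : l ∈ S then a ⟨l, h⟩ else c ⟨l, h⟩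

/-- The partial trace over the complement of `S`. -/
def partialTrace {N : ℕ} (S : Finset (Fin N)) (ρ : Op N) : Matrix (Config S) (Config S) ℂ :=
  fun a b => ∑ c : Config {l // l ∉ S}, ρ (glue S a c) (glue S b c)

/-! ### The reduced states of the evolving system are density matrices -/

theorem pauli_isHermitian (u : Axis) : (pauli u).IsHermitian := by
  cases u <;> ext i j <;> fin_cases i <;> fin_cases j <;> simp [pauli]

theorem onSite_isHermitian {N : ℕ} (l : Fin N) {A : Matrix (Fin 2) (Fin 2) ℂ}
    (hA : A.IsHermitian) : (onSite l A).IsHermitian := by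
  ext s s'
  have h1 : (∀ k, k ≠ l → s' k = s k) ↔ (∀ k, k ≠ l → s k = s' k) :=
    forall₂_congr fun _ _ => eq_comm
  have h2 := hA.apply (s l) (s' l)
  simp only [conjTranspose_apply, onSite, h1]
  split_ifs with h
  · exact h2
  · simp

theorem onSite_commute {N : ℕ} {l m : Fin N} (hlm : l ≠ m) (A B : Matrix (Fin 2) (Fin 2) ℂ) :
    onSite l A * onSite m B = onSite m B * onSite l A := by
  ext s s'
  have key : ∀ (l m : Fin N), l ≠ m → ∀ A B : Matrix (Fin 2) (Fin 2) ℂ,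
      (onSite l A * onSite m B) s s' =
        if ∀ k, k ≠ l → k ≠ m → s k = s' k then A (s l) (s' l) * B (s m) (s' m) else 0 := by
    intro l m hlm A B
    rw [mul_apply, Finset.sum_eq_single (Function.update s l (s' l))]
    · have h1 : ∀ k, k ≠ l → s k = Function.update s l (s' l) k := fun k hk => by simp [hk]
      have h2 : (∀ k, k ≠ m → Function.update s l (s' l) k = s' k) ↔
          ∀ k, k ≠ l → k ≠ m → s k = s' k := by
        refine forall_congr' fun k => ?_
        by_cases hk : k = l
        · subst hk; simp
        · simp [hk]
      simp only [onSite, if_pos h1, h2, Function.update_self, Function.update_of_ne hlm.symm]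
      split_ifs <;> simp
    · intro r _ hr
      by_contra hne
      apply hr
      have ha : ∀ k, k ≠ l → s k = r k := by
        by_contra hc
        exact hne (by simp only [onSite, if_neg hc, zero_mul])
      have hb : ∀ k, k ≠ m → r k = s' k := by
        by_contra hc
        exact hne (by simp only [onSite, if_neg hc, mul_zero])
      funext k
      by_cases hk : k = l
      · subst hk; simpa using hb k hlm
      · simpa [hk] using (ha k hk).symm
    · simp
  rw [key l m hlm, key m l hlm.symm]
  have h : (∀ k, k ≠ m → k ≠ l → s k = s' k) ↔ (∀ k, k ≠ l → k ≠ m → s k = s' k) :=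
    forall_congr' fun _ => ⟨fun h a b => h b a, fun h a b => h b a⟩
  simp only [h, mul_comm]

theorem Ensemble.hamiltonian_isHermitian (E : Ensemble) {N : ℕ} (p : Params E.n N) (j : Fin E.n) :
    (E.hamiltonian p j).IsHermitian := by
  have hreal : ∀ (b : Bool) (r : ℝ) (A : Op N), A.IsHermitian →
      ((if b then ((r : ℝ) : ℂ) else 0) • A).IsHermitian := by
    intro b r A hA
    unfold Matrix.IsHermitian
    rw [conjTranspose_smul, hA.eq]
    cases b <;> simp
  have hsum : ∀ {κ : Type} [Fintype κ] (F : κ → Op N), (∀ i, (F i).IsHermitian) →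
      (∑ i, F i).IsHermitian := by
    intro κ _ F hF
    unfold Matrix.IsHermitian
    rw [conjTranspose_sum]
    exact Finset.sum_congr rfl fun i _ => (hF i).eq
  refine Matrix.IsHermitian.add (hsum _ fun l => hsum _ fun u => hreal _ _ _
    (onSite_isHermitian l (pauli_isHermitian u))) (hsum _ fun l => hsum _ fun u => hsum _ fun v =>
      hreal _ _ _ ?_)
  have hne : bondLeft l ≠ bondRight l := by
    intro h
    have := congrArg Fin.val h
    simp [bondLeft, bondRight] at this
  unfold Matrix.IsHermitian
  rw [conjTranspose_mul, (onSite_isHermitian _ (pauli_isHermitian u)).eq,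
    (onSite_isHermitian _ (pauli_isHermitian v)).eq, onSite_commute hne]

theorem exp_unitary {N : ℕ} {H : Op N} (hH : H.IsHermitian) (r : ℝ) :
    NormedSpace.exp ((-Complex.I * (r : ℂ)) • H) ∈ unitary (Op N) := by
  have hstar : (NormedSpace.exp ((-Complex.I * (r : ℂ)) • H))ᴴ =
      NormedSpace.exp (-((-Complex.I * (r : ℂ)) • H)) := by
    rw [← exp_conjTranspose, conjTranspose_smul, hH.eq, ← neg_smul]
    congr 2
    simp
  have hu : IsUnit (NormedSpace.exp ((-Complex.I * (r : ℂ)) • H)).det :=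
    (isUnit_iff_isUnit_det _).1 (Matrix.isUnit_exp _)
  rw [Unitary.mem_iff, star_eq_conjTranspose, hstar, Matrix.exp_neg]
  exact ⟨nonsing_inv_mul _ hu, mul_nonsing_inv _ hu⟩

theorem Ensemble.evolution_unitary (E : Ensemble) {N : ℕ} (p : Params E.n N) (t : ℝ) :
    E.evolution p t ∈ unitary (Op N) := by
  have h : ∀ x, E.partialEvolution p x ∈ unitary (Op N) := by
    intro x
    refine list_prod_mem fun M hM => ?_
    rw [List.mem_reverse, List.mem_ofFn] at hM
    obtain ⟨j, rfl⟩ := hM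
    exact exp_unitary (E.hamiltonian_isHermitian p j) _
  exact mul_mem (h _) (pow_mem (h _) _)

theorem productState_normalized {N : ℕ} (φ : Fin N → QubitState) :
    star (productState φ) ⬝ᵥ productState φ = 1 := by
  have h1 : ∀ l, ∑ i, star ((φ l : EuclideanSpace ℂ (Fin 2)) i) *
      (φ l : EuclideanSpace ℂ (Fin 2)) i = 1 := by
    intro l
    have h2 : ‖(φ l : EuclideanSpace ℂ (Fin 2))‖ = 1 := by simp
    have h3 := EuclideanSpace.norm_sq_eq (φ l : EuclideanSpace ℂ (Fin 2))
    rw [h2] at h3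
    have h4 : ((∑ i, ‖(φ l : EuclideanSpace ℂ (Fin 2)) i‖ ^ 2 : ℝ) : ℂ) = 1 := by
      rw [← h3]; simp
    rw [← h4]
    push_cast
    exact Finset.sum_congr rfl fun i _ => by
      simpa using Complex.conj_mul' ((φ l : EuclideanSpace ℂ (Fin 2)) i)
  calc star (productState φ) ⬝ᵥ productState φ
      = ∑ s : Fin N → Fin 2, ∏ l, (star ((φ l : EuclideanSpace ℂ (Fin 2)) (s l)) *
          (φ l : EuclideanSpace ℂ (Fin 2)) (s l)) := by
        simp [dotProduct, productState, Finset.prod_mul_distrib]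
    _ = ∏ l, ∑ i, (star ((φ l : EuclideanSpace ℂ (Fin 2)) i) *
          (φ l : EuclideanSpace ℂ (Fin 2)) i) := by
        rw [Finset.prod_univ_sum, Fintype.piFinset_univ]
    _ = 1 := by simp only [h1, Finset.prod_const_one]

/-- The state at time `t` of the system that starts in the given product state. -/
def Ensemble.stateAt (E : Ensemble) {N : ℕ} (p : Params E.n N) (φ : Fin N → QubitState) (t : ℝ) :
    Config (Fin N) → ℂ :=
  E.evolution p t *ᵥ productState φ

theorem Ensemble.stateAt_normalized (E : Ensemble) {N : ℕ} (p : Params E.n N)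
    (φ : Fin N → QubitState) (t : ℝ) :
    star (E.stateAt p φ t) ⬝ᵥ E.stateAt p φ t = 1 := by
  have hU : (E.evolution p t)ᴴ * E.evolution p t = 1 := (E.evolution_unitary p t).1
  rw [stateAt, star_mulVec, ← dotProduct_mulVec, mulVec_mulVec, hU, one_mulVec,
    productState_normalized]

theorem partialTrace_density {N : ℕ} (S : Finset (Fin N)) (ψ : Config (Fin N) → ℂ)
    (hψ : star ψ ⬝ᵥ ψ = 1) :
    (partialTrace S (vecMulVec ψ (star ψ))).PosSemidef ∧
      (partialTrace S (vecMulVec ψ (star ψ))).trace = 1 := by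
  constructor
  · have h : partialTrace S (vecMulVec ψ (star ψ)) =
        ∑ c : Config {l // l ∉ S},
          vecMulVec (fun a => ψ (glue S a c)) (star fun a => ψ (glue S a c)) := by
      ext a b
      simp [partialTrace, Matrix.sum_apply, vecMulVec_apply]
    rw [h]
    exact posSemidef_sum _ fun c _ => posSemidef_vecMulVec_self_star _
  · rw [← hψ]
    have e : ∀ x : Config S × Config {l // l ∉ S},
        (Equiv.piEquivPiSubtypeProd (fun l => l ∈ S) (fun _ => Fin 2)).symm x =
          glue S x.1 x.2 := fun _ => rfl
    rw [dotProduct, ← Equiv.sum_comp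
      (Equiv.piEquivPiSubtypeProd (fun l => l ∈ S) (fun _ => Fin 2)).symm, Fintype.sum_prod_type]
    simp only [e, trace, diag, partialTrace, vecMulVec_apply, Pi.star_apply]
    exact Finset.sum_congr rfl fun a _ => Finset.sum_congr rfl fun c _ => mul_comm _ _

/-- The reduced density matrix of the subsystem `S` at time `t`. -/
def Ensemble.reducedState (E : Ensemble) {N : ℕ} (p : Params E.n N) (φ : Fin N → QubitState)
    (S : Finset (Fin N)) (t : ℝ) : Density (Config S) :=
  ⟨partialTrace S (vecMulVec (E.stateAt p φ t) (star (E.stateAt p φ t))),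
    partialTrace_density S _ (E.stateAt_normalized p φ t)⟩

/-! ### Approximately periodic functions -/

/-- The (upper) Lebesgue integral over `[0, 1)`. It is the Lebesgue integral if the integrand is
measurable, and bounding it is meaningful for every integrand. -/
def integralIco (F : ℝ → ENNReal) : ENNReal :=
  ⨅ (G : ℝ → ENNReal) (_ : Measurable G) (_ : ∀ x ∈ Set.Ico (0 : ℝ) 1, F x ≤ G x),
    ∫⁻ x in Set.Ico (0 : ℝ) 1, G x

theorem integralIco_eq {F : ℝ → ENNReal} (hF : Measurable F) :
    integralIco F = ∫⁻ x in Set.Ico (0 : ℝ) 1, F x := by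
  apply le_antisymm
  · exact iInf_le_of_le F (iInf_le_of_le hF (iInf_le_of_le (fun _ _ => le_rfl) le_rfl))
  · exact le_iInf fun G => le_iInf fun _ => le_iInf fun hG =>
      setLIntegral_mono' measurableSet_Ico hG

/-- `f` is `ε`-periodic with period `1`: for some function `fbar` on `[0, 1)`, the lower density
of the `m` for which the squared `L²` distance on `[0, 1)` of `f (m + ·)` to `fbar` is at most `ε`
is at least `1 - ε`. -/
def ApproxPeriodic (ε : ℝ) (f : ℝ → ℝ) : Prop :=
  ∃ fbar : ℝ → ℝ, 1 - ε ≤ Filter.liminf (fun M : ℕ =>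
    (Set.ncard {m : ℕ | m < M ∧
      integralIco (fun x => ENNReal.ofReal (|f (m + x) - fbar x| ^ 2)) ≤ ENNReal.ofReal ε} : ℝ) / M)
    Filter.atTop

/-! ### Properties of reduced density matrices -/

/-- A family of real-valued functions of density matrices, one for each size `N` of the system and
each subsystem `S` of the `N` qubits. -/
abbrev StateFunction : Type := ∀ (N : ℕ) (S : Finset (Fin N)), Density (Config S) → ℝ

/-- The subsystem `S` has at most `0.29248 N` qubits. -/
def Small {N : ℕ} (S : Finset (Fin N)) : Prop := (S.card : ℝ) ≤ 0.29248 * N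

/-- Perturbations of size `e ^ (-Ω(N))` in trace norm change `f` by `e ^ (-Ω(N))`. -/
def ExpContinuous (f : StateFunction) : Prop :=
  ∀ c : ℝ, 0 < c → ∃ c' : ℝ, 0 < c' ∧ ∃ N₀ : ℕ, ∀ N : ℕ, N₀ ≤ N →
    ∀ S : Finset (Fin N), Small S → ∀ ρ₁ ρ₂ : Density (Config S),
      traceNorm (ρ₁.1 - ρ₂.1) ≤ Real.exp (-c * N) →
        |f N S ρ₁ - f N S ρ₂| ≤ Real.exp (-c' * N)

/-- For all but a null set of systems in every ensemble with `α₁ˣ = α₁ᶻ = γ₁ᶻᶻ = 1`, the function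
`f` of the reduced density matrix of every small subsystem is `e ^ (-Ω(N))`-periodic with
probability `1 - e ^ (-Ω(N))` over Haar-random initial product states. The implied constants are
uniform in the ensemble, the system and the subsystem. -/
def AlmostAlwaysPeriodic (f : StateFunction) : Prop :=
  ∃ c : ℝ, 0 < c ∧ ∃ N₀ : ℕ, ∀ N : ℕ, N₀ ≤ N → ∀ S : Finset (Fin N), Small S →
    ∀ E : Ensemble, E.α E.first .x = true → E.α E.first .z = true →
      E.γ E.first .z .z = true →
      volume {p : Params E.n N |
        haarProduct N {φ | ApproxPeriodic (Real.exp (-c * N))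
          fun t => f N S (E.reducedState p φ S t)}ᶜ ≤ ENNReal.ofReal (Real.exp (-c * N))}ᶜ = 0

/-- The von Neumann entropy of the reduced density matrix, that is, the entanglement entropy
between the subsystem and its complement. -/
def entanglementEntropy : StateFunction := fun _ _ ρ => entropy ρ

end Floquet

end

open Floquet

/-! Let `z k` be the eigenvalues of the Floquet operator, `V` an eigenbasis and `c` the coordinates
of the initial state in it. After `m` periods and a fraction `x` of a period the state is `Y`
applied to `z k ^ m * c k`, where `Y = U(0, x) V`. Its reduction to `S` differs from that of the
dephased mixture of the columns of `Y`, with weights `‖c k‖ ^ 2`, by a trigonometric sum in `m` with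
frequencies `z j * star (z k)`, `j ≠ k`. The dephased state depends on `x` but not on `m`, so `f` of
it serves as the periodic comparison function.

If products of two eigenvalues coincide only trivially, these frequencies are distinct. The mean
over `m < M` of the squared Hilbert–Schmidt deviation is then at most `2 ^ |S| * ∑ ‖c k‖ ^ 4` up to
`O(1 / M)` (`sum_deviation_le`), and passing to the trace norm costs another `2 ^ |S|`. A
Haar-random product state overlaps any unit vector with fourth moment at most `3 ^ (-N)`
(`lintegral_overlap_pow_four_le`), so `∑ ‖c k‖ ^ 4` has mean at most `(2 / 3) ^ N`. Since `4 ^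
0.29248 < 3 / 2`, the deviation is exponentially small. Markov's inequality, over the initial state
and then over `m` (`approxPeriodic_of_average`), gives the claim. Where the deviation is not small,
only the total oscillation of `f` is available; `abs_sub_le_of_local` bounds it by an exponential
whose rate is small enough to be absorbed.

Absence of resonances is the nonvanishing of a discriminant that is analytic in the parameters, so
it holds off a null set as soon as it holds once (`measure_zeros_of_analytic`). The example is an
Ising chain acting in the first piece only, scaled down so that additive nonresonance of the
energies survives exponentiation. The chain is built spin by spin: a new spin in a strong tilted
field is weakly coupled to the end, and first-order perturbation theory lifts the remaining
degeneracies (`exists_noResonance_isingChain`).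

For the entropy, Klein's inequality against a slightly depolarized state gives a modulus of
continuity of order `τ log (D / τ)`. In dimension `D ≤ 2 ^ N` an exponentially small `τ` costs only
a factor linear in `N`. -/

namespace Floquet

/-! ### Trace norm and continuity of the entropy -/

section TraceNorm

variable {ι : Type} [Fintype ι] [DecidableEq ι]

/-- The columns of the unitary matrix `V` are eigenvectors of `A` with eigenvalues `d`. -/
def Diagonalizes (V : Matrix ι ι ℂ) (d : ι → ℂ) (A : Matrix ι ι ℂ) : Prop :=
  Vᴴ * V = 1 ∧ A = V * diagonal d * Vᴴ

theorem Diagonalizes.mul_conjTranspose {V : Matrix ι ι ℂ} {d : ι → ℂ} {A : Matrix ι ι ℂ}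
    (h : Diagonalizes V d A) : V * Vᴴ = 1 := mul_eq_one_comm.1 h.1

theorem Diagonalizes.conj {V : Matrix ι ι ℂ} {d : ι → ℂ} {A : Matrix ι ι ℂ}
    (h : Diagonalizes V d A) : Vᴴ * A * V = diagonal d := by
  calc Vᴴ * A * V = (Vᴴ * V) * diagonal d * (Vᴴ * V) := by
        rw [h.2]; simp only [Matrix.mul_assoc]
    _ = _ := by rw [h.1, Matrix.one_mul, Matrix.mul_one]

theorem Diagonalizes.mul {V : Matrix ι ι ℂ} {d e : ι → ℂ} {A B : Matrix ι ι ℂ}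
    (h : Diagonalizes V d A) (h' : Diagonalizes V e B) :
    Diagonalizes V (fun i => d i * e i) (A * B) := by
  refine ⟨h.1, ?_⟩
  rw [h.2, h'.2]
  calc _ = V * diagonal d * (Vᴴ * V) * diagonal e * Vᴴ := by simp only [Matrix.mul_assoc]
    _ = _ := by rw [h.1, Matrix.mul_one, Matrix.mul_assoc V, diagonal_mul_diagonal]

theorem Diagonalizes.trace_eq {V A : Matrix ι ι ℂ} {d : ι → ℂ} (h : Diagonalizes V d A) :
    A.trace = ∑ i, d i := by
  rw [h.2, trace_mul_comm, ← Matrix.mul_assoc, h.1, Matrix.one_mul, trace_diagonal]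

theorem exists_diagonalizes {A : Matrix ι ι ℂ} (hA : A.IsHermitian) :
    Diagonalizes hA.eigenvectorUnitary.1 (fun i => (hA.eigenvalues i : ℂ)) A := by
  refine ⟨(hA.eigenvectorUnitary).2.1, ?_⟩
  have h := hA.spectral_theorem
  rw [Unitary.conjStarAlgAut_apply] at h
  exact h

omit [DecidableEq ι] in
theorem conjTranspose_mul_self_apply_self (X : Matrix ι ι ℂ) (i : ι) :
    (Xᴴ * X) i i = ((∑ j, ‖X j i‖ ^ 2 : ℝ) : ℂ) := by
  rw [mul_apply]
  push_cast
  exact Finset.sum_congr rfl fun j _ => by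
    simpa using Complex.conj_mul' (X j i)

omit [DecidableEq ι] in
theorem mul_conjTranspose_self_apply_self (X : Matrix ι ι ℂ) (i : ι) :
    (X * Xᴴ) i i = ((∑ j, ‖X i j‖ ^ 2 : ℝ) : ℂ) := by
  rw [mul_apply]
  push_cast
  exact Finset.sum_congr rfl fun j _ => by
    simpa using Complex.mul_conj' (X i j)

omit [DecidableEq ι] in
theorem trace_conjTranspose_mul_self (X : Matrix ι ι ℂ) :
    (Xᴴ * X).trace = ((∑ i, ∑ j, ‖X i j‖ ^ 2 : ℝ) : ℂ) := by
  rw [trace, Finset.sum_comm]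
  simp only [diag_apply, conjTranspose_mul_self_apply_self]
  push_cast
  rfl

theorem sum_sq_col_of_unitary {V : Matrix ι ι ℂ} (h : Vᴴ * V = 1) (i : ι) :
    ∑ j, ‖V j i‖ ^ 2 = 1 := by
  have h1 := conjTranspose_mul_self_apply_self V i
  rw [h, one_apply_eq] at h1
  exact_mod_cast h1.symm

theorem sum_sq_row_of_unitary {V : Matrix ι ι ℂ} (h : V * Vᴴ = 1) (i : ι) :
    ∑ j, ‖V i j‖ ^ 2 = 1 := by
  have h1 := mul_conjTranspose_self_apply_self V i
  rw [h, one_apply_eq] at h1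
  exact_mod_cast h1.symm

/-- `Aᴴ * A` has characteristic roots `a i ^ 2`. Comparing root multisets identifies these with the
eigenvalues inside `traceNorm`, so no matching of eigenvectors or orderings is needed. -/
theorem traceNorm_eq_sum_abs {V A : Matrix ι ι ℂ} {a : ι → ℝ}
    (h : Diagonalizes V (fun i => (a i : ℂ)) A) : traceNorm A = ∑ i, |a i| := by
  have hsq : Aᴴ * A = V * diagonal (fun i => ((a i ^ 2 : ℝ) : ℂ)) * Vᴴ := by
    have hd : (diagonal fun i => (a i : ℂ))ᴴ = diagonal fun i => (a i : ℂ) := by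
      rw [diagonal_conjTranspose]; congr 1; ext i; simp
    rw [h.2, conjTranspose_mul, conjTranspose_mul, hd, conjTranspose_conjTranspose]
    calc _ = V * diagonal (fun i => (a i : ℂ)) * (Vᴴ * V) * diagonal (fun i => (a i : ℂ)) * Vᴴ := by
          simp only [Matrix.mul_assoc]
      _ = _ := by
        rw [h.1, Matrix.mul_one, Matrix.mul_assoc V, diagonal_mul_diagonal]
        congr 3; ext i; push_cast; ring
  have hc : (Aᴴ * A).charpoly = ∏ i, (Polynomial.X - Polynomial.C ((a i ^ 2 : ℝ) : ℂ)) := by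
    rw [hsq, charpoly_mul_comm, ← Matrix.mul_assoc, h.1, Matrix.one_mul, charpoly_diagonal]
  have hr := (isHermitian_conjTranspose_mul_self A).roots_charpoly_eq_eigenvalues
  have hroots : (∏ i, (Polynomial.X - Polynomial.C ((a i ^ 2 : ℝ) : ℂ))).roots =
      Finset.univ.val.map fun i => ((a i ^ 2 : ℝ) : ℂ) := by
    rw [← Polynomial.roots_multiset_prod_X_sub_C (Finset.univ.val.map _), Multiset.map_map]
    rfl
  rw [hc, hroots] at hr
  have h2 := congrArg (fun s : Multiset ℂ => (s.map fun z => Real.sqrt z.re).sum) hr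
  simp only [Multiset.map_map, Function.comp_def] at h2
  change ∑ i, Real.sqrt (((a i ^ 2 : ℝ) : ℂ)).re = ∑ i, Real.sqrt _ at h2
  simp only [Complex.ofReal_re, Real.sqrt_sq_eq_abs] at h2
  rw [h2]
  rfl

/-- Cauchy–Schwarz on the singular values, whose squares sum to the squared Hilbert–Schmidt norm.
The dimension factor is one of the two powers `2 ^ |S|` in the final estimate. -/
theorem traceNorm_sq_le (A : Matrix ι ι ℂ) :
    traceNorm A ^ 2 ≤ Fintype.card ι * ∑ i, ∑ j, ‖A i j‖ ^ 2 := by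
  have hH := isHermitian_conjTranspose_mul_self A
  have hnn : ∀ i, 0 ≤ hH.eigenvalues i := (posSemidef_conjTranspose_mul_self A).eigenvalues_nonneg
  have h1 : ∑ i, hH.eigenvalues i = ∑ i, ∑ j, ‖A i j‖ ^ 2 := by
    have h2 := hH.trace_eq_sum_eigenvalues
    rw [trace_conjTranspose_mul_self] at h2
    rw [← Complex.ofReal_inj, h2]
    push_cast
    rfl
  rw [← h1, traceNorm]
  refine (sq_sum_le_card_mul_sum_sq).trans ?_
  rw [Finset.card_univ]
  gcongr with i
  exact (Real.sq_sqrt (hnn i)).le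

/-- Insert a right singular basis `U` of `A`: the diagonal entries become `∑ i, X j i * Y i j`,
where the `i`-th column of `X` has norm equal to the `i`-th singular value and the rows of the
unitary `Y` are unit vectors. Cauchy–Schwarz in `j` finishes. -/
theorem sum_norm_diag_le_traceNorm (A : Matrix ι ι ℂ) {W : Matrix ι ι ℂ} (hW : Wᴴ * W = 1) :
    ∑ j, ‖(Wᴴ * A * W) j j‖ ≤ traceNorm A := by
  have hH := isHermitian_conjTranspose_mul_self A
  have hnn : ∀ i, 0 ≤ hH.eigenvalues i := (posSemidef_conjTranspose_mul_self A).eigenvalues_nonneg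
  obtain ⟨hU, hd⟩ := exists_diagonalizes hH
  set U : Matrix ι ι ℂ := hH.eigenvectorUnitary.1
  have hU' : U * Uᴴ = 1 := mul_eq_one_comm.1 hU
  have hW' : W * Wᴴ = 1 := mul_eq_one_comm.1 hW
  set X := Wᴴ * A * U
  set Y := Uᴴ * W
  have hXY : Wᴴ * A * W = X * Y := by
    simp only [X, Y]
    rw [Matrix.mul_assoc, Matrix.mul_assoc _ U, ← Matrix.mul_assoc U, hU', Matrix.one_mul,
      Matrix.mul_assoc]
  have hY : ∀ i, ∑ j, ‖Y i j‖ ^ 2 = 1 := by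
    apply sum_sq_row_of_unitary
    simp only [Y, conjTranspose_mul, conjTranspose_conjTranspose]
    rw [Matrix.mul_assoc, ← Matrix.mul_assoc W, hW', Matrix.one_mul, hU]
  have hX : ∀ i, ∑ j, ‖X j i‖ ^ 2 = hH.eigenvalues i := by
    intro i
    have h1 := conjTranspose_mul_self_apply_self X i
    have h2 : Xᴴ * X = diagonal fun i => (hH.eigenvalues i : ℂ) := by
      calc Xᴴ * X = Uᴴ * (Aᴴ * (W * Wᴴ) * A) * U := by
            simp only [X, conjTranspose_mul, conjTranspose_conjTranspose, Matrix.mul_assoc]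
        _ = _ := by rw [hW', Matrix.mul_one, Diagonalizes.conj ⟨hU, hd⟩]
    rw [h2, diagonal_apply_eq] at h1
    exact_mod_cast h1.symm
  calc ∑ j, ‖(Wᴴ * A * W) j j‖ ≤ ∑ j, ∑ i, ‖X j i‖ * ‖Y i j‖ := by
        refine Finset.sum_le_sum fun j _ => ?_
        rw [hXY, mul_apply]
        exact (norm_sum_le _ _).trans (Finset.sum_le_sum fun i _ => norm_mul_le _ _)
    _ = ∑ i, ∑ j, ‖X j i‖ * ‖Y i j‖ := Finset.sum_comm
    _ ≤ traceNorm A := by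
        refine Finset.sum_le_sum fun i _ => ?_
        refine (Real.sum_mul_le_sqrt_mul_sqrt _ _ _).trans ?_
        rw [hX, hY, Real.sqrt_one, mul_one]

theorem sum_diag_re_eq_one {A : Matrix ι ι ℂ} (hA : A.trace = 1) {W : Matrix ι ι ℂ}
    (hW : Wᴴ * W = 1) : ∑ j, ((Wᴴ * A * W) j j).re = 1 := by
  have h : (Wᴴ * A * W).trace = 1 := by
    rw [trace_mul_comm, ← Matrix.mul_assoc, mul_eq_one_comm.1 hW, Matrix.one_mul, hA]
  rw [← Complex.re_sum]
  have := congrArg Complex.re h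
  simpa [trace] using this

omit [DecidableEq ι] in
theorem norm_diag_eq_re {A : Matrix ι ι ℂ} (hA : A.PosSemidef) (W : Matrix ι ι ℂ) (j : ι) :
    ‖(Wᴴ * A * W) j j‖ = ((Wᴴ * A * W) j j).re := by
  have h := (hA.conjTranspose_mul_mul_same W).diag_nonneg (i := j)
  obtain ⟨h1, h2⟩ := Complex.le_def.1 h
  rw [Complex.norm_eq_sqrt_sq_add_sq, ← h2]
  simpa using Real.sqrt_sq h1

/-- In an eigenbasis of the difference, each eigenvalue is a difference of diagonal entries of the
two states; these are nonnegative and sum to `1` for each state. -/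
theorem traceNorm_smul_sub_le (ρ₁ ρ₂ : Density ι) (s : ℝ) :
    traceNorm ((s : ℂ) • (ρ₁.1 - ρ₂.1)) ≤ 2 * |s| := by
  have hH : (ρ₁.1 - ρ₂.1).IsHermitian := ρ₁.2.1.isHermitian.sub ρ₂.2.1.isHermitian
  obtain ⟨hU, hd⟩ := exists_diagonalizes hH
  set U : Matrix ι ι ℂ := hH.eigenvectorUnitary.1
  have h1 : Diagonalizes U (fun i => ((s * hH.eigenvalues i : ℝ) : ℂ))
      ((s : ℂ) • (ρ₁.1 - ρ₂.1)) := by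
    refine ⟨hU, ?_⟩
    have h3 : diagonal (fun i => ((s * hH.eigenvalues i : ℝ) : ℂ)) =
        (s : ℂ) • diagonal (fun i => (hH.eigenvalues i : ℂ)) := by
      rw [← diagonal_smul]
      congr 1; ext i; simp
    rw [h3, Matrix.mul_smul, Matrix.smul_mul]
    exact congrArg _ hd
  rw [traceNorm_eq_sum_abs h1]
  have h2 : ∀ i, |s * hH.eigenvalues i| ≤
      |s| * (((Uᴴ * ρ₁.1 * U) i i).re + ((Uᴴ * ρ₂.1 * U) i i).re) := by
    intro i
    have h4 := Diagonalizes.conj ⟨hU, hd⟩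
    have h5 := congrFun (congrFun h4 i) i
    rw [diagonal_apply_eq, Matrix.mul_sub, Matrix.sub_mul, Matrix.sub_apply] at h5
    have h6 := congrArg norm h5
    rw [Complex.norm_real, Real.norm_eq_abs] at h6
    rw [abs_mul, ← h6]
    gcongr
    exact (norm_sub_le _ _).trans_eq (congrArg₂ _ (norm_diag_eq_re ρ₁.2.1 U i) (norm_diag_eq_re ρ₂.2.1 U i))
  refine (Finset.sum_le_sum fun i _ => h2 i).trans ?_
  rw [← Finset.mul_sum, Finset.sum_add_distrib, sum_diag_re_eq_one ρ₁.2.2 hU, sum_diag_re_eq_one ρ₂.2.2 hU]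
  linarith

theorem trace_mul_cfc_log {A : Matrix ι ι ℂ} (hA : A.IsHermitian) :
    (A * hA.cfc Real.log).trace =
      ((∑ i, hA.eigenvalues i * Real.log (hA.eigenvalues i) : ℝ) : ℂ) := by
  have h := exists_diagonalizes hA
  have hc : Diagonalizes hA.eigenvectorUnitary.1
      (fun i => ((Real.log (hA.eigenvalues i) : ℝ) : ℂ)) (hA.cfc Real.log) := by
    refine ⟨h.1, ?_⟩
    rw [IsHermitian.cfc, Unitary.conjStarAlgAut_apply]
    rfl
  rw [(h.mul hc).trace_eq]
  push_cast
  rfl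

theorem entropy_eq (ρ : Density ι) :
    entropy ρ = -∑ i, ρ.2.1.isHermitian.eigenvalues i *
      Real.log (ρ.2.1.isHermitian.eigenvalues i) := by
  rw [entropy, trace_mul_cfc_log, Complex.ofReal_re]

/-- The inequality `log x ≤ x - 1` at `x = w / r`; this is the scalar form of Klein's inequality. -/
theorem sub_le_mul_log_sub {r w : ℝ} (hr : 0 ≤ r) (hw : 0 < w) :
    r - w ≤ r * Real.log r - r * Real.log w := by
  rcases hr.eq_or_lt with rfl | hr
  · simpa using hw.le
  · have h := Real.log_le_sub_one_of_pos (div_pos hw hr)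
    rw [Real.log_div hw.ne' hr.ne'] at h
    have h2 := mul_le_mul_of_nonneg_left h hr.le
    have h3 : r * (w / r - 1) = w - r := by field_simp
    nlinarith

theorem density_eigenvalues (ρ : Density ι) :
    (∀ i, 0 ≤ ρ.2.1.isHermitian.eigenvalues i) ∧ ∑ i, ρ.2.1.isHermitian.eigenvalues i = 1 := by
  refine ⟨ρ.2.1.eigenvalues_nonneg, ?_⟩
  have h := (exists_diagonalizes ρ.2.1.isHermitian).trace_eq
  rw [← Complex.ofReal_sum] at h
  have h2 := ρ.2.2.symm.trans h
  exact_mod_cast h2.symm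

/-- A relative entropy argument in the eigenbasis of `σ`. Klein's inequality bounds the entropy of
`ρ` by its cross entropy with a regularization of `σ`. Replacing `ρ` by `σ` in this cross entropy
costs `τ` times the largest logarithm, and undoing the regularization costs at most `log (1 + τ) ≤
τ`. -/
theorem entropy_sub_le (ρ σ : Density ι) {τ : ℝ} (hτ : 0 < τ)
    (h : traceNorm (ρ.1 - σ.1) ≤ τ) :
    entropy ρ - entropy σ ≤ τ * Real.log (Fintype.card ι * (1 + τ) / τ) + τ := by
  obtain ⟨hr0, hr1⟩ := density_eigenvalues ρ
  obtain ⟨hs0, hs1⟩ := density_eigenvalues σ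
  have hρd := exists_diagonalizes ρ.2.1.isHermitian
  have hσd := exists_diagonalizes σ.2.1.isHermitian
  rw [entropy_eq, entropy_eq]
  set r := ρ.2.1.isHermitian.eigenvalues
  set s := σ.2.1.isHermitian.eigenvalues
  set U := ρ.2.1.isHermitian.eigenvectorUnitary.1
  set W := σ.2.1.isHermitian.eigenvectorUnitary.1
  -- The doubly stochastic matrix of squared overlaps between the two eigenbases; it turns the
  -- matrix form of Klein's inequality into a weighted sum of scalar ones.
  set P : ι → ι → ℝ := fun i j => ‖(Uᴴ * W) i j‖ ^ 2
  have hPr : ∀ i, ∑ j, P i j = 1 := by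
    apply sum_sq_row_of_unitary
    rw [conjTranspose_mul, conjTranspose_conjTranspose, Matrix.mul_assoc, ← Matrix.mul_assoc W,
      hσd.mul_conjTranspose, Matrix.one_mul, hρd.1]
  have hPc : ∀ j, ∑ i, P i j = 1 := by
    apply sum_sq_col_of_unitary
    rw [conjTranspose_mul, conjTranspose_conjTranspose, Matrix.mul_assoc, ← Matrix.mul_assoc U,
      hρd.mul_conjTranspose, Matrix.one_mul, hσd.1]
  set q : ι → ℝ := fun j => ∑ i, P i j * r i
  have hq : ∀ j, ((Wᴴ * ρ.1 * W) j j) = (q j : ℂ) := by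
    intro j
    have h1 : Wᴴ * ρ.1 * W = (Uᴴ * W)ᴴ * (diagonal (fun i => (r i : ℂ)) * (Uᴴ * W)) := by
      refine (congrArg (fun X => Wᴴ * X * W) hρd.2).trans ?_
      rw [conjTranspose_mul, conjTranspose_conjTranspose]
      simp only [Matrix.mul_assoc]
    rw [h1, mul_apply]
    simp only [q, P, diagonal_mul, conjTranspose_apply]
    push_cast
    refine Finset.sum_congr rfl fun i _ => ?_
    rw [← Complex.conj_mul']
    simp only [RCLike.star_def]
    ring
  have hsd : ∀ j, (Wᴴ * σ.1 * W) j j = (s j : ℂ) := by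
    intro j
    have := congrFun (congrFun hσd.conj j) j
    rw [diagonal_apply_eq] at this
    exact this
  have hT : ∑ j, |s j - q j| ≤ τ := by
    refine le_trans (le_of_eq (Finset.sum_congr rfl fun j _ => ?_))
      ((sum_norm_diag_le_traceNorm (ρ.1 - σ.1) hσd.1).trans h)
    rw [Matrix.mul_sub, Matrix.sub_mul, Matrix.sub_apply]
    refine Eq.trans ?_ (congrArg₂ (fun x y : ℂ => ‖x - y‖) (hq j) (hsd j)).symm
    rw [← Complex.ofReal_sub, Complex.norm_real, Real.norm_eq_abs, abs_sub_comm]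
  have hne : Nonempty ι := by
    by_contra hc
    rw [not_nonempty_iff] at hc
    simp at hr1
  have hD : (1 : ℝ) ≤ Fintype.card ι := by exact_mod_cast Fintype.card_pos
  set D : ℝ := (Fintype.card ι : ℝ)
  have hD0 : 0 < D := by linarith
  -- Eigenvalues of the normalized mixture of `σ` with `τ` times the maximally mixed state, which
  -- keeps the logarithms bounded when `σ` is singular.
  set w : ι → ℝ := fun j => (s j + τ / D) / (1 + τ)
  have hτD : 0 < τ / D := by positivity
  have hw : ∀ j, τ / D / (1 + τ) ≤ w j := fun j => by
    simp only [w]; gcongr; linarith [hs0 j]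
  have hw0 : ∀ j, 0 < w j := fun j => lt_of_lt_of_le (by positivity) (hw j)
  have hs_le : ∀ j, s j ≤ 1 := fun j => by
    rw [← hs1]; exact Finset.single_le_sum (fun i _ => hs0 i) (Finset.mem_univ j)
  have hw1 : ∀ j, w j ≤ 1 := fun j => by
    simp only [w]
    rw [div_le_one (by linarith)]
    have : τ / D ≤ τ := div_le_self hτ.le hD
    linarith [hs_le j]
  have hwsum : ∑ j, w j = 1 := by
    simp only [w]
    rw [← Finset.sum_div, Finset.sum_add_distrib, hs1, Finset.sum_const, Finset.card_univ,
      nsmul_eq_mul]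
    change (1 + D * (τ / D)) / (1 + τ) = 1
    rw [mul_div_cancel₀ _ hD0.ne', div_self (by linarith)]
  have klein : ∑ j, q j * Real.log (w j) ≤ ∑ i, r i * Real.log (r i) := by
    have h1 : ∑ i, ∑ j, P i j * (r i - w j) ≤
        ∑ i, ∑ j, P i j * (r i * Real.log (r i) - r i * Real.log (w j)) :=
      Finset.sum_le_sum fun i _ => Finset.sum_le_sum fun j _ =>
        mul_le_mul_of_nonneg_left (sub_le_mul_log_sub (hr0 i) (hw0 j)) (sq_nonneg _)
    have h2 : ∑ i, ∑ j, P i j * (r i - w j) = 0 := by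
      simp only [mul_sub, Finset.sum_sub_distrib, ← Finset.sum_mul, hPr, one_mul, hr1]
      rw [Finset.sum_comm]
      simp only [← Finset.sum_mul, hPc, one_mul, hwsum, sub_self]
    have h3 : ∑ i, ∑ j, P i j * (r i * Real.log (r i) - r i * Real.log (w j)) =
        ∑ i, r i * Real.log (r i) - ∑ j, q j * Real.log (w j) := by
      simp only [mul_sub, Finset.sum_sub_distrib, ← Finset.sum_mul, hPr, one_mul]
      congr 1
      rw [Finset.sum_comm]
      simp only [q, Finset.sum_mul, mul_assoc]
    rw [h2, h3] at h1
    linarith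
  have hlog : ∀ j, |Real.log (w j)| ≤ Real.log (D * (1 + τ) / τ) := by
    intro j
    rw [abs_of_nonpos (Real.log_nonpos (hw0 j).le (hw1 j)), ← Real.log_inv]
    refine Real.log_le_log (inv_pos.2 (hw0 j)) ?_
    rw [inv_le_comm₀ (hw0 j) (by positivity)]
    refine le_trans (le_of_eq ?_) (hw j)
    field_simp
  have h1 : ∑ j, (s j - q j) * Real.log (w j) ≤ τ * Real.log (D * (1 + τ) / τ) := by
    have hL : 0 ≤ Real.log (D * (1 + τ) / τ) := (abs_nonneg _).trans (hlog hne.some)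
    calc _ ≤ ∑ j, |s j - q j| * Real.log (D * (1 + τ) / τ) := by
          refine Finset.sum_le_sum fun j _ => ?_
          refine (le_abs_self _).trans ?_
          rw [abs_mul]
          exact mul_le_mul_of_nonneg_left (hlog j) (abs_nonneg _)
      _ ≤ _ := by
          rw [← Finset.sum_mul]
          exact mul_le_mul_of_nonneg_right hT hL
  -- Termwise `s j ≤ (1 + τ) * w j`, so each logarithm of the ratio is at most `log (1 + τ) ≤ τ`.
  have h2 : ∑ j, (s j * Real.log (s j) - s j * Real.log (w j)) ≤ τ := by
    calc _ ≤ ∑ j, s j * τ := by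
          refine Finset.sum_le_sum fun j _ => ?_
          rw [← mul_sub]
          rcases (hs0 j).eq_or_lt with h0 | h0
          · rw [← h0]; simp
          · refine mul_le_mul_of_nonneg_left ?_ h0.le
            rw [← Real.log_div h0.ne' (hw0 j).ne']
            refine le_trans (Real.log_le_log (div_pos h0 (hw0 j)) (y := 1 + τ) ?_) ?_
            · rw [div_le_iff₀ (hw0 j)]
              simp only [w]
              rw [mul_div_cancel₀ _ (by linarith : (1 + τ) ≠ 0)]
              linarith
            · have := Real.log_le_sub_one_of_pos (x := 1 + τ) (by linarith)
              linarith
      _ = τ := by rw [← Finset.sum_mul, hs1, one_mul]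
  have h3 : ∑ j, (s j - q j) * Real.log (w j) +
      ∑ j, (s j * Real.log (s j) - s j * Real.log (w j)) =
      ∑ j, s j * Real.log (s j) - ∑ j, q j * Real.log (w j) := by
    rw [← Finset.sum_add_distrib, ← Finset.sum_sub_distrib]
    exact Finset.sum_congr rfl fun j _ => by ring
  linarith

end TraceNorm

theorem expContinuous_entanglementEntropy : ExpContinuous entanglementEntropy := by
  intro c hc
  -- Half of the exponent pays for the factor `N + 1 + c * N + 1`. With `y = c * N / 2`, the
  -- threshold makes the term `y ^ 2 / 2` of `exp y` at least `(3 + c) * N`.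
  refine ⟨c / 2, by positivity, max 1 ⌈8 * (3 + c) / c ^ 2⌉₊, fun N hN S _ => ?_⟩
  have hN1 : (1 : ℝ) ≤ N := by exact_mod_cast (le_max_left _ _).trans hN
  have hN2 : 8 * (3 + c) / c ^ 2 ≤ N :=
    (Nat.le_ceil _).trans (by exact_mod_cast (le_max_right _ _).trans hN)
  have hτ : 0 < Real.exp (-c * N) := Real.exp_pos _
  have hτ1 : Real.exp (-c * N) ≤ 1 := by
    rw [Real.exp_le_one_iff]; nlinarith
  have hbound : Real.exp (-c * N) * Real.log (Fintype.card (Config S) * (1 + Real.exp (-c * N)) /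
      Real.exp (-c * N)) + Real.exp (-c * N) ≤ Real.exp (-(c / 2) * N) := by
    have hcard : (Fintype.card (Config S) : ℝ) = 2 ^ S.card := by simp
    have h1 : Real.log (Fintype.card (Config S) * (1 + Real.exp (-c * N)) / Real.exp (-c * N)) ≤
        N + 1 + c * N := by
      rw [hcard, Real.log_div (by positivity) (by positivity), Real.log_mul (by positivity)
        (by positivity), Real.log_exp, Real.log_pow]
      have h2 : (S.card : ℝ) ≤ N := by
        exact_mod_cast (Finset.card_le_univ S).trans_eq (Fintype.card_fin N)
      have h3 : Real.log 2 ≤ 1 := by linarith [Real.log_two_lt_d9]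
      have h4 : Real.log (1 + Real.exp (-c * N)) ≤ Real.exp (-c * N) := by
        have := Real.log_le_sub_one_of_pos (x := 1 + Real.exp (-c * N)) (by positivity)
        linarith
      have h5 : (S.card : ℝ) * Real.log 2 ≤ S.card * 1 := by gcongr
      linarith
    have h2 : N + 1 + c * N + 1 ≤ Real.exp (c / 2 * N) := by
      have h3 := Real.quadratic_le_exp_of_nonneg (x := c / 2 * N) (by positivity)
      rw [div_le_iff₀ (by positivity)] at hN2
      nlinarith [mul_nonneg hc.le (by linarith : (0 : ℝ) ≤ N)]
    have h3 : Real.exp (-(c / 2) * N) = Real.exp (-c * N) * Real.exp (c / 2 * N) := by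
      rw [← Real.exp_add]; ring_nf
    rw [h3]
    nlinarith
  intro ρ₁ ρ₂ h
  have h' : traceNorm (ρ₂.1 - ρ₁.1) ≤ Real.exp (-c * N) := by
    refine le_trans (le_of_eq ?_) h
    have hH : (ρ₁.1 - ρ₂.1).IsHermitian := ρ₁.2.1.isHermitian.sub ρ₂.2.1.isHermitian
    have h1 := exists_diagonalizes hH
    have h2 : Diagonalizes hH.eigenvectorUnitary.1 (fun i => ((-hH.eigenvalues i : ℝ) : ℂ))
        (ρ₂.1 - ρ₁.1) := by
      refine ⟨h1.1, ?_⟩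
      have h3 : diagonal (fun i => ((-hH.eigenvalues i : ℝ) : ℂ)) =
          -diagonal (fun i => (hH.eigenvalues i : ℂ)) := by
        rw [diagonal_neg]; congr 1; ext i; simp
      rw [h3, Matrix.mul_neg, Matrix.neg_mul, ← h1.2, neg_sub]
    rw [traceNorm_eq_sum_abs h1, traceNorm_eq_sum_abs h2]
    simp
  exact abs_le.2 ⟨by
    have := (entropy_sub_le ρ₂ ρ₁ hτ h').trans hbound
    simp only [entanglementEntropy]
    linarith, (entropy_sub_le ρ₁ ρ₂ hτ h).trans hbound⟩

/-! ### Total oscillation of a locally controlled function -/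

section Segment

variable {ι : Type} [Fintype ι] [DecidableEq ι]

omit [DecidableEq ι] in
theorem density_mix (ρ₁ ρ₂ : Density ι) {s : ℝ} (h0 : 0 ≤ s) (h1 : s ≤ 1) :
    (ρ₁.1 + (s : ℂ) • (ρ₂.1 - ρ₁.1)).PosSemidef ∧
      (ρ₁.1 + (s : ℂ) • (ρ₂.1 - ρ₁.1)).trace = 1 := by
  constructor
  · have h : ρ₁.1 + (s : ℂ) • (ρ₂.1 - ρ₁.1) =
        ((1 - s : ℝ) : ℂ) • ρ₁.1 + (s : ℂ) • ρ₂.1 := by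
      push_cast
      rw [sub_smul, smul_sub, one_smul]
      abel
    rw [h]
    refine (ρ₁.2.1.smul ?_).add (ρ₂.2.1.smul ?_)
    · exact_mod_cast sub_nonneg.2 h1
    · exact_mod_cast h0
  · rw [trace_add, trace_smul, trace_sub, ρ₁.2.2, ρ₂.2.2]
    simp

/-- Two states are at trace distance at most `2`, so the segment between them splits into `K` steps
of length at most `2 / K ≤ δ`. This gives a bound on the oscillation of `f` although no boundedness
is assumed. -/
theorem abs_sub_le_of_local {f : Density ι → ℝ} {δ η : ℝ}
    (hf : ∀ ρ₁ ρ₂ : Density ι, traceNorm (ρ₁.1 - ρ₂.1) ≤ δ → |f ρ₁ - f ρ₂| ≤ η)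
    {K : ℕ} (hK : 0 < K) (hKδ : 2 / (K : ℝ) ≤ δ) (ρ₁ ρ₂ : Density ι) :
    |f ρ₁ - f ρ₂| ≤ K * η := by
  have hK' : (0 : ℝ) < K := by exact_mod_cast hK
  have hmem : ∀ k : ℕ, 0 ≤ min ((k : ℝ) / K) 1 ∧ min ((k : ℝ) / K) 1 ≤ 1 := fun k =>
    ⟨le_min (by positivity) zero_le_one, min_le_right _ _⟩
  let path : ℕ → Density ι := fun k => ⟨_, density_mix ρ₁ ρ₂ (hmem k).1 (hmem k).2⟩
  have h0 : path 0 = ρ₁ := by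
    apply Subtype.ext
    simp [path]
  have hlast : path K = ρ₂ := by
    apply Subtype.ext
    simp [path, hK'.ne']
  have hstep : ∀ k, k < K → |f (path k) - f (path (k + 1))| ≤ η := by
    intro k hk
    apply hf
    have h1 : min ((k : ℝ) / K) 1 = k / K := min_eq_left (by
      rw [div_le_one hK']; exact_mod_cast hk.le)
    have h2 : min (((k + 1 : ℕ) : ℝ) / K) 1 = (k + 1) / K := by
      rw [min_eq_left]
      · push_cast; rfl
      · rw [div_le_one hK']; exact_mod_cast hk
    have h3 : (path k).1 - (path (k + 1)).1 = ((1 / K : ℝ) : ℂ) • (ρ₁.1 - ρ₂.1) := by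
      change (ρ₁.1 + ((min ((k : ℝ) / K) 1 : ℝ) : ℂ) • (ρ₂.1 - ρ₁.1)) -
        (ρ₁.1 + ((min (((k + 1 : ℕ) : ℝ) / K) 1 : ℝ) : ℂ) • (ρ₂.1 - ρ₁.1)) = _
      rw [h1, h2, add_sub_add_left_eq_sub, ← sub_smul, ← neg_sub ρ₁.1 ρ₂.1, smul_neg, ← neg_smul]
      congr 1
      push_cast
      ring
    rw [h3]
    refine (traceNorm_smul_sub_le _ _ _).trans ?_
    rw [abs_of_nonneg (by positivity)]
    refine le_trans (le_of_eq ?_) hKδ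
    ring
  have hind : ∀ k, k ≤ K → |f ρ₁ - f (path k)| ≤ k * η := by
    intro k
    induction k with
    | zero => intro _; rw [h0]; simp
    | succ k ih =>
      intro hk
      have h1 := ih (by omega)
      have h2 := hstep k (by omega)
      have h3 := abs_sub_le (f ρ₁) (f (path k)) (f (path (k + 1)))
      push_cast
      linarith
  have := hind K le_rfl
  rwa [hlast] at this

end Segment

/-! ### Fourth moments of Haar-random product states -/

section Sphere

open Metric Set

variable {E : Type*} [NormedAddCommGroup E] [InnerProductSpace ℝ E] [FiniteDimensional ℝ E]
  [MeasurableSpace E] [BorelSpace E]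

/-- The action of a linear isometry on the unit sphere. -/
def sphereMap (f : E ≃ₗᵢ[ℝ] E) (x : sphere (0 : E) 1) : sphere (0 : E) 1 :=
  ⟨f x, by simp⟩

omit [FiniteDimensional ℝ E] [MeasurableSpace E] [BorelSpace E] in
theorem continuous_sphereMap (f : E ≃ₗᵢ[ℝ] E) : Continuous (sphereMap f) :=
  Continuous.subtype_mk (f.continuous.comp continuous_subtype_val) _

/-- The spherical measure of a set is proportional to the volume of the cone over it, and linear
isometries commute with taking cones and preserve volume. -/
theorem measurePreserving_sphereMap (f : E ≃ₗᵢ[ℝ] E) :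
    MeasurePreserving (sphereMap f) (volume : Measure E).toSphere
      (volume : Measure E).toSphere := by
  refine ⟨(continuous_sphereMap f).measurable, ?_⟩
  ext s hs
  have hm := (continuous_sphereMap f).measurable hs
  rw [Measure.map_apply (continuous_sphereMap f).measurable hs, Measure.toSphere_apply' _ hs,
    Measure.toSphere_apply' _ hm]
  congr 1
  conv_rhs => rw [← f.measurePreserving.measure_preimage_equiv (f := f.toMeasurableEquiv)]
  congr 1
  ext x
  simp only [Set.mem_smul, mem_image, mem_preimage, LinearIsometryEquiv.coe_toMeasurableEquiv]
  constructor
  · rintro ⟨r, hr, _, ⟨y, hy, rfl⟩, rfl⟩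
    exact ⟨r, hr, _, ⟨sphereMap f y, hy, rfl⟩, by simp [sphereMap]⟩
  · rintro ⟨r, hr, _, ⟨y, hy, rfl⟩, h⟩
    refine ⟨r, hr, _, ⟨sphereMap f.symm y, ?_, rfl⟩, ?_⟩
    · convert hy
      simp [sphereMap]
    · apply f.injective
      simp [sphereMap, h]

end Sphere

instance : IsProbabilityMeasure haarQubit := by
  refine ⟨?_⟩
  rw [haarQubit, Measure.smul_apply, smul_eq_mul]
  refine ENNReal.inv_mul_cancel ?_ (measure_ne_top _ _)
  rw [Ne, Measure.measure_univ_eq_zero]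
  exact Measure.toSphere_ne_zero _

theorem integrable_haarQubit {g : QubitState → ℝ} (hg : Continuous g) :
    Integrable g haarQubit :=
  hg.integrable_of_hasCompactSupport (HasCompactSupport.of_compactSpace g)

/-- The linear isometry of the state space of a qubit with a given unitary matrix. -/
noncomputable def qubitIsometry (a b c d : ℂ)
    (h : ∀ x y : ℂ, ‖a * x + b * y‖ ^ 2 + ‖c * x + d * y‖ ^ 2 = ‖x‖ ^ 2 + ‖y‖ ^ 2) :
    EuclideanSpace ℂ (Fin 2) ≃ₗᵢ[ℝ] EuclideanSpace ℂ (Fin 2) :=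
  LinearIsometry.toLinearIsometryEquiv
    { toFun := fun v => !₂[a * v 0 + b * v 1, c * v 0 + d * v 1]
      map_add' := fun v w => by
        ext i; fin_cases i <;> simp <;> ring
      map_smul' := fun r v => by
        ext i; fin_cases i <;> simp <;> ring
      norm_map' := fun v => by
        have := h (v 0) (v 1)
        rw [← sq_eq_sq₀ (norm_nonneg _) (norm_nonneg _), EuclideanSpace.norm_sq_eq,
          EuclideanSpace.norm_sq_eq]
        simpa using this } rfl

theorem integral_haarQubit_comp (a b c d : ℂ)
    (h : ∀ x y : ℂ, ‖a * x + b * y‖ ^ 2 + ‖c * x + d * y‖ ^ 2 = ‖x‖ ^ 2 + ‖y‖ ^ 2)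
    {g : ℂ → ℂ → ℝ} (hg : Continuous fun z : ℂ × ℂ => g z.1 z.2) :
    ∫ φ : QubitState, g (a * φ.1 0 + b * φ.1 1) (c * φ.1 0 + d * φ.1 1) ∂haarQubit =
      ∫ φ : QubitState, g (φ.1 0) (φ.1 1) ∂haarQubit := by
  have hp : MeasurePreserving (sphereMap (qubitIsometry a b c d h)) haarQubit haarQubit :=
    (measurePreserving_sphereMap _).smul_measure _
  have hc : Continuous fun φ : QubitState => g (φ.1 0) (φ.1 1) :=
    hg.comp (by fun_prop : Continuous fun φ : QubitState => (φ.1 0, φ.1 1))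
  conv_rhs => rw [← hp.map_eq]
  rw [integral_map hp.measurable.aemeasurable hc.aestronglyMeasurable]
  rfl

theorem qubit_norm_sq (φ : QubitState) : ‖φ.1 0‖ ^ 2 + ‖φ.1 1‖ ^ 2 = 1 := by
  have h : ‖φ.1‖ = 1 := by simp
  have h2 := EuclideanSpace.norm_sq_eq φ.1
  rw [h] at h2
  simpa using h2.symm


theorem two_mul_re_sq_add_im_sq (z : ℂ) : z.re ^ 2 + z.im ^ 2 = ‖z‖ ^ 2 := by
  rw [Complex.sq_norm, Complex.normSq_apply]; ring

/-- Each integrand is odd under the symmetry that negates the second amplitude. -/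
theorem integral_qubit_mul_cross :
    (∫ φ : QubitState, ‖φ.1 0‖ ^ 2 * (φ.1 0 * star (φ.1 1)).re ∂haarQubit = 0) ∧
    (∫ φ : QubitState, ‖φ.1 0‖ ^ 2 * (φ.1 0 * star (φ.1 1)).im ∂haarQubit = 0) ∧
    (∫ φ : QubitState, ‖φ.1 1‖ ^ 2 * (φ.1 0 * star (φ.1 1)).re ∂haarQubit = 0) ∧
    (∫ φ : QubitState, ‖φ.1 1‖ ^ 2 * (φ.1 0 * star (φ.1 1)).im ∂haarQubit = 0) ∧
    (∫ φ : QubitState, (φ.1 0 * star (φ.1 1)).re ∂haarQubit = 0) := by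
  have key : ∀ g : ℂ → ℂ → ℝ, (Continuous fun z : ℂ × ℂ => g z.1 z.2) →
      (∀ x y, g x (-y) = -g x y) → ∫ φ : QubitState, g (φ.1 0) (φ.1 1) ∂haarQubit = 0 := by
    intro g hg hodd
    have h := integral_haarQubit_comp 1 0 0 (-1) (by simp) hg
    simp only [one_mul, zero_mul, add_zero, zero_add, neg_mul, hodd, integral_neg] at h
    linarith
  refine ⟨key (fun x y => ‖x‖ ^ 2 * (x * star y).re) (by fun_prop) (by simp; intros; ring),
    key (fun x y => ‖x‖ ^ 2 * (x * star y).im) (by fun_prop) (by simp; intros; ring),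
    key (fun x y => ‖y‖ ^ 2 * (x * star y).re) (by fun_prop) (by simp; intros; ring),
    key (fun x y => ‖y‖ ^ 2 * (x * star y).im) (by fun_prop) (by simp; intros; ring),
    key (fun x y => (x * star y).re) (by fun_prop) (by simp)⟩

theorem integral_qubit_re_mul_im :
    ∫ φ : QubitState, (φ.1 0 * star (φ.1 1)).re * (φ.1 0 * star (φ.1 1)).im ∂haarQubit = 0 := by
  have h := integral_haarQubit_comp 1 0 0 Complex.I (by simp)
    (g := fun x y => (x * star y).re * (x * star y).im) (by fun_prop)
  have h2 : ∀ x y : ℂ, (x * star (Complex.I * y)).re * (x * star (Complex.I * y)).im =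
      -((x * star y).re * (x * star y).im) := by
    intro x y; simp; ring
  simp only [one_mul, zero_mul, add_zero, zero_add, h2, integral_neg] at h
  linarith

theorem integral_qubit_re_sq_eq_im_sq :
    ∫ φ : QubitState, (φ.1 0 * star (φ.1 1)).re ^ 2 ∂haarQubit =
      ∫ φ : QubitState, (φ.1 0 * star (φ.1 1)).im ^ 2 ∂haarQubit := by
  have h := integral_haarQubit_comp 1 0 0 Complex.I (by simp)
    (g := fun x y => (x * star y).re ^ 2) (by fun_prop)
  have h2 : ∀ x y : ℂ, (x * star (Complex.I * y)).re ^ 2 = (x * star y).im ^ 2 := by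
    intro x y; simp; ring
  simp only [one_mul, zero_mul, add_zero, zero_add, h2] at h
  exact h.symm

theorem integral_qubit_swap :
    ∫ φ : QubitState, ‖φ.1 1‖ ^ 4 ∂haarQubit = ∫ φ : QubitState, ‖φ.1 0‖ ^ 4 ∂haarQubit := by
  have h := integral_haarQubit_comp 0 1 1 0 (by intros; simp; ring)
    (g := fun x y => ‖x‖ ^ 4) (by fun_prop)
  simpa using h

theorem norm_add_div_sqrt_two_pow_four (x y : ℂ) :
    ‖((1 / Real.sqrt 2 : ℝ) : ℂ) * x + ((1 / Real.sqrt 2 : ℝ) : ℂ) * y‖ ^ 4 =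
      (‖x‖ ^ 2 + ‖y‖ ^ 2 + 2 * (x * star y).re) ^ 2 / 4 := by
  have h : ‖x + y‖ ^ 2 = ‖x‖ ^ 2 + ‖y‖ ^ 2 + 2 * (x * star y).re := by
    simp only [Complex.sq_norm, Complex.normSq_add]
    rfl
  rw [← mul_add, norm_mul, mul_pow, Complex.norm_real, Real.norm_of_nonneg (by positivity), ← h]
  have h2 : Real.sqrt 2 ^ 4 = 4 := by
    rw [show Real.sqrt 2 ^ 4 = (Real.sqrt 2 ^ 2) ^ 2 by ring, Real.sq_sqrt (by norm_num)]
    norm_num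
  rw [div_pow, h2]
  ring

/-- Symmetry yields enough linear equations to avoid integrating. With `a = E‖φ 0‖ ^ 4`, `b = E‖φ 0‖
^ 2 ‖φ 1‖ ^ 2` and `r` the mean square of the real part of the coherence, normalization and the swap
give `2 a + 2 b = 1`, the phase rotation gives `2 r = b`, and the Hadamard rotation gives `a = 1 / 4
+ r`. -/
theorem integral_qubit_moments :
    (∫ φ : QubitState, ‖φ.1 0‖ ^ 4 ∂haarQubit = 1 / 3) ∧
    (∫ φ : QubitState, ‖φ.1 1‖ ^ 4 ∂haarQubit = 1 / 3) ∧
    (∫ φ : QubitState, ‖φ.1 0‖ ^ 2 * ‖φ.1 1‖ ^ 2 ∂haarQubit = 1 / 6) ∧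
    (∫ φ : QubitState, (φ.1 0 * star (φ.1 1)).re ^ 2 ∂haarQubit = 1 / 12) ∧
    (∫ φ : QubitState, (φ.1 0 * star (φ.1 1)).im ^ 2 ∂haarQubit = 1 / 12) := by
  have i1 : Integrable (fun φ : QubitState => ‖φ.1 0‖ ^ 4) haarQubit :=
    integrable_haarQubit (by fun_prop)
  have i2 : Integrable (fun φ : QubitState => ‖φ.1 1‖ ^ 4) haarQubit :=
    integrable_haarQubit (by fun_prop)
  have i3 : Integrable (fun φ : QubitState => ‖φ.1 0‖ ^ 2 * ‖φ.1 1‖ ^ 2) haarQubit :=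
    integrable_haarQubit (by fun_prop)
  have i4 : Integrable (fun φ : QubitState => (φ.1 0 * star (φ.1 1)).re ^ 2) haarQubit :=
    integrable_haarQubit (by fun_prop)
  have i5 : Integrable (fun φ : QubitState => (φ.1 0 * star (φ.1 1)).im ^ 2) haarQubit :=
    integrable_haarQubit (by fun_prop)
  have i6 : Integrable (fun φ : QubitState => (φ.1 0 * star (φ.1 1)).re) haarQubit :=
    integrable_haarQubit (by fun_prop)
  have hsum : ∫ φ : QubitState, (‖φ.1 0‖ ^ 4 + ‖φ.1 1‖ ^ 4 + 2 * (‖φ.1 0‖ ^ 2 * ‖φ.1 1‖ ^ 2))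
      ∂haarQubit = 1 := by
    have : ∀ φ : QubitState,
        ‖φ.1 0‖ ^ 4 + ‖φ.1 1‖ ^ 4 + 2 * (‖φ.1 0‖ ^ 2 * ‖φ.1 1‖ ^ 2) = 1 := fun φ => by
      have := qubit_norm_sq φ
      nlinarith
    simp [this]
  rw [integral_add (by exact i1.add i2) (i3.const_mul 2), integral_add i1 i2,
    integral_const_mul] at hsum
  have hreim : (∫ φ : QubitState, (φ.1 0 * star (φ.1 1)).re ^ 2 ∂haarQubit) +
      ∫ φ : QubitState, (φ.1 0 * star (φ.1 1)).im ^ 2 ∂haarQubit =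
      ∫ φ : QubitState, ‖φ.1 0‖ ^ 2 * ‖φ.1 1‖ ^ 2 ∂haarQubit := by
    rw [← integral_add i4 i5]
    congr 1
    ext φ
    rw [two_mul_re_sq_add_im_sq, norm_mul, mul_pow, norm_star]
  have hhad := integral_haarQubit_comp ((1 / Real.sqrt 2 : ℝ) : ℂ) ((1 / Real.sqrt 2 : ℝ) : ℂ)
    ((1 / Real.sqrt 2 : ℝ) : ℂ) (-((1 / Real.sqrt 2 : ℝ) : ℂ)) (by
      intro x y
      have h2 : (1 / Real.sqrt 2) ^ 2 = 1 / 2 := by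
        rw [div_pow, Real.sq_sqrt (by norm_num)]; norm_num
      rw [neg_mul, ← sub_eq_add_neg, ← mul_add, ← mul_sub, norm_mul, norm_mul, mul_pow, mul_pow,
        Complex.norm_real, Real.norm_of_nonneg (by positivity), h2]
      have := parallelogram_law_with_norm ℝ x y
      nlinarith) (g := fun x y => ‖x‖ ^ 4) (by fun_prop)
  simp only [norm_add_div_sqrt_two_pow_four] at hhad
  have hexp : ∀ φ : QubitState, (‖φ.1 0‖ ^ 2 + ‖φ.1 1‖ ^ 2 + 2 * (φ.1 0 * star (φ.1 1)).re) ^ 2 / 4 =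
      1 / 4 + (φ.1 0 * star (φ.1 1)).re + (φ.1 0 * star (φ.1 1)).re ^ 2 := fun φ => by
    rw [qubit_norm_sq]; ring
  simp only [hexp] at hhad
  rw [integral_add (by exact (integrable_const _).add i6) i4, integral_add (integrable_const _) i6,
    integral_qubit_mul_cross.2.2.2.2] at hhad
  simp only [integral_const, probReal_univ, smul_eq_mul] at hhad
  have h1 := integral_qubit_re_sq_eq_im_sq
  have h2 := integral_qubit_swap
  refine ⟨?_, ?_, ?_, ?_, ?_⟩ <;> linarith

/-- The integrand is the square of a positive quadratic form with Gram matrix `G`, and its mean is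
`((tr G) ^ 2 + tr (G ^ 2)) / 6`. Positivity, used as the Cauchy–Schwarz bound `|C| ^ 2 ≤ A * B`,
gives `tr (G ^ 2) ≤ (tr G) ^ 2`. -/
theorem integral_qubit_quadratic_sq_le {κ : Type*} [Fintype κ] (v : Fin 2 → κ → ℂ) :
    ∫ φ : QubitState, (∑ k, ‖φ.1 0 * v 0 k + φ.1 1 * v 1 k‖ ^ 2) ^ 2 ∂haarQubit ≤
      1 / 3 * (∑ k, ‖v 0 k‖ ^ 2 + ∑ k, ‖v 1 k‖ ^ 2) ^ 2 := by
  set A := ∑ k, ‖v 0 k‖ ^ 2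
  set B := ∑ k, ‖v 1 k‖ ^ 2
  set C : ℂ := ∑ k, v 0 k * star (v 1 k)
  have hC : C.re ^ 2 + C.im ^ 2 ≤ A * B := by
    rw [two_mul_re_sq_add_im_sq]
    have h1 : ‖C‖ ≤ ∑ k, ‖v 0 k‖ * ‖v 1 k‖ := by
      refine (norm_sum_le _ _).trans (Finset.sum_le_sum fun k _ => ?_)
      rw [norm_mul, norm_star]
    have h2 := Finset.sum_mul_sq_le_sq_mul_sq Finset.univ (fun k => ‖v 0 k‖) (fun k => ‖v 1 k‖)
    exact (pow_le_pow_left₀ (norm_nonneg _) h1 2).trans h2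
  have hexp : ∀ φ : QubitState, ∑ k, ‖φ.1 0 * v 0 k + φ.1 1 * v 1 k‖ ^ 2 =
      A * ‖φ.1 0‖ ^ 2 + B * ‖φ.1 1‖ ^ 2 + 2 * C.re * (φ.1 0 * star (φ.1 1)).re -
        2 * C.im * (φ.1 0 * star (φ.1 1)).im := by
    intro φ
    have h1 : ∀ k, ‖φ.1 0 * v 0 k + φ.1 1 * v 1 k‖ ^ 2 = ‖v 0 k‖ ^ 2 * ‖φ.1 0‖ ^ 2 +
        ‖v 1 k‖ ^ 2 * ‖φ.1 1‖ ^ 2 + 2 * (v 0 k * star (v 1 k)).re * (φ.1 0 * star (φ.1 1)).re -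
        2 * (v 0 k * star (v 1 k)).im * (φ.1 0 * star (φ.1 1)).im := by
      intro k
      simp only [Complex.sq_norm, Complex.normSq_apply, Complex.add_re, Complex.add_im,
        Complex.mul_re, Complex.mul_im, RCLike.star_def, Complex.conj_re, Complex.conj_im]
      ring
    simp only [h1, Finset.sum_sub_distrib, Finset.sum_add_distrib, ← Finset.sum_mul,
      ← Finset.mul_sum, ← Complex.re_sum, ← Complex.im_sum]
    rfl
  obtain ⟨m1, m2, m3, m4, m5⟩ := integral_qubit_moments
  obtain ⟨o1, o2, o3, o4, -⟩ := integral_qubit_mul_cross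
  have o5 := integral_qubit_re_mul_im
  have hval : ∫ φ : QubitState, (∑ k, ‖φ.1 0 * v 0 k + φ.1 1 * v 1 k‖ ^ 2) ^ 2 ∂haarQubit =
      A ^ 2 * (1 / 3) + B ^ 2 * (1 / 3) + 2 * A * B * (1 / 6) + 4 * C.re ^ 2 * (1 / 12) +
        4 * C.im ^ 2 * (1 / 12) := by
    have e : ∀ φ : QubitState, (∑ k, ‖φ.1 0 * v 0 k + φ.1 1 * v 1 k‖ ^ 2) ^ 2 =
        A ^ 2 * ‖φ.1 0‖ ^ 4 + (B ^ 2 * ‖φ.1 1‖ ^ 4 + (2 * A * B * (‖φ.1 0‖ ^ 2 * ‖φ.1 1‖ ^ 2) +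
        (4 * C.re ^ 2 * (φ.1 0 * star (φ.1 1)).re ^ 2 +
        (4 * C.im ^ 2 * (φ.1 0 * star (φ.1 1)).im ^ 2 +
        (4 * A * C.re * (‖φ.1 0‖ ^ 2 * (φ.1 0 * star (φ.1 1)).re) +
        (-4 * A * C.im * (‖φ.1 0‖ ^ 2 * (φ.1 0 * star (φ.1 1)).im) +
        (4 * B * C.re * (‖φ.1 1‖ ^ 2 * (φ.1 0 * star (φ.1 1)).re) +
        (-4 * B * C.im * (‖φ.1 1‖ ^ 2 * (φ.1 0 * star (φ.1 1)).im) +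
        (-8 * C.re * C.im * ((φ.1 0 * star (φ.1 1)).re * (φ.1 0 * star (φ.1 1)).im)))))))))) :=
      fun φ => by rw [hexp]; ring
    simp only [e]
    iterate 9 rw [integral_add (integrable_haarQubit (by fun_prop))
      (integrable_haarQubit (by fun_prop)), integral_const_mul]
    rw [integral_const_mul, m1, m2, m3, m4, m5, o1, o2, o3, o4, o5]
    ring
  rw [hval]
  nlinarith

theorem measurable_productState {N : ℕ} (s : Config (Fin N)) :
    Measurable fun φ : Fin N → QubitState => productState φ s := by
  unfold productState
  refine Finset.measurable_prod _ fun l _ => ?_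
  have h : Continuous fun φ : Fin N → QubitState => (φ l).1 (s l) := by fun_prop
  exact h.measurable

/-- Induction on the number of qubits, with a factor `1 / 3` per qubit. Contracting `v` with the
first qubit leaves a random vector on the rest, whose squared norm is a quadratic form in that
qubit's state. No product structure of `v` is needed. -/
theorem lintegral_overlap_pow_four_le (N : ℕ) (v : Config (Fin N) → ℂ) :
    ∫⁻ φ, ENNReal.ofReal (‖v ⬝ᵥ productState φ‖ ^ 4) ∂haarProduct N ≤
      ENNReal.ofReal ((1 / 3) ^ N * (∑ s, ‖v s‖ ^ 2) ^ 2) := by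
  induction N with
  | zero =>
    have h : ∀ φ : Fin 0 → QubitState, ‖v ⬝ᵥ productState φ‖ ^ 4 = (∑ s, ‖v s‖ ^ 2) ^ 2 := by
      intro φ
      rw [dotProduct, Fintype.sum_unique, Fintype.sum_unique]
      simp only [productState, Finset.univ_eq_empty, Finset.prod_empty, mul_one]
      ring
    simp only [h]
    rw [lintegral_const, haarProduct]
    simp
  | succ N ih =>
    set w : QubitState → Config (Fin N) → ℂ := fun p s =>
      p.1 0 * v (Fin.cons 0 s) + p.1 1 * v (Fin.cons 1 s)
    have hmp := measurePreserving_piFinSuccAbove (fun _ : Fin (N + 1) => haarQubit) 0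
    set G : QubitState × (Fin N → QubitState) → ENNReal := fun x =>
      ENNReal.ofReal (‖w x.1 ⬝ᵥ productState x.2‖ ^ 4)
    have hG : Measurable G := by
      refine ENNReal.measurable_ofReal.comp ((Measurable.norm ?_).pow_const 4)
      simp only [dotProduct]
      refine Finset.measurable_sum _ fun s _ => Measurable.mul ?_
        ((measurable_productState s).comp measurable_snd)
      have : Continuous fun p : QubitState => w p s := by simp only [w]; fun_prop
      exact this.measurable.comp measurable_fst
    have hF : ∀ φ : Fin (N + 1) → QubitState, ENNReal.ofReal (‖v ⬝ᵥ productState φ‖ ^ 4) =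
        G (MeasurableEquiv.piFinSuccAbove (fun _ => QubitState) 0 φ) := by
      intro φ
      have h1 : v ⬝ᵥ productState φ = w (φ 0) ⬝ᵥ productState (fun j : Fin N => φ j.succ) := by
        rw [dotProduct, ← (Fin.consEquiv fun _ : Fin (N + 1) => Fin 2).sum_comp,
          Fintype.sum_prod_type, Fin.sum_univ_two, ← Finset.sum_add_distrib]
        refine Finset.sum_congr rfl fun s _ => ?_
        simp only [w, productState, Fin.consEquiv_apply, Fin.prod_univ_succ, Fin.cons_zero,
          Fin.cons_succ]
        change v (Fin.cons 0 s) * _ + v (Fin.cons 1 s) * _ = _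
        ring
      rw [h1]
      rfl
    simp only [hF]
    rw [haarProduct, hmp.lintegral_comp hG, lintegral_prod _ hG.aemeasurable]
    calc _ ≤ ∫⁻ p, ENNReal.ofReal ((1 / 3) ^ N * (∑ s, ‖w p s‖ ^ 2) ^ 2) ∂haarQubit :=
          lintegral_mono fun p => ih (w p)
      _ = ENNReal.ofReal (∫ p, (1 / 3) ^ N * (∑ s, ‖w p s‖ ^ 2) ^ 2 ∂haarQubit) := by
          rw [ofReal_integral_eq_lintegral_ofReal (integrable_haarQubit (by
            simp only [w]; fun_prop)) (Filter.Eventually.of_forall fun p => by positivity)]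
      _ ≤ _ := by
          refine ENNReal.ofReal_le_ofReal ?_
          rw [integral_const_mul, pow_succ, mul_assoc]
          refine mul_le_mul_of_nonneg_left ?_ (by positivity)
          refine (integral_qubit_quadratic_sq_le fun a s => v (Fin.cons a s)).trans (le_of_eq ?_)
          rw [← (Fin.consEquiv fun _ : Fin (N + 1) => Fin 2).sum_comp (fun s => ‖v s‖ ^ 2),
            Fintype.sum_prod_type, Fin.sum_univ_two]
          rfl

/-! ### First-order perturbation of eigenvalues and expectations -/

section Perturbation

open Filter Topology

variable {κ : Type} [Fintype κ] [DecidableEq κ]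

omit [DecidableEq κ] in
theorem star_dotProduct_self_eq (v : κ → ℂ) : star v ⬝ᵥ v = ((∑ i, ‖v i‖ ^ 2 : ℝ) : ℂ) := by
  rw [dotProduct]
  push_cast
  exact Finset.sum_congr rfl fun j _ => by simpa using Complex.conj_mul' (v j)

theorem sum_norm_sq_mulVec {X : Matrix κ κ ℂ} (hX : Xᴴ * X = 1) (v : κ → ℂ) :
    ∑ i, ‖(X *ᵥ v) i‖ ^ 2 = ∑ i, ‖v i‖ ^ 2 := by
  have h : star (X *ᵥ v) ⬝ᵥ (X *ᵥ v) = star v ⬝ᵥ v := by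
    rw [star_mulVec, ← dotProduct_mulVec, mulVec_mulVec, hX, one_mulVec]
  rw [star_dotProduct_self_eq, star_dotProduct_self_eq] at h
  exact_mod_cast h

theorem norm_entry_le_one_of_unitary {W : Matrix κ κ ℂ} (hW : Wᴴ * W = 1) (i j : κ) :
    ‖W i j‖ ≤ 1 := by
  have h := sum_sq_col_of_unitary hW j
  have h2 := Finset.single_le_sum (f := fun i => ‖W i j‖ ^ 2) (fun _ _ => sq_nonneg _)
    (Finset.mem_univ i)
  simp only [h] at h2
  exact (sq_le_one_iff₀ (norm_nonneg _)).1 h2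

theorem norm_conj_entry_le {W : Matrix κ κ ℂ} (hW : Wᴴ * W = 1) (C : Matrix κ κ ℂ) (m m' : κ) :
    ‖(Wᴴ * C * W) m m'‖ ≤ ∑ i, ∑ j, ‖C i j‖ := by
  rw [mul_apply]
  simp only [mul_apply, Finset.sum_mul]
  rw [Finset.sum_comm]
  refine (norm_sum_le _ _).trans (Finset.sum_le_sum fun i _ => ?_)
  refine (norm_sum_le _ _).trans (Finset.sum_le_sum fun j _ => ?_)
  rw [norm_mul, norm_mul, conjTranspose_apply, norm_star]
  have h1 := norm_entry_le_one_of_unitary hW i m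
  have h2 := norm_entry_le_one_of_unitary hW j m'
  calc ‖W i m‖ * ‖C i j‖ * ‖W j m'‖ ≤ 1 * ‖C i j‖ * 1 := by gcongr
    _ = _ := by ring

omit [DecidableEq κ] in
theorem exists_gap {lam : κ → ℝ} (hlam : Function.Injective lam) :
    ∃ g > 0, ∀ k l, k ≠ l → g ≤ |lam k - lam l| := by
  rcases isEmpty_or_nonempty {p : κ × κ // p.1 ≠ p.2} with h | h
  · exact ⟨1, one_pos, fun k l hkl => (h.false ⟨(k, l), hkl⟩).elim⟩
  · obtain ⟨p, hp⟩ := Finite.exists_min fun p : {p : κ × κ // p.1 ≠ p.2} =>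
      |lam p.1.1 - lam p.1.2|
    exact ⟨_, abs_pos.2 (sub_ne_zero.2 (hlam.ne p.2)), fun k l hkl => hp ⟨(k, l), hkl⟩⟩

theorem Diagonalizes.reindex {W A : Matrix κ κ ℂ} {d : κ → ℂ} (h : Diagonalizes W d A)
    (e : κ ≃ κ) : Diagonalizes (W.submatrix id e) (d ∘ e) A := by
  constructor
  · rw [conjTranspose_submatrix, ← submatrix_mul _ _ e id e Function.bijective_id, h.1,
      submatrix_one_equiv]
  · have h1 : diagonal (d ∘ e) = (diagonal d).submatrix e e := by
      rw [submatrix_diagonal_equiv]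
    rw [h1, conjTranspose_submatrix, submatrix_mul_equiv, submatrix_mul_equiv, ← h.2]
    rfl

/-- The first order correction of the `k`-th eigenvector of `diagonal lam` under the perturbation
`B`. -/
noncomputable def firstOrderVector (lam : κ → ℝ) (B : Matrix κ κ ℂ) (k : κ) : κ → ℂ := fun l =>
  if l = k then 0 else B l k / ((lam k : ℂ) - lam l)

/-- The first-order vector solves the linearized eigenvalue equation, so the terms of order `J`
cancel and the residual is exactly quadratic. -/
theorem quasimode_residual {lam : κ → ℝ} (hlam : Function.Injective lam) {B : Matrix κ κ ℂ}
    (hB : B.IsHermitian) (J : ℝ) (k : κ) :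
    (diagonal (fun i => (lam i : ℂ)) + (J : ℂ) • B) *ᵥ
        (Pi.single k 1 + (J : ℂ) • firstOrderVector lam B k) -
      ((lam k + J * (B k k).re : ℝ) : ℂ) • (Pi.single k 1 + (J : ℂ) • firstOrderVector lam B k) =
    ((J ^ 2 : ℝ) : ℂ) • (B *ᵥ firstOrderVector lam B k - B k k • firstOrderVector lam B k) := by
  have hbk : ((B k k).re : ℂ) = B k k := hB.coe_re_apply_self k
  ext l
  simp only [add_mulVec, mulVec_add, mulVec_smul, smul_mulVec, mulVec_single_one, Pi.add_apply,
    Pi.sub_apply, Pi.smul_apply, smul_eq_mul, mulVec_diagonal, col_apply]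
  push_cast
  rw [hbk]
  by_cases h : l = k
  · subst h
    simp [firstOrderVector]
    ring
  · have hne : (lam k : ℂ) - lam l ≠ 0 := by
      rw [sub_ne_zero]
      exact_mod_cast hlam.ne (Ne.symm h)
    have hw : firstOrderVector lam B k l * ((lam k : ℂ) - lam l) = B l k := by
      rw [firstOrderVector, if_neg h, div_mul_cancel₀ _ hne]
    simp only [Pi.single_eq_of_ne h, Matrix.add_apply, Matrix.smul_apply, diagonal_apply_ne _ h,
      smul_eq_mul]
    linear_combination (-(J : ℂ)) * hw

theorem quasimode_norm (lam : κ → ℝ) (B : Matrix κ κ ℂ) (J : ℝ) (k : κ) :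
    ∑ l, ‖((Pi.single k 1 + (J : ℂ) • firstOrderVector lam B k : κ → ℂ)) l‖ ^ 2 =
      1 + J ^ 2 * ∑ l, ‖firstOrderVector lam B k l‖ ^ 2 := by
  have h : ∀ l, ‖((Pi.single k 1 + (J : ℂ) • firstOrderVector lam B k : κ → ℂ)) l‖ ^ 2 =
      (if l = k then 1 else 0) + J ^ 2 * ‖firstOrderVector lam B k l‖ ^ 2 := by
    intro l
    by_cases h : l = k
    · subst h; simp [firstOrderVector]
    · simp [h, mul_pow]
  simp only [h, Finset.sum_add_distrib, Finset.sum_ite_eq', Finset.mem_univ, if_true,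
    Finset.mul_sum]

/-- An approximate eigenvector has small components along eigenvectors whose eigenvalue is far from
the approximate one. -/
theorem quasimode_coefficient {A U : Matrix κ κ ℂ} {ν : κ → ℂ} (h : Diagonalizes U ν A)
    {v r : κ → ℂ} {μ c : ℂ} (hr : A *ᵥ v - μ • v = c • r) (m : κ) :
    (ν m - μ) * (Uᴴ *ᵥ v) m = c * (Uᴴ *ᵥ r) m := by
  have h1 : Uᴴ * A = diagonal ν * Uᴴ := by
    rw [h.2, Matrix.mul_assoc, ← Matrix.mul_assoc Uᴴ, h.1, Matrix.one_mul]
  have h2 := congrFun (congrArg (fun x => Uᴴ *ᵥ x) hr) m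
  simp only [mulVec_sub, mulVec_smul, mulVec_mulVec, h1] at h2
  rw [← mulVec_mulVec] at h2
  simp only [Pi.sub_apply, mulVec_diagonal, Pi.smul_apply, smul_eq_mul] at h2
  rw [sub_mul, h2]

-- A quantitative substitute for differentiating eigenvectors. The vectors `e k + J w k` solve the
-- eigenvalue equation up to `O(J ^ 2)`; since the unperturbed spectrum is simple, each lies within
-- `O(J ^ 2)` of a single exact eigenvector up to phase. Expectations of `C` do not see this phase,
-- so they can be computed on the approximate vectors.
set_option maxHeartbeats 800000 in
theorem exists_perturbed_eigenbasis {lam : κ → ℝ} (hlam : Function.Injective lam)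
    {B : Matrix κ κ ℂ} (hB : B.IsHermitian) (C : Matrix κ κ ℂ) :
    ∃ K : ℝ, ∀ᶠ J : ℝ in 𝓝[>] 0, ∃ (W : Matrix κ κ ℂ) (μ : κ → ℝ),
      Diagonalizes W (fun k => (μ k : ℂ)) (diagonal (fun i => (lam i : ℂ)) + (J : ℂ) • B) ∧
      ∀ k, |μ k - (lam k + J * (B k k).re)| ≤ K * J ^ 2 ∧
        ‖(Wᴴ * C * W) k k - (C k k + J * ((C *ᵥ firstOrderVector lam B k) k +
          (star (firstOrderVector lam B k) ᵥ* C) k))‖ ≤ K * J ^ 2 := by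
  obtain ⟨g, hg, hgap⟩ := exists_gap hlam
  set w := firstOrderVector lam B
  set r : κ → κ → ℂ := fun k => B *ᵥ w k - B k k • w k
  set β : ℝ := ∑ k, ‖B k k‖
  set R : ℝ := 1 + ∑ k, ∑ l, ‖r k l‖ ^ 2
  set ω : ℝ := ∑ k, ∑ l, ‖w k l‖ ^ 2
  set Γ : ℝ := ∑ i, ∑ j, ‖C i j‖
  set D : ℝ := 4 * R / g
  set n : ℝ := (Fintype.card κ : ℝ)
  have hΓ : 0 ≤ Γ := by positivity
  have hω : 0 ≤ ω := by positivity
  have hR1 : 1 ≤ R := le_add_of_nonneg_right (by positivity)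
  have hD : 0 ≤ D := by positivity
  have hn : 0 ≤ n := by positivity
  have hβ : ∀ k, |(B k k).re| ≤ β := fun k => (Complex.abs_re_le_norm _).trans
    (Finset.single_le_sum (f := fun k => ‖B k k‖) (fun _ _ => norm_nonneg _) (Finset.mem_univ k))
  have hrR : ∀ k, ∑ l, ‖r k l‖ ^ 2 < R ^ 2 := fun k => by
    have h1 := Finset.single_le_sum (f := fun k => ∑ l, ‖r k l‖ ^ 2)
      (fun _ _ => by positivity) (Finset.mem_univ k)
    have h2 : R ≤ R ^ 2 := by nlinarith
    simp only [R] at h2 ⊢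
    linarith
  have hwω : ∀ k, ∑ l, ‖w k l‖ ^ 2 ≤ ω := fun k =>
    Finset.single_le_sum (f := fun k => ∑ l, ‖w k l‖ ^ 2)
      (fun _ _ => by positivity) (Finset.mem_univ k)
  have hΓC : ∀ W : Matrix κ κ ℂ, Wᴴ * W = 1 → ∀ m m', ‖(Wᴴ * C * W) m m'‖ ≤ Γ :=
    fun W hW => norm_conj_entry_le hW C
  have hDdef : D = 4 * R / g := rfl
  have hndef : n = Fintype.card κ := rfl
  clear_value β ω Γ n D R
  have hsmall : ∀ c ε : ℝ, 0 < ε → ∀ᶠ J : ℝ in 𝓝[>] 0, c * J < ε := fun c ε hε => by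
    have : Tendsto (fun J : ℝ => c * J) (𝓝[>] 0) (𝓝 0) :=
      ((continuous_const.mul continuous_id).tendsto' 0 0 (by simp)).mono_left nhdsWithin_le_nhds
    exact this.eventually_lt_const hε
  refine ⟨max R (n * (n * (Γ * (2 * D + ω + n * D))) + ∑ k, ‖(star (w k) ⬝ᵥ (C *ᵥ w k))‖), ?_⟩
  filter_upwards [self_mem_nhdsWithin, hsmall 1 1 one_pos, hsmall (2 * β) (g / 4) (by positivity),
    hsmall R (g / 8) (by positivity), hsmall D 1 one_pos, hsmall ω 1 one_pos]
    with J hJ0 hJ1 hJβ hJR hJD hJω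
  replace hJ0 : 0 < J := hJ0
  rw [one_mul] at hJ1
  have hJsq : J ^ 2 ≤ J := by nlinarith
  have hHerm : (diagonal (fun i => (lam i : ℂ)) + (J : ℂ) • B).IsHermitian := by
    refine IsHermitian.add ?_ ?_
    · rw [IsHermitian, diagonal_conjTranspose]
      congr 1; ext i; simp
    · rw [IsHermitian, conjTranspose_smul, hB.eq]
      simp
  have hdU := exists_diagonalizes hHerm
  set U := hHerm.eigenvectorUnitary.1
  set ν := hHerm.eigenvalues
  set v : κ → κ → ℂ := fun k => Pi.single k 1 + (J : ℂ) • w k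
  set μ₀ : κ → ℝ := fun k => lam k + J * (B k k).re
  have hUU : Uᴴᴴ * Uᴴ = 1 := by rw [conjTranspose_conjTranspose]; exact hdU.mul_conjTranspose
  have hnv : ∀ k, ∑ l, ‖v k l‖ ^ 2 = 1 + J ^ 2 * ∑ l, ‖w k l‖ ^ 2 := quasimode_norm lam B J
  have hcoef : ∀ k m, |ν m - μ₀ k| * ‖(Uᴴ *ᵥ v k) m‖ = J ^ 2 * ‖(Uᴴ *ᵥ r k) m‖ := by
    intro k m
    have h := congrArg norm
      (quasimode_coefficient hdU (quasimode_residual hlam hB J k) m)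
    rwa [norm_mul, norm_mul, ← Complex.ofReal_sub, Complex.norm_real, Complex.norm_real,
      Real.norm_eq_abs, Real.norm_of_nonneg (sq_nonneg J)] at h
  -- If every exact eigenvalue were farther away, summing the squared coefficient identities by
  -- Parseval would make the residual norm at least `R * J ^ 2`, against the choice of `R`.
  have hex : ∀ k, ∃ m, |ν m - μ₀ k| ≤ R * J ^ 2 := by
    intro k
    by_contra! hc
    have h1 : ∑ m, (R * J ^ 2) ^ 2 * ‖(Uᴴ *ᵥ v k) m‖ ^ 2 ≤
        ∑ m, (J ^ 2) ^ 2 * ‖(Uᴴ *ᵥ r k) m‖ ^ 2 := by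
      refine Finset.sum_le_sum fun m _ => ?_
      rw [← mul_pow, ← mul_pow, ← hcoef]
      have := (hc m).le
      gcongr
    rw [← Finset.mul_sum, ← Finset.mul_sum, sum_norm_sq_mulVec hUU, sum_norm_sq_mulVec hUU,
      hnv] at h1
    have h2 : 0 ≤ J ^ 2 * ∑ l, ‖w k l‖ ^ 2 := by positivity
    have h3 : (J ^ 2) ^ 2 * ∑ l, ‖r k l‖ ^ 2 < (J ^ 2) ^ 2 * R ^ 2 :=
      mul_lt_mul_of_pos_left (hrR k) (by positivity)
    have h4 : (R * J ^ 2) ^ 2 * 1 ≤ (R * J ^ 2) ^ 2 * (1 + J ^ 2 * ∑ l, ‖w k l‖ ^ 2) :=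
      mul_le_mul_of_nonneg_left (by linarith) (by positivity)
    nlinarith
  choose σ hσ using hex
  have hRJ : R * J ^ 2 ≤ g / 8 := by nlinarith
  have hμgap : ∀ k l, k ≠ l → 3 * g / 4 ≤ |μ₀ k - μ₀ l| := by
    intro k l hkl
    have h1 := hgap k l hkl
    have h2 : |lam k - lam l| ≤ |μ₀ k - μ₀ l| + (J * β + J * β) := by
      have h3 : lam k - lam l = (μ₀ k - μ₀ l) + (J * (B l l).re - J * (B k k).re) := by
        simp only [μ₀]; ring
      rw [h3]
      refine (abs_add_le _ _).trans (add_le_add_right ((abs_sub _ _).trans ?_) _)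
      rw [abs_mul, abs_mul, abs_of_pos hJ0]
      exact add_le_add (mul_le_mul_of_nonneg_left (hβ l) hJ0.le)
        (mul_le_mul_of_nonneg_left (hβ k) hJ0.le)
    linarith
  -- Two approximate eigenvalues are separated by `3 g / 4`, but would differ by at most `g / 4` if
  -- they shared an exact one. Thus `σ` matches the two spectra and supplies the reindexing of the
  -- eigenbasis.
  have hinj : Function.Injective σ := by
    intro k l hkl
    by_contra hne
    have h1 := hμgap k l hne
    have h2 := hσ k
    have h3 := hσ l
    rw [hkl] at h2
    have h4 := abs_sub_le (μ₀ k) (ν (σ l)) (μ₀ l)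
    rw [abs_sub_comm (μ₀ k) (ν (σ l))] at h4
    linarith
  let e : κ ≃ κ := Equiv.ofBijective σ (Finite.injective_iff_bijective.1 hinj)
  have hdW := hdU.reindex e
  refine ⟨U.submatrix id e, ν ∘ e, hdW, fun k => ⟨?_, ?_⟩⟩
  · exact (hσ k).trans (mul_le_mul_of_nonneg_right (le_max_left _ _) (sq_nonneg _))
  set W := U.submatrix id e
  set C' := Wᴴ * C * W
  set a := Wᴴ *ᵥ v k
  have ha : ∀ m, a m = (Uᴴ *ᵥ v k) (e m) := fun m => rfl
  have hasum : ∑ m, ‖a m‖ ^ 2 = 1 + J ^ 2 * ∑ l, ‖w k l‖ ^ 2 := by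
    rw [← hnv]
    exact sum_norm_sq_mulVec (by
      rw [conjTranspose_conjTranspose]; exact hdW.mul_conjTranspose) _
  have haoff : ∀ m, m ≠ k → ‖a m‖ ≤ D * J ^ 2 := by
    intro m hm
    have h1 := hcoef k (e m)
    have h2 : g / 4 ≤ |ν (e m) - μ₀ k| := by
      have h3 := hμgap m k hm
      have h4 := hσ m
      have h5 := abs_sub_le (μ₀ m) (ν (σ m)) (μ₀ k)
      rw [abs_sub_comm (μ₀ m) (ν (σ m))] at h5
      change g / 4 ≤ |ν (σ m) - μ₀ k|
      linarith
    have h3 : ‖(Uᴴ *ᵥ r k) (e m)‖ ≤ R := by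
      have h4 := Finset.single_le_sum (f := fun m => ‖(Uᴴ *ᵥ r k) m‖ ^ 2)
        (fun _ _ => sq_nonneg _) (Finset.mem_univ (e m))
      rw [sum_norm_sq_mulVec hUU] at h4
      exact (sq_le_sq₀ (norm_nonneg _) (by linarith)).1 (h4.trans (hrR k).le)
    rw [← ha] at h1
    have h4 : g / 4 * ‖a m‖ ≤ J ^ 2 * R :=
      (mul_le_mul_of_nonneg_right h2 (norm_nonneg _)).trans
        (h1.le.trans (mul_le_mul_of_nonneg_left h3 (sq_nonneg _)))
    have h5 : D * J ^ 2 = J ^ 2 * R / (g / 4) := by rw [hDdef]; field_simp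
    rw [h5, le_div_iff₀ (by positivity)]
    linarith
  have hDJ : D * J ^ 2 ≤ 1 := by nlinarith
  have hle2 : ∀ m, ‖a m‖ ≤ 2 := by
    intro m
    have h1 := Finset.single_le_sum (f := fun m => ‖a m‖ ^ 2)
      (fun _ _ => sq_nonneg _) (Finset.mem_univ m)
    simp only [hasum] at h1
    have h2 : J ^ 2 * ∑ l, ‖w k l‖ ^ 2 ≤ J * ω := by
      have := hwω k
      gcongr
    nlinarith [norm_nonneg (a m)]
  -- The norm of the quasimode is `1 + O(J ^ 2)` and all other coefficients are `O(J ^ 2)`, so the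
  -- diagonal coefficient has modulus near `1`.
  have hak : |‖a k‖ ^ 2 - 1| ≤ (ω + n * D) * J ^ 2 := by
    have h1 := Finset.add_sum_erase Finset.univ (fun m => ‖a m‖ ^ 2) (Finset.mem_univ k)
    have h2 : ∑ m ∈ Finset.univ.erase k, ‖a m‖ ^ 2 ≤ n * (D * J ^ 2) := by
      refine (Finset.sum_le_sum (g := fun _ => D * J ^ 2) fun m hm => ?_).trans ?_
      · have := haoff m (Finset.ne_of_mem_erase hm)
        nlinarith [norm_nonneg (a m)]
      · rw [Finset.sum_const, nsmul_eq_mul]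
        refine mul_le_mul_of_nonneg_right ?_ (by positivity)
        rw [hndef]
        exact Nat.cast_le.2 (Finset.card_le_univ _)
    have h3 : 0 ≤ ∑ m ∈ Finset.univ.erase k, ‖a m‖ ^ 2 := Finset.sum_nonneg fun _ _ => sq_nonneg _
    have h4 : J ^ 2 * ∑ l, ‖w k l‖ ^ 2 ≤ J ^ 2 * ω :=
      mul_le_mul_of_nonneg_left (hwω k) (sq_nonneg _)
    have h5 : 0 ≤ J ^ 2 * ∑ l, ‖w k l‖ ^ 2 := by positivity
    rw [abs_le]
    simp only [hasum] at h1
    constructor <;> nlinarith [mul_nonneg hω (sq_nonneg J)]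
  have hterm : ∀ m m', ‖star (a m) * (C' m m' * a m') -
      (if m = k ∧ m' = k then C' k k else 0)‖ ≤ Γ * (2 * D + ω + n * D) * J ^ 2 := by
    intro m m'
    have hC' : ∀ m m', ‖C' m m'‖ ≤ Γ := hΓC W hdW.1
    have hx : ∀ x y : ℝ, 0 ≤ x → 0 ≤ y → x ≤ D * J ^ 2 → y ≤ 2 →
        x * y * Γ ≤ Γ * (2 * D + ω + n * D) * J ^ 2 := by
      intro x y hx0 hy0 hx hy
      have h1 : x * y ≤ D * J ^ 2 * 2 := mul_le_mul hx hy hy0 (by positivity)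
      have h2 : 0 ≤ Γ * (ω + n * D) * J ^ 2 := by positivity
      nlinarith
    by_cases hmm : m = k ∧ m' = k
    · rw [if_pos hmm, hmm.1, hmm.2]
      have h1 : star (a k) * (C' k k * a k) - C' k k = ((‖a k‖ ^ 2 - 1 : ℝ) : ℂ) * C' k k := by
        push_cast
        rw [← Complex.conj_mul']
        simp only [RCLike.star_def]
        ring
      rw [h1, norm_mul, Complex.norm_real, Real.norm_eq_abs]
      calc _ ≤ (ω + n * D) * J ^ 2 * Γ := mul_le_mul hak (hC' _ _) (norm_nonneg _) (by positivity)
        _ ≤ _ := by nlinarith [mul_nonneg (mul_nonneg hΓ hD) (sq_nonneg J)]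
    · rw [if_neg hmm, sub_zero, norm_mul, norm_mul, norm_star]
      rw [not_and_or] at hmm
      rcases hmm with hm | hm
      · refine le_trans ?_ (hx ‖a m‖ ‖a m'‖ (norm_nonneg _) (norm_nonneg _) (haoff m hm) (hle2 m'))
        rw [mul_comm ‖C' m m'‖, ← mul_assoc]
        exact mul_le_mul_of_nonneg_left (hC' _ _) (by positivity)
      · refine le_trans ?_ (hx ‖a m'‖ ‖a m‖ (norm_nonneg _) (norm_nonneg _) (haoff m' hm) (hle2 m))
        rw [mul_comm ‖C' m m'‖, ← mul_assoc, mul_comm ‖a m‖]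
        exact mul_le_mul_of_nonneg_left (hC' _ _) (by positivity)
  have hQ : star (v k) ⬝ᵥ (C *ᵥ v k) = ∑ m, ∑ m', star (a m) * (C' m m' * a m') := by
    have h1 : v k = W *ᵥ a := by
      simp only [a]
      rw [mulVec_mulVec, hdW.mul_conjTranspose, one_mulVec]
    have h2 : star (v k) ⬝ᵥ (C *ᵥ v k) = star a ⬝ᵥ (C' *ᵥ a) := by
      rw [h1, star_mulVec, ← dotProduct_mulVec, mulVec_mulVec, mulVec_mulVec]
    rw [h2]
    simp only [dotProduct, mulVec, Finset.mul_sum, Pi.star_apply]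
  have hexp : star (v k) ⬝ᵥ (C *ᵥ v k) = C k k + J * ((C *ᵥ w k) k + (star (w k) ᵥ* C) k) +
      ((J ^ 2 : ℝ) : ℂ) * (star (w k) ⬝ᵥ (C *ᵥ w k)) := by
    have h1 : star (v k) = Pi.single k 1 + (J : ℂ) • star (w k) := by
      simp only [v, star_add, star_smul, Pi.star_single, star_one]
      simp
    rw [h1]
    simp only [v, mulVec_add, mulVec_smul, add_dotProduct, dotProduct_add, smul_dotProduct,
      dotProduct_smul, single_one_dotProduct, mulVec_single_one, smul_eq_mul]
    have h2 : star (w k) ⬝ᵥ C.col k = (star (w k) ᵥ* C) k := rfl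
    rw [h2]
    push_cast
    simp only [col_apply]
    ring
  have hsum : ‖star (v k) ⬝ᵥ (C *ᵥ v k) - C' k k‖ ≤
      n * (n * (Γ * (2 * D + ω + n * D))) * J ^ 2 := by
    have h1 : C' k k = ∑ m, ∑ m', (if m = k ∧ m' = k then C' k k else 0) := by
      simp [ite_and]
    rw [h1, hQ, ← Finset.sum_sub_distrib]
    simp only [← Finset.sum_sub_distrib]
    refine (norm_sum_le _ _).trans ((Finset.sum_le_sum fun m _ => (norm_sum_le _ _).trans
      (Finset.sum_le_sum fun m' _ => hterm m m')).trans (le_of_eq ?_))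
    simp only [Finset.sum_const, Finset.card_univ, nsmul_eq_mul]
    rw [← hndef]
    ring
  have hww : ‖star (w k) ⬝ᵥ (C *ᵥ w k)‖ ≤ ∑ k, ‖(star (w k) ⬝ᵥ (C *ᵥ w k))‖ :=
    Finset.single_le_sum (f := fun k => ‖star (w k) ⬝ᵥ (C *ᵥ w k)‖)
      (fun _ _ => norm_nonneg _) (Finset.mem_univ k)
  have hfin : C' k k - (C k k + J * ((C *ᵥ w k) k + (star (w k) ᵥ* C) k)) =
      ((J ^ 2 : ℝ) : ℂ) * (star (w k) ⬝ᵥ (C *ᵥ w k)) - (star (v k) ⬝ᵥ (C *ᵥ v k) - C' k k) := by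
    rw [hexp]; ring
  rw [hfin]
  refine (norm_sub_le _ _).trans ?_
  rw [norm_mul, Complex.norm_real, Real.norm_of_nonneg (sq_nonneg J)]
  refine le_trans ?_ (mul_le_mul_of_nonneg_right (le_max_right _ _) (sq_nonneg J))
  rw [add_mul, add_comm]
  exact add_le_add hsum (by rw [mul_comm]; exact mul_le_mul_of_nonneg_right hww (sq_nonneg _))

end Perturbation

/-! ### An Ising chain without gap resonances -/

section Chain

open Filter Topology Kronecker

/-- The real numbers `lam` have no resonances: the gaps between them are nondegenerate. -/
def NoResonance {κ : Type} (lam : κ → ℝ) : Prop :=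
  ∀ a b c d, lam a + lam b = lam c + lam d → (a = c ∧ b = d) ∨ (a = d ∧ b = c)

theorem NoResonance.injective {κ : Type} {lam : κ → ℝ} (h : NoResonance lam) :
    Function.Injective lam := by
  intro a b hab
  rcases h a a b b (by rw [hab]) with h | h <;> exact h.1

/-- The Ising chain with longitudinal and transverse fields. -/
noncomputable def isingChain {M : ℕ} (hx hz : Fin (M + 1) → ℝ) (J : Fin M → ℝ) : Op (M + 1) :=
  (∑ l, ((hx l : ℂ) • onSite l (pauli .x) + (hz l : ℂ) • onSite l (pauli .z))) +
    ∑ l : Fin M, (J l : ℂ) • (onSite l.castSucc (pauli .z) * onSite l.succ (pauli .z))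

/-- The configurations of a chain split into those of its last qubit and of the others. -/
def configSnocEquiv (N : ℕ) : Config (Fin (N + 1)) ≃ Config (Fin N) × Fin 2 :=
  (Fin.snocEquiv fun _ : Fin (N + 1) => Fin 2).symm.trans (Equiv.prodComm _ _)

theorem configSnocEquiv_apply {N : ℕ} (s : Config (Fin (N + 1))) :
    configSnocEquiv N s = (fun l => s l.castSucc, s (Fin.last N)) := rfl

/-- The tensor product of an operator on the first qubits and one on the last qubit. -/
def tensorLast {N : ℕ} (X : Op N) (A : Matrix (Fin 2) (Fin 2) ℂ) : Op (N + 1) :=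
  (X ⊗ₖ A).submatrix (configSnocEquiv N) (configSnocEquiv N)

theorem tensorLast_apply {N : ℕ} (X : Op N) (A : Matrix (Fin 2) (Fin 2) ℂ)
    (s s' : Config (Fin (N + 1))) :
    tensorLast X A s s' = X (fun l => s l.castSucc) (fun l => s' l.castSucc) *
      A (s (Fin.last N)) (s' (Fin.last N)) := rfl

theorem tensorLast_mul {N : ℕ} (X Y : Op N) (A B : Matrix (Fin 2) (Fin 2) ℂ) :
    tensorLast X A * tensorLast Y B = tensorLast (X * Y) (A * B) := by
  rw [tensorLast, tensorLast, submatrix_mul_equiv, ← mul_kronecker_mul, tensorLast]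

theorem tensorLast_conjTranspose {N : ℕ} (X : Op N) (A : Matrix (Fin 2) (Fin 2) ℂ) :
    (tensorLast X A)ᴴ = tensorLast Xᴴ Aᴴ := by
  rw [tensorLast, conjTranspose_submatrix, conjTranspose_kronecker, tensorLast]

theorem tensorLast_one {N : ℕ} : tensorLast (1 : Op N) 1 = 1 := by
  rw [tensorLast, one_kronecker_one, submatrix_one_equiv]

theorem tensorLast_add_left {N : ℕ} (X Y : Op N) (A : Matrix (Fin 2) (Fin 2) ℂ) :
    tensorLast (X + Y) A = tensorLast X A + tensorLast Y A := by
  ext s s'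
  simp [tensorLast_apply, add_mul]

theorem tensorLast_sum_left {N : ℕ} {κ : Type} [Fintype κ] (X : κ → Op N)
    (A : Matrix (Fin 2) (Fin 2) ℂ) :
    tensorLast (∑ k, X k) A = ∑ k, tensorLast (X k) A := by
  ext s s'
  simp [tensorLast_apply, Matrix.sum_apply, Finset.sum_mul]

theorem tensorLast_smul_left {N : ℕ} (c : ℂ) (X : Op N) (A : Matrix (Fin 2) (Fin 2) ℂ) :
    tensorLast (c • X) A = c • tensorLast X A := by
  ext s s'
  simp [tensorLast_apply, mul_assoc]

theorem tensorLast_add_right {N : ℕ} (X : Op N) (A B : Matrix (Fin 2) (Fin 2) ℂ) :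
    tensorLast X (A + B) = tensorLast X A + tensorLast X B := by
  ext s s'
  simp [tensorLast_apply, mul_add]

theorem tensorLast_smul_right {N : ℕ} (c : ℂ) (X : Op N) (A : Matrix (Fin 2) (Fin 2) ℂ) :
    tensorLast X (c • A) = c • tensorLast X A := by
  ext s s'
  simp only [tensorLast_apply, Matrix.smul_apply, smul_eq_mul]
  ring

theorem onSite_castSucc {N : ℕ} (l : Fin N) (A : Matrix (Fin 2) (Fin 2) ℂ) :
    onSite l.castSucc A = tensorLast (onSite l A) 1 := by
  ext s s'
  have h : (∀ k : Fin (N + 1), k ≠ l.castSucc → s k = s' k) ↔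
      (∀ k : Fin N, k ≠ l → s k.castSucc = s' k.castSucc) ∧ s (Fin.last N) = s' (Fin.last N) := by
    constructor
    · intro h
      exact ⟨fun k hk => h _ fun hc => hk (Fin.castSucc_injective _ hc),
        h _ (Fin.castSucc_lt_last l).ne'⟩
    · rintro ⟨h1, h2⟩ k
      induction k using Fin.lastCases with
      | last => exact fun _ => h2
      | cast k => exact fun hk => h1 k fun hc => hk (by rw [hc])
  simp only [onSite, tensorLast_apply, h, one_apply]
  by_cases h1 : ∀ k : Fin N, k ≠ l → s k.castSucc = s' k.castSucc <;>
    by_cases h2 : s (Fin.last N) = s' (Fin.last N) <;> simp [h1, h2]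

theorem onSite_last {N : ℕ} (A : Matrix (Fin 2) (Fin 2) ℂ) :
    onSite (Fin.last N) A = tensorLast 1 A := by
  ext s s'
  have h : (∀ k : Fin (N + 1), k ≠ Fin.last N → s k = s' k) ↔
      (fun l : Fin N => s l.castSucc) = fun l => s' l.castSucc := by
    rw [funext_iff]
    constructor
    · exact fun h k => h _ (Fin.castSucc_lt_last k).ne
    · intro h k
      induction k using Fin.lastCases with
      | last => exact fun hk => (hk rfl).elim
      | cast k => exact fun _ => h k
  simp only [onSite, tensorLast_apply, h, one_apply]
  split_ifs <;> simp

theorem isingChain_succ {M : ℕ} (hx hz : Fin (M + 2) → ℝ) (J : Fin (M + 1) → ℝ) :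
    isingChain hx hz J =
      tensorLast (isingChain (fun l => hx l.castSucc) (fun l => hz l.castSucc)
        (fun l => J l.castSucc)) 1 +
      tensorLast 1 ((hx (Fin.last _) : ℂ) • pauli .x + (hz (Fin.last _) : ℂ) • pauli .z) +
      (J (Fin.last _) : ℂ) • tensorLast (onSite (Fin.last M) (pauli .z)) (pauli .z) := by
  have h1 : ∀ l : Fin M, onSite (l.castSucc.castSucc : Fin (M + 2)) (pauli .z) *
      onSite (l.castSucc.succ : Fin (M + 2)) (pauli .z) =
      tensorLast (onSite l.castSucc (pauli .z) * onSite l.succ (pauli .z)) 1 := by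
    intro l
    rw [← Fin.castSucc_succ, onSite_castSucc l.castSucc, onSite_castSucc l.succ, tensorLast_mul,
      Matrix.one_mul]
  have h2 : onSite ((Fin.last M).castSucc : Fin (M + 2)) (pauli .z) *
      onSite ((Fin.last M).succ : Fin (M + 2)) (pauli .z) =
      tensorLast (onSite (Fin.last M) (pauli .z)) (pauli .z) := by
    rw [Fin.succ_last, onSite_castSucc (Fin.last M), onSite_last (N := M + 1), tensorLast_mul,
      Matrix.one_mul, Matrix.mul_one]
  rw [isingChain, Fin.sum_univ_castSucc, Fin.sum_univ_castSucc (fun l : Fin (M + 1) =>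
    (J l : ℂ) • (onSite l.castSucc (pauli .z) * onSite l.succ (pauli .z))), h2]
  simp only [h1]
  simp only [isingChain, tensorLast_add_left, tensorLast_sum_left, tensorLast_smul_left,
    tensorLast_add_right, tensorLast_smul_right, onSite_castSucc, onSite_last]
  abel

/-- The eigenvalue `±1` of a spin. -/
def spinSign (i : Fin 2) : ℝ := if i = 0 then 1 else -1

theorem spinSign_eq (i : Fin 2) : spinSign i = 1 ∨ spinSign i = -1 := by
  unfold spinSign; split_ifs <;> simp

theorem spinSign_injective : Function.Injective spinSign := by
  intro i j h
  fin_cases i <;> fin_cases j <;> simp [spinSign] at h ⊢ <;> norm_num at h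

/-- Two pairs of signs with equal sums but different first members are `{1, -1}` in opposite orders.
-/
theorem spinSign_swap {i j k l : Fin 2}
    (h : spinSign i + spinSign j = spinSign k + spinSign l) (hne : spinSign i ≠ spinSign k) :
    spinSign i = spinSign l ∧ spinSign j = spinSign k ∧ spinSign j = -spinSign i := by
  rcases spinSign_eq i with ha | ha <;> rcases spinSign_eq j with hb | hb <;>
    rcases spinSign_eq k with hc | hc <;> rcases spinSign_eq l with hd | hd <;>
    rw [ha, hb, hc, hd] at h <;> rw [ha, hc] at hne <;> rw [ha, hb, hc, hd] <;>
    refine ⟨?_, ?_, ?_⟩ <;> first | linarith | exact (hne rfl).elim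

theorem spinSign_ne_zero (i : Fin 2) : spinSign i ≠ 0 := by
  rcases spinSign_eq i with h | h <;> rw [h] <;> norm_num

theorem spinSign_rev (i : Fin 2) : spinSign i.rev = -spinSign i := by
  fin_cases i <;> simp [spinSign, Fin.rev]

/-- The eigenvectors of `(24 / 25) X + (7 / 25) Z`. -/
noncomputable def tiltMatrix : Matrix (Fin 2) (Fin 2) ℂ := !![4 / 5, -3 / 5; 3 / 5, 4 / 5]

theorem tiltMatrix_conjTranspose : tiltMatrixᴴ = !![4 / 5, 3 / 5; -3 / 5, 4 / 5] := by
  ext i j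
  fin_cases i <;> fin_cases j <;> simp [tiltMatrix]

theorem tiltMatrix_unitary : tiltMatrixᴴ * tiltMatrix = 1 := by
  rw [tiltMatrix_conjTranspose, tiltMatrix]
  ext i j
  fin_cases i <;> fin_cases j <;> simp [Matrix.mul_apply, Fin.sum_univ_two] <;> norm_num

theorem diagonalizes_tilt (b : ℝ) : Diagonalizes tiltMatrix (fun i => ((b * spinSign i : ℝ) : ℂ))
    (((24 / 25 * b : ℝ) : ℂ) • pauli .x + ((7 / 25 * b : ℝ) : ℂ) • pauli .z) := by
  refine ⟨tiltMatrix_unitary, ?_⟩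
  rw [tiltMatrix_conjTranspose, tiltMatrix]
  ext i j
  fin_cases i <;> fin_cases j <;>
    simp [Matrix.mul_apply, Fin.sum_univ_two, spinSign, pauli, vecMul_diagonal] <;> ring

/-- Both kinds of entries are needed: the diagonal ones give first-order energy shifts through the
coupling, while the off-diagonal ones give first-order changes of the magnetization of the last
spin. -/
theorem tilt_conj_pauli_z :
    tiltMatrixᴴ * pauli .z * tiltMatrix = !![7 / 25, -24 / 25; -24 / 25, -7 / 25] := by
  rw [tiltMatrix_conjTranspose, tiltMatrix, pauli]
  ext i j
  fin_cases i <;> fin_cases j <;> simp [Matrix.mul_apply, Fin.sum_univ_two] <;> norm_num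

theorem Diagonalizes.tensorLast_add {N : ℕ} {V A : Op N} {d : Config (Fin N) → ℂ}
    {Q B : Matrix (Fin 2) (Fin 2) ℂ} {e : Fin 2 → ℂ} (h : Diagonalizes V d A)
    (h' : Diagonalizes Q e B) :
    Diagonalizes (tensorLast V Q) (fun s => d (fun l => s l.castSucc) + e (s (Fin.last N)))
      (tensorLast A 1 + tensorLast 1 B) := by
  constructor
  · rw [tensorLast_conjTranspose, tensorLast_mul, h.1, h'.1, tensorLast_one]
  · have h1 : diagonal (fun s : Config (Fin (N + 1)) =>
        d (fun l => s l.castSucc) + e (s (Fin.last N))) =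
        tensorLast (diagonal d) 1 + tensorLast 1 (diagonal e) := by
      ext s s'
      by_cases hs : s = s'
      · subst hs; simp [tensorLast_apply]
      · have h2 : ¬((fun l : Fin N => s l.castSucc) = (fun l => s' l.castSucc) ∧
            s (Fin.last N) = s' (Fin.last N)) := by
          rintro ⟨h3, h4⟩
          exact hs ((configSnocEquiv N).injective (Prod.ext h3 h4))
        rw [diagonal_apply_ne _ hs]
        by_cases h3 : (fun l : Fin N => s l.castSucc) = (fun l => s' l.castSucc)
        · have h4 : s (Fin.last N) ≠ s' (Fin.last N) := fun h => h2 ⟨h3, h⟩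
          simp [tensorLast_apply, h4]
        · simp [tensorLast_apply, h3]
    rw [h1, Matrix.mul_add, Matrix.add_mul, tensorLast_conjTranspose, tensorLast_mul,
      tensorLast_mul, tensorLast_mul, tensorLast_mul, Matrix.mul_one, Matrix.mul_one, ← h.2,
      ← h'.2, h.mul_conjTranspose, h'.mul_conjTranspose]

theorem Diagonalizes.trans {κ : Type} [Fintype κ] [DecidableEq κ] {V W A B : Matrix κ κ ℂ}
    {d : κ → ℂ} (hV : Vᴴ * V = 1) (hA : A = V * B * Vᴴ) (h : Diagonalizes W d B) :
    Diagonalizes (V * W) d A := by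
  constructor
  · rw [conjTranspose_mul, Matrix.mul_assoc, ← Matrix.mul_assoc Vᴴ, hV, Matrix.one_mul, h.1]
  · rw [hA, h.2, conjTranspose_mul]
    simp only [Matrix.mul_assoc]

/-- A quantity with nonzero first order expansion in `J` does not vanish for small `J`. -/
theorem eventually_ne_zero_of_expansion {x y : ℝ} (h : x = 0 → y ≠ 0) (K : ℝ) :
    ∀ᶠ J : ℝ in 𝓝[>] 0, ∀ z : ℝ, |z - (x + J * y)| ≤ K * J ^ 2 → z ≠ 0 := by
  have hsmall : ∀ c ε : ℝ, 0 < ε → ∀ᶠ J : ℝ in 𝓝[>] 0, c * J < ε := fun c ε hε => by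
    have : Tendsto (fun J : ℝ => c * J) (𝓝[>] 0) (𝓝 0) :=
      ((continuous_const.mul continuous_id).tendsto' 0 0 (by simp)).mono_left nhdsWithin_le_nhds
    exact this.eventually_lt_const hε
  by_cases hx : x = 0
  · have hy := h hx
    subst hx
    filter_upwards [self_mem_nhdsWithin, hsmall K |y| (abs_pos.2 hy)] with J hJ0 hJ z hz hz0
    replace hJ0 : 0 < J := hJ0
    rw [hz0, zero_add, zero_sub, abs_neg, abs_mul, abs_of_pos hJ0] at hz
    nlinarith
  · filter_upwards [self_mem_nhdsWithin, hsmall 1 1 one_pos,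
      hsmall (|y| + |K|) |x| (abs_pos.2 hx)] with J hJ0 hJ1 hJ z hz hz0
    replace hJ0 : 0 < J := hJ0
    rw [hz0, zero_sub, abs_neg] at hz
    have h1 : |x| ≤ |x + J * y| + J * |y| := by
      have := abs_sub (x + J * y) (J * y)
      rwa [add_sub_cancel_right, abs_mul, abs_of_pos hJ0] at this
    have h2 : K * J ^ 2 ≤ |K| * J := by
      have h3 : K * J ^ 2 ≤ |K| * J ^ 2 :=
        mul_le_mul_of_nonneg_right (le_abs_self K) (sq_nonneg J)
      have h4 : |K| * J ^ 2 ≤ |K| * J :=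
        mul_le_mul_of_nonneg_left (by nlinarith) (abs_nonneg K)
      linarith
    nlinarith

/-- The strong field separates the spin part of a resonance from the old energies, so by `hlam` the
old labels match up to order. Only a mismatch of the attached spins can remain. Such a mismatch
forces opposite signs, and the first-order equation then gives `s a.1 = s b'.1`, making the
resonance trivial. -/
theorem resonance_of_split {κ : Type} {lam s : κ → ℝ} (hlam : NoResonance lam)
    (hs : Function.Injective s) {b : ℝ} (hb : ∀ k, 2 * |lam k| < b) (a b' c d : κ × Fin 2)
    (h0 : (lam a.1 + b * spinSign a.2) + (lam b'.1 + b * spinSign b'.2) =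
      (lam c.1 + b * spinSign c.2) + (lam d.1 + b * spinSign d.2))
    (h1 : spinSign a.2 * s a.1 + spinSign b'.2 * s b'.1 =
      spinSign c.2 * s c.1 + spinSign d.2 * s d.1) :
    (a = c ∧ b' = d) ∨ (a = d ∧ b' = c) := by
  have hla := abs_lt.1 (show |lam a.1| < b / 2 by linarith [hb a.1])
  have hlb := abs_lt.1 (show |lam b'.1| < b / 2 by linarith [hb b'.1])
  have hlc := abs_lt.1 (show |lam c.1| < b / 2 by linarith [hb c.1])
  have hld := abs_lt.1 (show |lam d.1| < b / 2 by linarith [hb d.1])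
  have ext : ∀ {x y : κ × Fin 2}, x.1 = y.1 → spinSign x.2 = spinSign y.2 → x = y :=
    fun h h' => Prod.ext h (spinSign_injective h')
  have hT : spinSign a.2 + spinSign b'.2 = spinSign c.2 + spinSign d.2 := by
    -- The four old energies together contribute less than `2 * b`, while two unequal sums of spin
    -- signs differ by at least `2`.
    rcases spinSign_eq a.2 with ha | ha <;> rcases spinSign_eq b'.2 with hb | hb <;>
      rcases spinSign_eq c.2 with hc | hc <;> rcases spinSign_eq d.2 with hd | hd <;>
      rw [ha, hb, hc, hd] at h0 ⊢ <;> linarith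
  have hL : lam a.1 + lam b'.1 = lam c.1 + lam d.1 := by
    have := congrArg (fun x => b * x) hT
    simp only [mul_add] at this
    linarith
  have key : ∀ c d : κ × Fin 2, a.1 = c.1 → b'.1 = d.1 →
      spinSign a.2 + spinSign b'.2 = spinSign c.2 + spinSign d.2 →
      spinSign a.2 * s a.1 + spinSign b'.2 * s b'.1 =
        spinSign c.2 * s c.1 + spinSign d.2 * s d.1 → (a = c ∧ b' = d) ∨ (a = d ∧ b' = c) := by
    intro c d hac hbd hT h1
    by_cases hsgn : spinSign a.2 = spinSign c.2
    · exact Or.inl ⟨ext hac hsgn, ext hbd (by linarith)⟩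
    · obtain ⟨h3, h4, h5⟩ := spinSign_swap hT hsgn
      have h6 := spinSign_ne_zero a.2
      have h7 : s a.1 = s b'.1 := by
        rw [← hac, ← hbd, ← h3, ← h4, h5] at h1
        have h8 : spinSign a.2 * (s a.1 - s b'.1) = 0 := by linarith
        rcases mul_eq_zero.1 h8 with h8 | h8
        · exact (h6 h8).elim
        · linarith
      have h8 := hs h7
      exact Or.inr ⟨ext (h8.trans hbd) h3, ext (h8.symm.trans hac) h4⟩
  rcases hlam _ _ _ _ hL with ⟨h2, h3⟩ | ⟨h2, h3⟩
  · exact key c d h2 h3 hT h1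
  · exact (key d c h2 h3 (by linarith) (by linarith)).symm

/-- The induction carries distinctness of the magnetizations of the last spin as well: they set the
first-order energy shifts when the next spin is attached. Both properties hold to first order for
the enlarged chain, hence exactly for some small coupling. -/
theorem exists_noResonance_isingChain (M : ℕ) :
    ∃ (hx hz : Fin (M + 1) → ℝ) (J : Fin M → ℝ) (V : Op (M + 1)) (lam : Config (Fin (M + 1)) → ℝ),
      Diagonalizes V (fun k => (lam k : ℂ)) (isingChain hx hz J) ∧ NoResonance lam ∧
      Function.Injective fun k => ((Vᴴ * onSite (Fin.last M) (pauli .z) * V) k k).re := by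
  induction M with
  | zero =>
    have hZ : ∀ l : Fin 1, onSite l (pauli .z) =
        diagonal fun k : Config (Fin 1) => ((spinSign (k 0) : ℝ) : ℂ) := by
      intro l
      ext s s'
      have h1 : ∀ k : Fin 1, k ≠ l → s k = s' k := fun k hk => (hk (Subsingleton.elim _ _)).elim
      rw [onSite, if_pos h1, diagonal_apply, Subsingleton.elim l 0]
      have h2 : s = s' ↔ s 0 = s' 0 := by rw [funext_iff, Fin.forall_fin_one]
      rw [if_congr h2 rfl rfl]
      generalize s 0 = i
      generalize s' 0 = j
      fin_cases i <;> fin_cases j <;> simp [pauli, spinSign]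
    have hinj : Function.Injective fun k : Config (Fin 1) => spinSign (k 0) := by
      intro k k' h
      ext l
      rw [Subsingleton.elim l 0, spinSign_injective h]
    refine ⟨0, 1, Fin.elim0, 1, fun k => spinSign (k 0), ⟨by simp, ?_⟩, ?_, ?_⟩
    · simp [isingChain, hZ]
    · intro a b c d h
      have ext : ∀ {x y : Config (Fin 1)}, spinSign (x 0) = spinSign (y 0) → x = y :=
        fun h => hinj h
      by_cases hac : spinSign (a 0) = spinSign (c 0)
      · exact Or.inl ⟨ext hac, ext (by linarith)⟩
      · obtain ⟨h1, h2, -⟩ := spinSign_swap h hac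
        exact Or.inr ⟨ext h1, ext h2⟩
    · simpa [hZ] using hinj
  | succ M ih =>
    obtain ⟨hx, hz, J, V, lam, hV, hlam, hs⟩ := ih
    set Zc := Vᴴ * onSite (Fin.last M) (pauli .z) * V
    set s : Config (Fin (M + 1)) → ℝ := fun k => (Zc k k).re
    have hZc : Zc.IsHermitian :=
      isHermitian_conjTranspose_mul_mul _ (onSite_isHermitian _ (pauli_isHermitian .z))
    have hsc : ∀ k, Zc k k = (s k : ℂ) := fun k => (hZc.coe_re_apply_self k).symm
    -- A field large enough that the spectra for the two orientations of the new spin are disjoint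
    -- and their resonances separate.
    set b : ℝ := 1 + ∑ k, 2 * |lam k|
    have hb : ∀ k, 2 * |lam k| < b := fun k => by
      have := Finset.single_le_sum (f := fun k => 2 * |lam k|) (fun _ _ => by positivity)
        (Finset.mem_univ k)
      simp only [b]
      linarith
    have hb0 : 0 < b := by simp only [b]; positivity
    set V' := tensorLast V tiltMatrix
    set Lam : Config (Fin (M + 2)) → ℝ := fun k =>
      lam (fun l => k l.castSucc) + b * spinSign (k (Fin.last _))
    have hV' := hV.tensorLast_add (diagonalizes_tilt b)
    have hVd : Diagonalizes V' (fun k => (Lam k : ℂ)) (tensorLast (isingChain hx hz J) 1 +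
        tensorLast 1 (((24 / 25 * b : ℝ) : ℂ) • pauli .x + ((7 / 25 * b : ℝ) : ℂ) • pauli .z)) := by
      convert hV' using 1
      ext k
      simp only [Lam]
      push_cast
      rfl
    set T : Matrix (Fin 2) (Fin 2) ℂ := !![7 / 25, -24 / 25; -24 / 25, -7 / 25]
    set B := tensorLast Zc T
    set C : Op (M + 2) := tensorLast 1 T
    have hT : T = tiltMatrixᴴ * pauli .z * tiltMatrix := tilt_conj_pauli_z.symm
    have hBeq : V'ᴴ * tensorLast (onSite (Fin.last M) (pauli .z)) (pauli .z) * V' = B := by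
      simp only [V', B, Zc]
      rw [tensorLast_conjTranspose, tensorLast_mul, tensorLast_mul, hT]
    have hCeq : V'ᴴ * onSite (Fin.last (M + 1)) (pauli .z) * V' = C := by
      simp only [V', C]
      rw [tensorLast_conjTranspose, onSite_last, tensorLast_mul, tensorLast_mul, hT, Matrix.mul_one,
        hV.1]
    have hB : B.IsHermitian := by
      rw [← hBeq]
      refine isHermitian_conjTranspose_mul_mul _ ?_
      rw [IsHermitian, tensorLast_conjTranspose, (pauli_isHermitian .z).eq,
        (onSite_isHermitian _ (pauli_isHermitian .z)).eq]
    have hinit : ∀ {k k' : Config (Fin (M + 2))}, (fun l : Fin (M + 1) => k l.castSucc) =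
        (fun l => k' l.castSucc) → spinSign (k (Fin.last _)) = spinSign (k' (Fin.last _)) →
        k = k' := fun h h' =>
      (configSnocEquiv (M + 1)).injective (Prod.ext h (spinSign_injective h'))
    have hTdiag : ∀ i, T i i = ((7 / 25 * spinSign i : ℝ) : ℂ) := by
      intro i
      fin_cases i <;> simp [T, spinSign]
      norm_num
    have hLam : Function.Injective Lam := by
      intro k k' h
      have h1 := abs_lt.1 (show |lam fun l => k l.castSucc| < b / 2 by
        linarith [hb fun l => k l.castSucc])
      have h2 := abs_lt.1 (show |lam fun l => k' l.castSucc| < b / 2 by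
        linarith [hb fun l => k' l.castSucc])
      simp only [Lam] at h
      have h3 : spinSign (k (Fin.last _)) = spinSign (k' (Fin.last _)) := by
        rcases spinSign_eq (k (Fin.last _)) with h3 | h3 <;>
          rcases spinSign_eq (k' (Fin.last _)) with h4 | h4 <;> rw [h3, h4] at h ⊢ <;> linarith
      rw [h3] at h
      exact hinit (hlam.injective (by linarith)) h3
    obtain ⟨K, hK⟩ := exists_perturbed_eigenbasis hLam hB C
    have hB1 : ∀ k : Config (Fin (M + 2)), (B k k).re =
        7 / 25 * (spinSign (k (Fin.last _)) * s fun l => k l.castSucc) := by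
      intro k
      simp only [B]
      rw [tensorLast_apply, hsc, hTdiag, ← Complex.ofReal_mul, Complex.ofReal_re]
      ring
    have hC0 : ∀ k : Config (Fin (M + 2)),
        C k k = ((7 / 25 * spinSign (k (Fin.last _)) : ℝ) : ℂ) := by
      intro k
      simp only [C]
      rw [tensorLast_apply, hTdiag, one_apply_eq, one_mul]
    have hTrev : ∀ i, T i i.rev = -24 / 25 ∧ T i.rev i = -24 / 25 := by
      intro i
      fin_cases i <;> simp [T, Fin.rev]
    -- `C` acts only on the new spin, so flipping that spin is the only intermediate configuration.
    -- Its energy denominator is `2 * b * spinSign`, and the two off-diagonal entries give the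
    -- numerator `(24 / 25) ^ 2 * s`.
    have hC1 : ∀ k : Config (Fin (M + 2)), (C *ᵥ firstOrderVector Lam B k) k =
        ((288 / 625 / b * (spinSign (k (Fin.last _)) * s fun l => k l.castSucc) : ℝ) : ℂ) := by
      intro k
      set i := k (Fin.last _) with hi
      set k' : Config (Fin (M + 2)) :=
        (configSnocEquiv (M + 1)).symm (fun l => k l.castSucc, i.rev) with hk'
      have he : configSnocEquiv (M + 1) k' = (fun l => k l.castSucc, i.rev) := by
        rw [hk', Equiv.apply_symm_apply]
      rw [configSnocEquiv_apply, Prod.mk.injEq] at he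
      have hne : k' ≠ k := by
        intro h
        have h1 := he.2
        rw [h, ← hi] at h1
        have h2 := spinSign_rev i
        rw [← h1] at h2
        exact spinSign_ne_zero i (by linarith)
      rw [mulVec, dotProduct, Finset.sum_eq_single k']
      · have h1 : C k k' = -24 / 25 := by
          simp only [C]
          rw [tensorLast_apply, he.1, he.2, one_apply_eq, one_mul, ← hi, (hTrev i).1]
        have h2 : B k' k = s (fun l => k l.castSucc) * (-24 / 25) := by
          simp only [B]
          rw [tensorLast_apply, he.1, he.2, hsc, ← hi, (hTrev i).2]
        have h3 : Lam k - Lam k' = 2 * b * spinSign i := by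
          simp only [Lam]
          rw [he.1, he.2, spinSign_rev, ← hi]
          ring
        rw [h1, firstOrderVector, if_neg hne, h2, ← Complex.ofReal_sub, h3]
        have hb0' : (b : ℂ) ≠ 0 := by exact_mod_cast hb0.ne'
        rcases spinSign_eq i with h4 | h4 <;> rw [h4] <;> push_cast <;> field_simp <;> norm_num <;> ring
      · intro l _ hl
        by_cases hlk : l = k
        · simp [firstOrderVector, hlk]
        · have h1 : (fun m : Fin (M + 1) => k m.castSucc) ≠ fun m => l m.castSucc := by
            intro h
            have h2 : spinSign (l (Fin.last _)) ≠ spinSign i := fun h3 => hlk (hinit h.symm h3)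
            refine hl (hinit (h.symm.trans he.1.symm) ?_)
            rw [he.2, spinSign_rev]
            rcases spinSign_eq (l (Fin.last _)) with h4 | h4 <;>
              rcases spinSign_eq i with h5 | h5 <;> rw [h4, h5] at h2 ⊢ <;> simp at h2 ⊢
          simp only [C]
          rw [tensorLast_apply, one_apply_ne h1, zero_mul, zero_mul]
      · simp
    have hCH : Cᴴ = C := by
      rw [← hCeq]
      exact isHermitian_conjTranspose_mul_mul _ (onSite_isHermitian _ (pauli_isHermitian .z))
    have hC2 : ∀ k : Config (Fin (M + 2)), (star (firstOrderVector Lam B k) ᵥ* C) k =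
        ((288 / 625 / b * (spinSign (k (Fin.last _)) * s fun l => k l.castSucc) : ℝ) : ℂ) := by
      intro k
      have h1 := congrFun (star_mulVec C (firstOrderVector Lam B k)) k
      rw [hCH, Pi.star_apply, hC1] at h1
      rw [← h1]
      simp
    -- Finitely many candidate resonances are excluded simultaneously; the factor `4` adds the
    -- errors of four eigenvalues.
    have E1 : ∀ᶠ J : ℝ in 𝓝[>] 0, ∀ a b' c d : Config (Fin (M + 2)),
        ¬((a = c ∧ b' = d) ∨ (a = d ∧ b' = c)) → ∀ z : ℝ,
        |z - ((Lam a + Lam b' - Lam c - Lam d) +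
          J * ((B a a).re + (B b' b').re - (B c c).re - (B d d).re))| ≤ 4 * K * J ^ 2 → z ≠ 0 := by
      simp only [eventually_all]
      intro a b' c d hnt
      refine eventually_ne_zero_of_expansion (fun hx hy => hnt ?_) _
      rw [hB1, hB1, hB1, hB1] at hy
      have h := resonance_of_split hlam hs hb (configSnocEquiv (M + 1) a)
        (configSnocEquiv (M + 1) b') (configSnocEquiv (M + 1) c) (configSnocEquiv (M + 1) d)
        (by simp only [configSnocEquiv_apply]; simp only [Lam] at hx; linarith)
        (by simp only [configSnocEquiv_apply]; linarith)
      simpa using h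
    -- At order zero the magnetization distinguishes only the new spin; for equal spins the
    -- first-order term distinguishes the old labels by injectivity of `s`. The coefficient is twice
    -- that in `hC1`, from the bra and the ket.
    have E2 : ∀ᶠ J : ℝ in 𝓝[>] 0, ∀ k k' : Config (Fin (M + 2)), k ≠ k' → ∀ z : ℝ,
        |z - ((7 / 25 * spinSign (k (Fin.last _)) - 7 / 25 * spinSign (k' (Fin.last _))) +
          J * (576 / 625 / b * (spinSign (k (Fin.last _)) * s fun l => k l.castSucc) -
            576 / 625 / b * (spinSign (k' (Fin.last _)) * s fun l => k' l.castSucc)))| ≤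
          2 * K * J ^ 2 → z ≠ 0 := by
      simp only [eventually_all]
      intro k k' hne
      refine eventually_ne_zero_of_expansion (fun hx hy => hne ?_) _
      have h1 : spinSign (k (Fin.last _)) = spinSign (k' (Fin.last _)) := by linarith
      rw [h1, ← mul_sub, ← mul_sub] at hy
      have h2 : (576 / 625 / b : ℝ) ≠ 0 := by positivity
      have h3 := (mul_eq_zero.1 ((mul_eq_zero.1 hy).resolve_left h2)).resolve_left
        (spinSign_ne_zero _)
      exact hinit (hs (sub_eq_zero.1 h3)) h1
    obtain ⟨j, ⟨W, μ, hW, hμ⟩, h1, h2⟩ := (hK.and (E1.and E2)).exists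
    have hchain : isingChain (Fin.snoc hx (24 / 25 * b) : Fin (M + 2) → ℝ)
        (Fin.snoc hz (7 / 25 * b) : Fin (M + 2) → ℝ) (Fin.snoc J j : Fin (M + 1) → ℝ) =
        V' * (diagonal (fun i => (Lam i : ℂ)) + (j : ℂ) • B) * V'ᴴ := by
      rw [isingChain_succ]
      simp only [Fin.snoc_castSucc, Fin.snoc_last]
      rw [hVd.2, Matrix.mul_add, Matrix.add_mul, Matrix.mul_smul, Matrix.smul_mul, ← hBeq]
      congr 2
      simp only [← Matrix.mul_assoc]
      rw [hVd.mul_conjTranspose, Matrix.one_mul, Matrix.mul_assoc, hVd.mul_conjTranspose,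
        Matrix.mul_one]
    refine ⟨_, _, _, V' * W, μ, Diagonalizes.trans hVd.1 hchain hW, ?_, ?_⟩
    · intro a b' c d h
      by_contra hnt
      refine h1 a b' c d hnt (μ a + μ b' - μ c - μ d) ?_ (by linarith)
      have ha := abs_le.1 (hμ a).1
      have hb := abs_le.1 (hμ b').1
      have hc := abs_le.1 (hμ c).1
      have hd := abs_le.1 (hμ d).1
      rw [abs_le]
      constructor <;> linarith
    · intro k k' h
      by_contra hne
      have hWC : (V' * W)ᴴ * onSite (Fin.last (M + 1)) (pauli .z) * (V' * W) = Wᴴ * C * W := by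
        rw [← hCeq, conjTranspose_mul]
        simp only [Matrix.mul_assoc]
      simp only [hWC] at h
      refine h2 k k' hne (((Wᴴ * C * W) k k).re - ((Wᴴ * C * W) k' k').re) ?_ (by rw [h, sub_self])
      have hre : ∀ k, |((Wᴴ * C * W) k k).re - (7 / 25 * spinSign (k (Fin.last _)) +
          j * (576 / 625 / b * (spinSign (k (Fin.last _)) * s fun l => k l.castSucc)))| ≤
          K * j ^ 2 := by
        intro k
        have h3 := (Complex.abs_re_le_norm _).trans (hμ k).2
        rw [hC0, hC1, hC2, ← Complex.ofReal_add, ← Complex.ofReal_mul, ← Complex.ofReal_add,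
          Complex.sub_re, Complex.ofReal_re] at h3
        refine le_of_eq_of_le ?_ h3
        congr 3
        ring
      have h3 := abs_le.1 (hre k)
      have h4 := abs_le.1 (hre k')
      rw [abs_le]
      constructor <;> linarith

end Chain

/-! ### Zero sets of real analytic functions -/

section AnalyticNull

open Filter Topology Set

/-- The zeros of a real analytic function that is not identically zero form a null set. -/
theorem measure_zeros_of_analytic {E : Type*} [NormedAddCommGroup E] [NormedSpace ℝ E]
    [FiniteDimensional ℝ E] [MeasurableSpace E] [BorelSpace E] (μ : Measure E)
    [μ.IsAddHaarMeasure] {F : E → ℂ} (hF : AnalyticOnNhd ℝ F univ) {p₀ : E} (h₀ : F p₀ ≠ 0) :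
    μ {p | F p = 0} = 0 := by
  set G : E → ℂ := fun q => F (p₀ + q)
  have hGc : Continuous G := by
    have : Continuous F := continuousOn_univ.1 hF.continuousOn
    fun_prop
  have hG0 : G 0 ≠ 0 := by simpa [G] using h₀
  have h1 : μ {p | F p = 0} = μ {q | G q = 0} := (measure_preimage_add μ p₀ _).symm
  have hmeas : MeasurableSet {q | G q = 0} := (isClosed_eq hGc continuous_const).measurableSet
  have hne : {q | G q = 0} ⊆ ({0}ᶜ : Set E) := by
    rintro q hq rfl
    exact hG0 hq
  have hemb : MeasurableEmbedding ((↑) : ({0}ᶜ : Set E) → E) :=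
    MeasurableEmbedding.subtype_coe (measurableSet_singleton _).compl
  -- After translation the function is nonzero at the origin, so its restriction to every line
  -- through the origin is a nonzero analytic function of one variable, with discrete zeros.
  have hline : ∀ ω : E, ∀ᵐ r : ℝ, G (r • ω) ≠ 0 := by
    intro ω
    have ha : AnalyticOnNhd ℝ (fun r : ℝ => G (r • ω)) univ := fun r _ => by
      refine AnalyticAt.comp (g := F) (f := fun r : ℝ => p₀ + r • ω) (hF _ (mem_univ _)) ?_
      fun_prop
    have h2 := ha.preimage_zero_mem_codiscrete (x := 0) (by simpa using hG0)
    have h3 := ae_restrict_le_codiscreteWithin (μ := (volume : Measure ℝ)) MeasurableSet.univ h2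
    rw [Measure.restrict_univ] at h3
    exact h3
  -- Polar coordinates and Fubini integrate the null sets on the rays to a null set in the whole
  -- space.
  have hpol := μ.measurePreserving_homeomorphUnitSphereProd
  set S : Set (Metric.sphere (0 : E) 1 × Ioi (0 : ℝ)) := {x | G (x.2.1 • x.1.1) = 0}
  have hS : MeasurableSet S := by
    refine IsClosed.measurableSet (isClosed_eq ?_ continuous_const)
    fun_prop
  rw [h1, ← inter_eq_self_of_subset_left hne, ← Subtype.range_coe (s := ({0}ᶜ : Set E)),
    ← image_preimage_eq_inter_range, ← hemb.comap_apply]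
  have h4 : ((↑) : ({0}ᶜ : Set E) → E) ⁻¹' {q | G q = 0} = homeomorphUnitSphereProd E ⁻¹' S := by
    ext x
    have hx : ‖x.1‖ ≠ 0 := norm_ne_zero_iff.2 x.2
    simp only [S, mem_preimage, mem_ofPred_eq, homeomorphUnitSphereProd_apply_fst_coe,
      homeomorphUnitSphereProd_apply_snd_coe]
    rw [smul_smul, mul_inv_cancel₀ hx, one_smul]
  rw [h4, hpol.measure_preimage hS.nullMeasurableSet, Measure.measure_prod_null hS]
  refine Eventually.of_forall fun ω => ?_
  change Measure.volumeIoiPow _ _ = 0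
  rw [Measure.volumeIoiPow]
  refine withDensity_absolutelyContinuous _ _ ?_
  rw [(MeasurableEmbedding.subtype_coe measurableSet_Ioi).comap_apply]
  refine measure_mono_null ?_ (hline ω.1)
  rintro _ ⟨r, hr, rfl⟩ hr2
  exact hr2 hr

end AnalyticNull

/-! ### Discriminant of pair products and diagonalization of unitaries -/

section Resonance

variable {ι : Type} [Fintype ι] [DecidableEq ι]

/-- The complex numbers `z` have no multiplicative resonances. -/
def NoProductResonance {κ : Type} (z : κ → ℂ) : Prop :=
  ∀ a b c d, z a * z b = z c * z d → (a = c ∧ b = d) ∨ (a = d ∧ b = c)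

/-- The product of the two values of `z` on an unordered pair. -/
def pairProduct {κ : Type} (z : κ → ℂ) (q : Sym2 κ) : ℂ := (q.map z).mul

theorem pairProduct_injective_iff {κ : Type} (z : κ → ℂ) :
    Function.Injective (pairProduct z) ↔ NoProductResonance z := by
  have h : ∀ a b, pairProduct z s(a, b) = z a * z b := fun _ _ => rfl
  constructor
  · intro hi a b c d hab
    have := hi (a₁ := s(a, b)) (a₂ := s(c, d)) hab
    simpa using this
  · intro hn q q' hq
    induction q with | _ a b
    induction q' with | _ c d
    simpa using hn a b c d hq

/-- An off-diagonal unordered pair has two orderings; a diagonal one has one ordering plus one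
diagonal label. This is why the trace of `A ^ (2 * k)` enters `pairPowerSum`. -/
theorem card_sym2_fiber (q : Sym2 ι) :
    (Finset.univ.filter fun p : ι × ι => s(p.1, p.2) = q).card +
      (Finset.univ.filter fun a : ι => s(a, a) = q).card = 2 := by
  induction q with | _ a b
  by_cases hab : a = b
  · subst hab
    have h1 : (Finset.univ.filter fun p : ι × ι => s(p.1, p.2) = s(a, a)) = {(a, a)} := by
      ext ⟨x, y⟩; simp
    have h2 : (Finset.univ.filter fun x : ι => s(x, x) = s(a, a)) = {a} := by
      ext x; simp
    rw [h1, h2]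
    simp
  · have h1 : (Finset.univ.filter fun p : ι × ι => s(p.1, p.2) = s(a, b)) = {(a, b), (b, a)} := by
      ext ⟨x, y⟩; simp
    have h2 : (Finset.univ.filter fun x : ι => s(x, x) = s(a, b)) = ∅ := by
      ext x
      simp only [Finset.mem_filter, Finset.mem_univ, true_and, Sym2.eq_iff, Finset.notMem_empty,
        iff_false]
      rintro (⟨h, h'⟩ | ⟨h, h'⟩)
      · exact hab (h.symm.trans h')
      · exact hab (h'.symm.trans h)
    rw [h1, h2, Finset.card_pair (by simp [hab]), Finset.card_empty]

theorem two_mul_sum_sym2 {M : Type*} [CommRing M] (f : Sym2 ι → M) :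
    2 * ∑ q, f q = ∑ a, ∑ b, f s(a, b) + ∑ a, f s(a, a) := by
  have h1 : ∑ a, ∑ b, f s(a, b) =
      ∑ q, ((Finset.univ.filter fun p : ι × ι => s(p.1, p.2) = q).card : M) * f q := by
    rw [← Fintype.sum_prod_type' (f := fun a b => f s(a, b)),
      ← Finset.sum_fiberwise Finset.univ fun p : ι × ι => s(p.1, p.2)]
    refine Finset.sum_congr rfl fun q _ => ?_
    rw [← nsmul_eq_mul, ← Finset.sum_const]
    exact Finset.sum_congr rfl fun p hp => by rw [(Finset.mem_filter.1 hp).2]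
  have h2 : ∑ a, f s(a, a) =
      ∑ q, ((Finset.univ.filter fun a : ι => s(a, a) = q).card : M) * f q := by
    rw [← Finset.sum_fiberwise Finset.univ fun a : ι => s(a, a)]
    refine Finset.sum_congr rfl fun q _ => ?_
    rw [← nsmul_eq_mul, ← Finset.sum_const]
    exact Finset.sum_congr rfl fun p hp => by rw [(Finset.mem_filter.1 hp).2]
  rw [h1, h2, ← Finset.sum_add_distrib, Finset.mul_sum]
  refine Finset.sum_congr rfl fun q _ => ?_
  rw [← add_mul, ← Nat.cast_add, card_sym2_fiber]
  norm_num

/-- The power sums of the products of unordered pairs of eigenvalues. -/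
noncomputable def pairPowerSum (k : ℕ) (A : Matrix ι ι ℂ) : ℂ :=
  ((A ^ k).trace ^ 2 + (A ^ (2 * k)).trace) / 2

/-- The discriminant of the products of unordered pairs of eigenvalues. -/
noncomputable def pairDiscriminant (A : Matrix ι ι ℂ) : ℂ :=
  (Matrix.of fun i j : Fin (Fintype.card (Sym2 ι)) => pairPowerSum (i + j : ℕ) A).det

theorem Diagonalizes.pow {V A : Matrix ι ι ℂ} {z : ι → ℂ} (h : Diagonalizes V z A) (k : ℕ) :
    Diagonalizes V (fun i => z i ^ k) (A ^ k) := by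
  induction k with
  | zero =>
    refine ⟨h.1, ?_⟩
    have h1 : diagonal (fun i => z i ^ 0) = 1 := by simp
    rw [h1, Matrix.mul_one, h.mul_conjTranspose, pow_zero]
  | succ k ih =>
    simp only [pow_succ]
    exact ih.mul h

theorem Diagonalizes.pairPowerSum_eq {V A : Matrix ι ι ℂ} {z : ι → ℂ} (h : Diagonalizes V z A)
    (k : ℕ) : pairPowerSum k A = ∑ q, pairProduct z q ^ k := by
  have h1 := two_mul_sum_sym2 fun q => pairProduct z q ^ k
  have h2 : ∀ a b, pairProduct z s(a, b) ^ k = z a ^ k * z b ^ k := fun a b => mul_pow _ _ _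
  simp only [h2] at h1
  rw [pairPowerSum, (h.pow k).trace_eq, (h.pow (2 * k)).trace_eq, div_eq_iff two_ne_zero,
    mul_comm _ (2 : ℂ), h1, sq, Finset.sum_mul_sum]
  simp only [two_mul, pow_add]

/-- The Hankel matrix of power sums is `Wᵀ * W` for the Vandermonde matrix `W` of the pair products,
so its determinant detects coincidences while being polynomial in the entries of `A`. -/
theorem Diagonalizes.pairDiscriminant_ne_zero_iff {V A : Matrix ι ι ℂ} {z : ι → ℂ}
    (h : Diagonalizes V z A) : pairDiscriminant A ≠ 0 ↔ NoProductResonance z := by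
  set e := (Fintype.equivFin (Sym2 ι)).symm
  have h1 : (Matrix.of fun i j : Fin (Fintype.card (Sym2 ι)) => pairPowerSum (i + j : ℕ) A) =
      (vandermonde (pairProduct z ∘ e))ᵀ * vandermonde (pairProduct z ∘ e) := by
    ext i j
    rw [vandermonde_transpose_mul_vandermonde, of_apply, h.pairPowerSum_eq]
    exact (e.sum_comp fun q => pairProduct z q ^ (i + j : ℕ)).symm
  rw [pairDiscriminant, h1, det_mul, det_transpose, mul_self_ne_zero, det_vandermonde_ne_zero_iff,
    e.injective_comp, pairProduct_injective_iff]

/-- The Cayley transform of a unitary matrix is Hermitian. -/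
theorem isHermitian_cayley {W K : Matrix ι ι ℂ} (hW : Wᴴ * W = 1) (hK : (1 + W) * K = 1) :
    (Complex.I • ((1 - W) * K)).IsHermitian := by
  have hK' : K * (1 + W) = 1 := mul_eq_one_comm.1 hK
  have hKs : (1 + Wᴴ) * Kᴴ = 1 := by
    have := congrArg conjTranspose hK'
    simpa using this
  have hKs' : Kᴴ * (1 + Wᴴ) = 1 := mul_eq_one_comm.1 hKs
  set H := Complex.I • ((1 - W) * K)
  have h1 : (1 + Wᴴ) * H * (1 + W) = Complex.I • (Wᴴ - W) := by
    simp only [H]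
    rw [Matrix.mul_smul, Matrix.smul_mul, Matrix.mul_assoc, Matrix.mul_assoc, hK', Matrix.mul_one]
    congr 1
    rw [Matrix.add_mul, Matrix.one_mul, Matrix.mul_sub, hW, Matrix.mul_one]
    abel
  have h2 : (1 + Wᴴ) * Hᴴ * (1 + W) = Complex.I • (Wᴴ - W) := by
    have h3 : Hᴴ = -Complex.I • (Kᴴ * (1 - Wᴴ)) := by
      simp only [H, conjTranspose_smul, conjTranspose_mul, conjTranspose_sub, conjTranspose_one]
      simp
    rw [h3, Matrix.mul_smul, Matrix.smul_mul, ← Matrix.mul_assoc, hKs, Matrix.one_mul, neg_smul,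
      ← smul_neg]
    congr 1
    rw [Matrix.sub_mul, Matrix.one_mul, Matrix.mul_add, hW, Matrix.mul_one]
    abel
  have h3 : ∀ X : Matrix ι ι ℂ, X = Kᴴ * ((1 + Wᴴ) * X * (1 + W)) * K := by
    intro X
    calc X = (Kᴴ * (1 + Wᴴ)) * X * ((1 + W) * K) := by rw [hKs', hK, Matrix.one_mul, Matrix.mul_one]
      _ = _ := by simp only [Matrix.mul_assoc]
  rw [IsHermitian, h3 Hᴴ, h2, ← h1, ← h3]

/-- The spectral theorem for unitary matrices. -/
theorem exists_diagonalizes_of_unitary {A : Matrix ι ι ℂ} (hA : Aᴴ * A = 1) :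
    ∃ (V : Matrix ι ι ℂ) (z : ι → ℂ), Diagonalizes V z A ∧ ∀ i, ‖z i‖ = 1 := by
  -- There are finitely many eigenvalues but infinitely many phases. The choice makes `-1` not an
  -- eigenvalue of `star u • A`, so its Cayley transform exists.
  obtain ⟨u, hu⟩ : ∃ u : Circle, ¬ (-A).charpoly.IsRoot u := by
    by_contra! hc
    have : Infinite Circle := by
      rw [Circle.argEquiv.infinite_iff, Set.infinite_coe_iff]
      exact Set.Ioc_infinite (by linarith [Real.pi_pos])
    have hinf : Set.Infinite (Set.range fun u : Circle => (u : ℂ)) :=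
      Set.infinite_range_of_injective Circle.coe_injective
    refine hinf ((-A).charpoly.roots.toFinset.finite_toSet.subset ?_)
    rintro _ ⟨u, rfl⟩
    simpa using ⟨(charpoly_monic _).ne_zero, hc u⟩
  have hu1 : (star (u : ℂ)) * u = 1 := by
    rw [RCLike.star_def, Complex.conj_mul', Circle.norm_coe]; simp
  set W : Matrix ι ι ℂ := star (u : ℂ) • A
  have hWA : A = (u : ℂ) • W := by
    simp only [W]
    rw [smul_smul, mul_comm, hu1, one_smul]
  have hW : Wᴴ * W = 1 := by
    simp only [W]
    rw [conjTranspose_smul, star_star, Matrix.smul_mul, Matrix.mul_smul, smul_smul, hA, mul_comm, hu1,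
      one_smul]
  have hdet : IsUnit (1 + W).det := by
    rw [isUnit_iff_ne_zero]
    intro h
    apply hu
    have h1 : scalar ι (u : ℂ) - -A = (u : ℂ) • (1 + W) := by
      rw [smul_add, ← hWA, sub_neg_eq_add]
      congr 1
      ext i j
      simp [scalar_apply, diagonal_apply, one_apply]
    rw [Polynomial.IsRoot, eval_charpoly, h1, det_smul, h, mul_zero]
  have hK : (1 + W) * (1 + W)⁻¹ = 1 := mul_nonsing_inv _ hdet
  have hH := isHermitian_cayley hW hK
  set H := Complex.I • ((1 - W) * (1 + W)⁻¹)
  have hd := exists_diagonalizes hH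
  set V := hH.eigenvectorUnitary.1
  set a := hH.eigenvalues
  have hHW : H * (1 + W) = Complex.I • (1 - W) := by
    simp only [H]
    rw [Matrix.smul_mul, Matrix.mul_assoc, nonsing_inv_mul _ hdet, Matrix.mul_one]
  set W' := Vᴴ * W * V
  have hW' : diagonal (fun i => (a i : ℂ)) * (1 + W') = Complex.I • (1 - W') := by
    rw [← hd.conj]
    have h1 : (1 : Matrix ι ι ℂ) + W' = Vᴴ * (1 + W) * V := by
      rw [Matrix.mul_add, Matrix.add_mul, Matrix.mul_one, hd.1]
    have h2 : (1 : Matrix ι ι ℂ) - W' = Vᴴ * (1 - W) * V := by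
      rw [Matrix.mul_sub, Matrix.sub_mul, Matrix.mul_one, hd.1]
    rw [h1, h2, ← Matrix.smul_mul, ← Matrix.mul_smul, ← hHW]
    calc _ = Vᴴ * H * (V * Vᴴ) * (1 + W) * V := by simp only [Matrix.mul_assoc]
      _ = _ := by rw [hd.mul_conjTranspose, Matrix.mul_one]; simp only [Matrix.mul_assoc]
  -- Off the diagonal the Cayley relation reads `(a i + I) * W' i j = 0`, and the eigenvalue `a i`
  -- is real.
  have hoff : ∀ i j, i ≠ j → W' i j = 0 := by
    intro i j hij
    have h1 := congrFun (congrFun hW' i) j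
    simp only [diagonal_mul, Matrix.smul_apply, Matrix.add_apply, Matrix.sub_apply, one_apply_ne hij,
      zero_add, zero_sub, smul_eq_mul] at h1
    have h2 : ((a i : ℂ) + Complex.I) * W' i j = 0 := by linear_combination h1
    refine (mul_eq_zero.1 h2).resolve_left fun h3 => ?_
    have := congrArg Complex.im h3
    simp at this
  have hWd : W = V * diagonal (fun i => W' i i) * Vᴴ := by
    have h1 : diagonal (fun i => W' i i) = W' := by
      ext i j
      by_cases hij : i = j
      · subst hij; simp
      · rw [diagonal_apply_ne _ hij, hoff i j hij]
    rw [h1]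
    calc W = (V * Vᴴ) * W * (V * Vᴴ) := by
          rw [hd.mul_conjTranspose, Matrix.one_mul, Matrix.mul_one]
      _ = _ := by simp only [W', Matrix.mul_assoc]
  have hAd : Diagonalizes V (fun i => u * W' i i) A := by
    refine ⟨hd.1, ?_⟩
    have h1 : diagonal (fun i => (u : ℂ) * W' i i) = (u : ℂ) • diagonal fun i => W' i i := by
      rw [← diagonal_smul]; rfl
    rw [h1, Matrix.mul_smul, Matrix.smul_mul, ← hWd, hWA]
  refine ⟨V, _, hAd, fun i => ?_⟩
  have h1 : (diagonal fun i => (u : ℂ) * W' i i)ᴴ * (diagonal fun i => (u : ℂ) * W' i i) = 1 := by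
    rw [← hAd.conj]
    calc _ = Vᴴ * (Aᴴ * (V * Vᴴ) * A) * V := by
          simp only [conjTranspose_mul, conjTranspose_conjTranspose, Matrix.mul_assoc]
      _ = 1 := by rw [hd.mul_conjTranspose, Matrix.mul_one, hA, Matrix.mul_one, hd.1]
  have h2 := congrFun (congrFun h1 i) i
  rw [diagonal_conjTranspose, diagonal_mul_diagonal, diagonal_apply_eq, one_apply_eq, Pi.star_apply,
    RCLike.star_def, Complex.conj_mul'] at h2
  have h3 : ‖(u : ℂ) * W' i i‖ ^ 2 = 1 := by exact_mod_cast h2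
  exact (pow_eq_one_iff_of_nonneg (norm_nonneg _) two_ne_zero).1 h3

end Resonance

/-! ### Almost every Floquet operator is nonresonant -/

section Generic

attribute [local instance] Matrix.linftyOpNormedRing Matrix.linftyOpNormedAlgebra

theorem isLinearMap_hamiltonian (E : Ensemble) {N : ℕ} (j : Fin E.n) :
    IsLinearMap ℝ fun p : Params E.n N => E.hamiltonian p j := by
  have hite : ∀ (b : Bool) (x y : ℝ), (if b then ((x + y : ℝ) : ℂ) else 0) =
      (if b then (x : ℂ) else 0) + (if b then (y : ℂ) else 0) := by
    intro b x y; cases b <;> simp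
  have hite' : ∀ (b : Bool) (x y : ℝ), (if b then ((x * y : ℝ) : ℂ) else 0) =
      (x : ℂ) * (if b then (y : ℂ) else 0) := by
    intro b x y; cases b <;> simp
  constructor
  · intro p q
    simp only [Ensemble.hamiltonian, Prod.fst_add, Prod.snd_add, Pi.add_apply, hite, add_smul,
      Finset.sum_add_distrib]
    abel
  · intro c p
    have hc : ∀ A : Op N, c • A = (c : ℂ) • A := fun A => rfl
    simp only [Ensemble.hamiltonian, Prod.smul_fst, Prod.smul_snd, Pi.smul_apply, smul_eq_mul,
      hite', mul_smul, hc, smul_add, Finset.smul_sum]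

theorem analyticAt_list_prod {E A : Type*} [NormedAddCommGroup E] [NormedSpace ℝ E] [NormedRing A]
    [NormedAlgebra ℝ A] (l : List (E → A)) {x : E} (h : ∀ f ∈ l, AnalyticAt ℝ f x) :
    AnalyticAt ℝ (fun y => (l.map fun f => f y).prod) x := by
  induction l with
  | nil => simpa using analyticAt_const
  | cons f l ih =>
    simp only [List.map_cons, List.prod_cons]
    exact (h f (by simp)).mul (ih fun g hg => h g (by simp [hg]))

/-- The operator is a finite product of exponentials of matrices that depend linearly on the
parameters. -/
theorem analyticAt_floquetOp (E : Ensemble) {N : ℕ} (p : Params E.n N) :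
    AnalyticAt ℝ (fun p : Params E.n N => E.floquetOp p) p := by
  have h : ∀ p : Params E.n N, E.floquetOp p = ((List.ofFn fun (j : Fin E.n) (p : Params E.n N) =>
      NormedSpace.exp ((-Complex.I * (E.elapsed 1 j : ℂ)) • E.hamiltonian p j)).reverse.map
      fun f => f p).prod := by
    intro p
    rw [Ensemble.floquetOp, Ensemble.partialEvolution, List.map_reverse, List.map_ofFn]
    rfl
  simp only [h]
  refine analyticAt_list_prod _ fun f hf => ?_
  rw [List.mem_reverse, List.mem_ofFn] at hf
  obtain ⟨j, rfl⟩ := hf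
  have h1 : AnalyticAt ℝ (NormedSpace.exp : Op N → Op N)
      ((-Complex.I * (E.elapsed 1 j : ℂ)) • E.hamiltonian p j) := NormedSpace.exp_analytic _
  refine h1.comp (f := fun p : Params E.n N =>
    (-Complex.I * (E.elapsed 1 j : ℂ)) • E.hamiltonian p j) ?_
  have h2 : AnalyticAt ℝ (fun p : Params E.n N => E.hamiltonian p j) p :=
    (LinearMap.toContinuousLinearMap (isLinearMap_hamiltonian E j).mk').analyticAt p
  exact h2.const_smul (c := -Complex.I * (E.elapsed 1 j : ℂ))

theorem analyticAt_pairDiscriminant {E : Type*} [NormedAddCommGroup E] [NormedSpace ℝ E] {ι : Type}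
    [Fintype ι] [DecidableEq ι] {A : E → Matrix ι ι ℂ} {x : E} (hA : AnalyticAt ℝ A x) :
    AnalyticAt ℝ (fun y => pairDiscriminant (A y)) x := by
  have htr : ∀ k : ℕ, AnalyticAt ℝ (fun y => (A y ^ k).trace) x := fun k =>
    ((LinearMap.toContinuousLinearMap (traceLinearMap ι ℝ ℂ)).analyticAt _).comp (hA.pow k)
  have hps : ∀ k : ℕ, AnalyticAt ℝ (fun y => pairPowerSum k (A y)) x := fun k => by
    simp only [pairPowerSum, div_eq_mul_inv]
    exact (((htr k).pow 2).add (htr (2 * k))).mul analyticAt_const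
  simp only [pairDiscriminant, det_apply, of_apply]
  refine Finset.analyticAt_fun_sum _ fun σ _ => ?_
  have h := Finset.analyticAt_fun_prod (N := Finset.univ)
    fun (i : Fin (Fintype.card (Sym2 ι))) _ => hps (σ i + i : ℕ)
  have h2 : ∀ z : ℂ, Equiv.Perm.sign σ • z = ((Equiv.Perm.sign σ : ℤ) : ℂ) * z := fun z => by
    rw [Units.smul_def, zsmul_eq_mul]
  simp only [h2]
  exact analyticAt_const.mul h

theorem partialEvolution_unitary (E : Ensemble) {N : ℕ} (p : Params E.n N) (x : ℝ) :
    E.partialEvolution p x ∈ unitary (Op N) := by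
  refine list_prod_mem fun M hM => ?_
  rw [List.mem_reverse, List.mem_ofFn] at hM
  obtain ⟨j, rfl⟩ := hM
  exact exp_unitary (E.hamiltonian_isHermitian p j) _

theorem list_prod_reverse_ofFn {M : Type*} [Monoid M] {n : ℕ} (hn : 0 < n) (f : Fin n → M)
    (h : ∀ j, j ≠ ⟨0, hn⟩ → f j = 1) : (List.ofFn f).reverse.prod = f ⟨0, hn⟩ := by
  obtain ⟨n, rfl⟩ : ∃ k, n = k + 1 := ⟨n - 1, by omega⟩
  rw [List.ofFn_succ, List.reverse_cons, List.prod_append, List.prod_singleton,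
    List.prod_eq_one, one_mul]
  · rfl
  · intro x hx
    rw [List.mem_reverse, List.mem_ofFn] at hx
    obtain ⟨j, rfl⟩ := hx
    exact h _ (by simp [Fin.ext_iff])

theorem sum_axis {M : Type*} [AddCommMonoid M] (f : Axis → M) :
    ∑ u, f u = f .x + (f .y + f .z) := by
  change Finset.sum {Axis.x, Axis.y, Axis.z} f = _
  rw [Finset.sum_insert (by simp), Finset.sum_insert (by simp), Finset.sum_singleton]

theorem elapsed_one_pos (E : Ensemble) (j : Fin E.n) : 0 < E.elapsed 1 j := by
  have h1 := E.T_strictMono (Fin.castSucc_lt_succ (i := j))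
  have h2 : E.T j.succ ≤ 1 := by
    rw [← E.T_last]
    exact E.T_strictMono.monotone (Fin.le_last _)
  rw [Ensemble.elapsed, min_eq_right h2]
  exact lt_max_of_lt_right (by linarith)

/-- The parameters of an Ising chain, scaled by `s`, in the first piece. -/
def isingParams (E : Ensemble) {M : ℕ} (s : ℝ) (hx hz : Fin (M + 1) → ℝ) (J : Fin M → ℝ) :
    Params E.n (M + 1) :=
  (fun j l u => if j = E.first then
      (match u with
        | .x => s * hx l
        | .y => 0
        | .z => s * hz l)
    else 0,
  fun j l u v => if j = E.first ∧ u = .z ∧ v = .z then s * J l else 0)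

theorem hamiltonian_isingParams_first (E : Ensemble) (hαx : E.α E.first .x = true)
    (hαz : E.α E.first .z = true) (hγ : E.γ E.first .z .z = true) {M : ℕ} (s : ℝ)
    (hx hz : Fin (M + 1) → ℝ) (J : Fin M → ℝ) :
    E.hamiltonian (isingParams E s hx hz J) E.first = (s : ℂ) • isingChain hx hz J := by
  simp only [Ensemble.hamiltonian, isingParams, sum_axis, hαx, hαz, if_true]
  simp only [reduceCtorEq, false_and, and_false, if_false, Complex.ofReal_zero, ite_self,
    zero_smul, zero_add, add_zero, and_self, if_true, hγ]
  simp only [isingChain, smul_add, Finset.smul_sum, smul_smul, Complex.ofReal_mul]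
  rfl

theorem hamiltonian_isingParams_of_ne (E : Ensemble) {M : ℕ} (s : ℝ)
    (hx hz : Fin (M + 1) → ℝ) (J : Fin M → ℝ) {j : Fin E.n} (hj : j ≠ E.first) :
    E.hamiltonian (isingParams E s hx hz J) j = 0 := by
  simp [Ensemble.hamiltonian, isingParams, hj]

theorem Diagonalizes.exp_smul {ι : Type} [Fintype ι] [DecidableEq ι] {V A : Matrix ι ι ℂ}
    {d : ι → ℂ} (h : Diagonalizes V d A) (c : ℂ) :
    Diagonalizes V (fun i => Complex.exp (c * d i)) (NormedSpace.exp (c • A)) := by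
  refine ⟨h.1, ?_⟩
  have hV : V⁻¹ = Vᴴ := inv_eq_left_inv h.1
  have hu : IsUnit V := IsUnit.of_mul_eq_one _ h.mul_conjTranspose
  have h1 : c • A = V * diagonal (fun i => c * d i) * V⁻¹ := by
    have h2 : diagonal (fun i => c * d i) = c • diagonal d := by
      rw [← diagonal_smul]; rfl
    rw [h2, Matrix.mul_smul, Matrix.smul_mul, hV, ← h.2]
  rw [h1, Matrix.exp_conj _ _ hu, Matrix.exp_diagonal, hV]
  congr 3
  ext i
  rw [Pi.coe_exp, Complex.exp_eq_exp_ℂ]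

/-- Switching off every piece but the first makes the Floquet operator one exponential of the
nonresonant chain. The remaining danger, that phases agree only modulo `2 * π`, is removed by
scaling the chain down. -/
theorem exists_pairDiscriminant_ne_zero (E : Ensemble) (hαx : E.α E.first .x = true)
    (hαz : E.α E.first .z = true) (hγ : E.γ E.first .z .z = true) (M : ℕ) :
    ∃ p : Params E.n (M + 1), pairDiscriminant (E.floquetOp p) ≠ 0 := by
  obtain ⟨hx, hz, J, V, lam, hV, hlam, -⟩ := exists_noResonance_isingChain M
  set τ := E.elapsed 1 E.first
  have hτ : 0 < τ := elapsed_one_pos E _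
  set B : ℝ := 1 + ∑ k, 2 * |lam k|
  have hB0 : 0 < B := by simp only [B]; positivity
  have hB : ∀ k, 2 * |lam k| ≤ B := fun k => by
    have := Finset.single_le_sum (f := fun k => 2 * |lam k|) (fun _ _ => by positivity)
      (Finset.mem_univ k)
    simp only [B]
    linarith
  -- The factor `τ` cancels the duration of the first piece, and `B` makes every sum of two phases
  -- lie in `[-1, 1]`, where the exponential is injective.
  set p := isingParams E (1 / (τ * B)) hx hz J
  have hop : E.floquetOp p = NormedSpace.exp ((-Complex.I * (1 / B : ℝ) : ℂ) • isingChain hx hz J) := by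
    rw [Ensemble.floquetOp, Ensemble.partialEvolution, list_prod_reverse_ofFn E.n_pos]
    · change NormedSpace.exp ((-Complex.I * (τ : ℂ)) • E.hamiltonian p E.first) = _
      rw [hamiltonian_isingParams_first E hαx hαz hγ, smul_smul]
      congr 2
      have h1 : (τ : ℂ) ≠ 0 := by exact_mod_cast hτ.ne'
      have h2 : (B : ℂ) ≠ 0 := by exact_mod_cast hB0.ne'
      push_cast
      field_simp
    · intro j hj
      rw [hamiltonian_isingParams_of_ne E _ _ _ _ hj, smul_zero, NormedSpace.exp_zero]
  refine ⟨p, ?_⟩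
  rw [hop, (hV.exp_smul _).pairDiscriminant_ne_zero_iff]
  intro a b c d h
  apply hlam
  rw [← Complex.exp_add, ← Complex.exp_add] at h
  have him : ∀ x y, (-Complex.I * (1 / B : ℝ) * (lam x : ℂ) + -Complex.I * (1 / B : ℝ) * (lam y : ℂ)) =
      ((-(1 / B * (lam x + lam y)) : ℝ) : ℂ) * Complex.I := by
    intro x y; push_cast; ring
  have hbd : ∀ x y, |(-(1 / B * (lam x + lam y)))| ≤ 1 := by
    intro x y
    rw [abs_neg, abs_mul, abs_of_pos (by positivity), one_div, inv_mul_le_iff₀ hB0, mul_one]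
    have := abs_add_le (lam x) (lam y)
    linarith [hB x, hB y]
  rw [him, him] at h
  have hpi := Real.pi_gt_three
  have h1 := abs_le.1 (hbd a b)
  have h2 := abs_le.1 (hbd c d)
  have hre : ∀ x : ℝ, ((x : ℂ) * Complex.I).im = x := fun x => by simp
  have h3 := Complex.exp_inj_of_neg_pi_lt_of_le_pi (by rw [hre]; linarith [h1.1])
    (by rw [hre]; linarith [h1.2]) (by rw [hre]; linarith [h2.1]) (by rw [hre]; linarith [h2.2]) h
  have h4 := congrArg Complex.im h3
  rw [hre, hre, neg_inj] at h4
  exact mul_left_cancel₀ (by positivity) h4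

/-- For almost all parameters, the quasienergies of the Floquet operator and their gaps are
nondegenerate. -/
theorem ae_noProductResonance (E : Ensemble) (hαx : E.α E.first .x = true)
    (hαz : E.α E.first .z = true) (hγ : E.γ E.first .z .z = true) {N : ℕ} (hN : 0 < N) :
    ∀ᵐ p : Params E.n N, ∃ (V : Op N) (z : Config (Fin N) → ℂ),
      Diagonalizes V z (E.floquetOp p) ∧ (∀ k, ‖z k‖ = 1) ∧ NoProductResonance z := by
  obtain ⟨M, rfl⟩ : ∃ k, N = k + 1 := ⟨N - 1, by omega⟩
  obtain ⟨p₀, h₀⟩ := exists_pairDiscriminant_ne_zero E hαx hαz hγ M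
  have : BorelSpace (Fin E.n → Fin (M + 1) → Axis → ℝ) := inferInstance
  have : BorelSpace (Axis → Axis → ℝ) := inferInstance
  have : BorelSpace (Fin (M + 1 - 1) → Axis → Axis → ℝ) := inferInstance
  have : BorelSpace (Fin E.n → Fin (M + 1 - 1) → Axis → Axis → ℝ) := inferInstance
  have : BorelSpace (Params E.n (M + 1)) := Prod.borelSpace
  have : (volume : Measure (Axis → Axis → ℝ)).IsAddHaarMeasure := Measure.pi.isAddHaarMeasure _
  have : (volume : Measure (Fin (M + 1 - 1) → Axis → Axis → ℝ)).IsAddHaarMeasure :=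
    Measure.pi.isAddHaarMeasure _
  have : (volume : Measure (Fin E.n → Fin (M + 1 - 1) → Axis → Axis → ℝ)).IsAddHaarMeasure :=
    Measure.pi.isAddHaarMeasure _
  have : (volume : Measure (Fin (M + 1) → Axis → ℝ)).IsAddHaarMeasure :=
    Measure.pi.isAddHaarMeasure _
  have : (volume : Measure (Fin E.n → Fin (M + 1) → Axis → ℝ)).IsAddHaarMeasure :=
    Measure.pi.isAddHaarMeasure _
  have : SigmaFinite (volume : Measure (Fin (M + 1 - 1) → Axis → Axis → ℝ)) :=
    Measure.pi.sigmaFinite _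
  have : SigmaFinite (volume : Measure (Fin E.n → Fin (M + 1 - 1) → Axis → Axis → ℝ)) :=
    Measure.pi.sigmaFinite _
  have : SigmaFinite (volume : Measure (Fin (M + 1) → Axis → ℝ)) := Measure.pi.sigmaFinite _
  have : SigmaFinite (volume : Measure (Fin E.n → Fin (M + 1) → Axis → ℝ)) :=
    Measure.pi.sigmaFinite _
  have : (volume : Measure (Params E.n (M + 1))).IsAddHaarMeasure :=
    Measure.prod.instIsAddHaarMeasure _ _
  have h := measure_zeros_of_analytic (volume : Measure (Params E.n (M + 1)))
    (F := fun p => pairDiscriminant (E.floquetOp p))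
    (fun p _ => analyticAt_pairDiscriminant (analyticAt_floquetOp E p)) h₀
  have h' : ∀ᵐ p : Params E.n (M + 1), pairDiscriminant (E.floquetOp p) ≠ 0 := by
    rw [ae_iff]
    simpa using h
  filter_upwards [h'] with p hp
  have hU : E.floquetOp p ∈ unitary (Op (M + 1)) := partialEvolution_unitary E p 1
  obtain ⟨V, z, hV, hz⟩ := exists_diagonalizes_of_unitary hU.1
  exact ⟨V, z, hV, hz, hV.pairDiscriminant_ne_zero_iff.1 hp⟩

end Generic

/-! ### Time averages and dephasing -/

theorem norm_geom_sum_le {ζ : ℂ} (hζ : ‖ζ‖ = 1) (h1 : ζ ≠ 1) (M : ℕ) :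
    ‖∑ m ∈ Finset.range M, ζ ^ m‖ ≤ 2 / ‖ζ - 1‖ := by
  rw [geom_sum_eq h1, norm_div]
  gcongr
  calc ‖ζ ^ M - 1‖ ≤ ‖ζ ^ M‖ + ‖(1 : ℂ)‖ := norm_sub_le _ _
    _ = 2 := by rw [norm_pow, hζ]; norm_num

theorem mul_star_self_of_norm_one {z : ℂ} (hz : ‖z‖ = 1) : z * star z = 1 := by
  have := Complex.mul_conj' z
  rw [hz] at this
  simpa using this

/-- Expand the square: equal frequencies contribute `M` each, and unequal ones give geometric sums
bounded independently of `M`. The constant depends only on the frequencies, so it stays uniform when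
the coefficients vary with `x`. -/
theorem sum_norm_sq_trigonometric_le {Q : Type} [Fintype Q] {ζ : Q → ℂ} (hζ : ∀ q, ‖ζ q‖ = 1)
    (hinj : Function.Injective ζ) :
    ∃ C : ℝ, 0 ≤ C ∧ ∀ (M : ℕ) (g : Q → ℂ),
      ∑ m ∈ Finset.range M, ‖∑ q, g q * ζ q ^ m‖ ^ 2 ≤
        M * ∑ q, ‖g q‖ ^ 2 + C * (∑ q, ‖g q‖) ^ 2 := by
  classical
  set C : ℝ := ∑ q, ∑ r, 2 / ‖ζ q * star (ζ r) - 1‖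
  have hC : ∀ q r, 2 / ‖ζ q * star (ζ r) - 1‖ ≤ C := fun q r =>
    (Finset.single_le_sum (f := fun r => 2 / ‖ζ q * star (ζ r) - 1‖)
      (fun _ _ => by positivity) (Finset.mem_univ r)).trans
    (Finset.single_le_sum (f := fun q => ∑ r, 2 / ‖ζ q * star (ζ r) - 1‖)
      (fun _ _ => by positivity) (Finset.mem_univ q))
  have hC0 : 0 ≤ C := by positivity
  refine ⟨C, hC0, fun M g => ?_⟩
  have hexp : ((∑ m ∈ Finset.range M, ‖∑ q, g q * ζ q ^ m‖ ^ 2 : ℝ) : ℂ) =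
      ∑ q, ∑ r, g q * star (g r) * ∑ m ∈ Finset.range M, (ζ q * star (ζ r)) ^ m := by
    push_cast
    calc ∑ m ∈ Finset.range M, (‖∑ q, g q * ζ q ^ m‖ : ℂ) ^ 2
        = ∑ m ∈ Finset.range M, ∑ q, ∑ r, g q * star (g r) * (ζ q * star (ζ r)) ^ m := by
          refine Finset.sum_congr rfl fun m _ => ?_
          rw [← Complex.mul_conj', map_sum, Finset.sum_mul_sum]
          refine Finset.sum_congr rfl fun q _ => Finset.sum_congr rfl fun r _ => ?_
          simp only [map_mul, map_pow, mul_pow, RCLike.star_def]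
          ring
      _ = _ := by
          rw [Finset.sum_comm]
          refine Finset.sum_congr rfl fun q _ => ?_
          rw [Finset.sum_comm]
          exact Finset.sum_congr rfl fun r _ => (Finset.mul_sum _ _ _).symm
  have hgeo : ∀ q r, ‖∑ m ∈ Finset.range M, (ζ q * star (ζ r)) ^ m‖ ≤
      (if q = r then (M : ℝ) else 0) + C := by
    intro q r
    split_ifs with h
    · subst h
      rw [mul_star_self_of_norm_one (hζ q)]
      simpa using hC0
    · rw [zero_add]
      refine (norm_geom_sum_le (by rw [norm_mul, norm_star, hζ, hζ, one_mul]) (fun h1 => h ?_)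
        M).trans (hC q r)
      apply hinj
      calc ζ q = ζ q * star (ζ r) * ζ r := by
            rw [mul_assoc, mul_comm (star _), mul_star_self_of_norm_one (hζ r), mul_one]
        _ = ζ r := by rw [h1, one_mul]
  calc ∑ m ∈ Finset.range M, ‖∑ q, g q * ζ q ^ m‖ ^ 2
      = ‖((∑ m ∈ Finset.range M, ‖∑ q, g q * ζ q ^ m‖ ^ 2 : ℝ) : ℂ)‖ := by
        rw [Complex.norm_real, Real.norm_of_nonneg (by positivity)]
    _ ≤ ∑ q, ∑ r, ‖g q‖ * ‖g r‖ * ((if q = r then (M : ℝ) else 0) + C) := by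
        rw [hexp]
        refine norm_sum_le_of_le _ fun q _ => norm_sum_le_of_le _ fun r _ => ?_
        rw [norm_mul, norm_mul, norm_star]
        exact mul_le_mul_of_nonneg_left (hgeo q r) (by positivity)
    _ = M * ∑ q, ‖g q‖ ^ 2 + C * (∑ q, ‖g q‖) ^ 2 := by
        simp only [mul_add, Finset.sum_add_distrib, mul_ite, mul_zero, Finset.sum_ite_eq,
          Finset.mem_univ, if_true]
        rw [sq (∑ q, ‖g q‖), Finset.sum_mul_sum, Finset.mul_sum, Finset.mul_sum]
        simp only [Finset.mul_sum]
        congr 1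
        · exact Finset.sum_congr rfl fun q _ => by ring
        · exact Finset.sum_congr rfl fun q _ => Finset.sum_congr rfl fun r _ => by ring

theorem sum_glue {N : ℕ} (S : Finset (Fin N)) {M : Type*} [AddCommMonoid M]
    (f : Config (Fin N) → M) :
    ∑ s, f s = ∑ a : Config S, ∑ c : Config {l // l ∉ S}, f (glue S a c) := by
  rw [← Equiv.sum_comp (Equiv.piEquivPiSubtypeProd (fun l => l ∈ S) (fun _ => Fin 2)).symm,
    Fintype.sum_prod_type]
  rfl

/-- The operator with eigenvectors the columns of `Y` and eigenvalues `p`. -/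
def mixture {ι κ : Type} [Fintype κ] (Y : Matrix ι κ ℂ) (p : κ → ℝ) : Matrix ι ι ℂ :=
  fun s t => ∑ k, (p k : ℂ) * (Y s k * star (Y t k))

theorem mixture_apply {ι κ : Type} [Fintype κ] (Y : Matrix ι κ ℂ) (p : κ → ℝ) (s t : ι) :
    mixture Y p s t = ∑ k, (p k : ℂ) * (Y s k * star (Y t k)) := rfl

theorem mixture_eq {ι κ : Type} [Fintype κ] [DecidableEq κ] (Y : Matrix ι κ ℂ) (p : κ → ℝ) :
    mixture Y p = Y * diagonal (fun k => (p k : ℂ)) * Yᴴ := by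
  ext s t
  rw [mul_apply]
  refine Finset.sum_congr rfl fun k _ => ?_
  rw [mul_diagonal, conjTranspose_apply]
  ring

theorem sum_norm_sq_mixture {ι : Type} [Fintype ι] [DecidableEq ι] {Y : Matrix ι ι ℂ}
    (hY : Yᴴ * Y = 1) (p : ι → ℝ) : ∑ s, ∑ t, ‖mixture Y p s t‖ ^ 2 = ∑ k, p k ^ 2 := by
  have h1 : Diagonalizes Y (fun k => (p k : ℂ)) (mixture Y p) := ⟨hY, mixture_eq Y p⟩
  have h2 : (mixture Y p)ᴴ = mixture Y p := by
    ext s t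
    rw [conjTranspose_apply, mixture_apply, mixture_apply, star_sum]
    refine Finset.sum_congr rfl fun k _ => ?_
    rw [star_mul', star_mul', star_star, mul_comm (star (Y t k)), RCLike.star_def,
      Complex.conj_ofReal]
  have h3 := trace_conjTranspose_mul_self (mixture Y p)
  rw [h2, ← sq, (h1.pow 2).trace_eq] at h3
  exact_mod_cast h3.symm

/-- The matrix elements on `S` of the transition operator between two columns of `Y`. -/
def transition {N : ℕ} {κ : Type} (S : Finset (Fin N)) (Y : Matrix (Config (Fin N)) κ ℂ) (j k : κ) :
    Matrix (Config S) (Config S) ℂ :=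
  fun a b => ∑ c : Config {l // l ∉ S}, Y (glue S a c) j * star (Y (glue S b c) k)

theorem transition_apply {N : ℕ} {κ : Type} (S : Finset (Fin N)) (Y : Matrix (Config (Fin N)) κ ℂ)
    (j k : κ) (a b : Config S) : transition S Y j k a b =
      ∑ c : Config {l // l ∉ S}, Y (glue S a c) j * star (Y (glue S b c) k) := rfl

theorem sum_rearrange {J A C : Type} [Fintype J] [Fintype A] [Fintype C]
    (F : J → J → A → A → C → C → ℂ) :
    ∑ j, ∑ k, ∑ a, ∑ b, ∑ c, ∑ c', F j k a b c c' =
      ∑ c, ∑ c', ∑ a, ∑ b, ∑ j, ∑ k, F j k a b c c' := by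
  have h1 : ∑ j, ∑ k, ∑ a, ∑ b, ∑ c, ∑ c', F j k a b c c' =
      ∑ x : J × J × A × A × C × C, F x.1 x.2.1 x.2.2.1 x.2.2.2.1 x.2.2.2.2.1 x.2.2.2.2.2 := by
    simp only [Fintype.sum_prod_type]
  have h2 : ∑ c, ∑ c', ∑ a, ∑ b, ∑ j, ∑ k, F j k a b c c' =
      ∑ x : C × C × A × A × J × J, F x.2.2.2.2.1 x.2.2.2.2.2 x.2.2.1 x.2.2.2.1 x.1 x.2.1 := by
    simp only [Fintype.sum_prod_type]
  rw [h1, h2]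
  exact Fintype.sum_equiv
    ⟨fun x => (x.2.2.2.2.1, x.2.2.2.2.2, x.2.2.1, x.2.2.2.1, x.1, x.2.1),
      fun x => (x.2.2.2.2.1, x.2.2.2.2.2, x.2.2.1, x.2.2.2.1, x.1, x.2.1),
      fun _ => rfl, fun _ => rfl⟩ _ _ fun _ => rfl

/-- Exchanging the roles of the two subsystems: the weighted squared norms of the transition
operators reduced to `S` add up to the purity of the mixture reduced to the complement of `S`. -/
theorem sum_transition_eq {N : ℕ} {κ : Type} [Fintype κ] (S : Finset (Fin N))
    (Y : Matrix (Config (Fin N)) κ ℂ) (p : κ → ℝ) :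
    ∑ j, ∑ k, p j * p k * ∑ a, ∑ b, ‖transition S Y j k a b‖ ^ 2 =
      ∑ c : Config {l // l ∉ S}, ∑ c' : Config {l // l ∉ S},
        ‖∑ a, mixture Y p (glue S a c) (glue S a c')‖ ^ 2 := by
  apply Complex.ofReal_injective
  push_cast
  have h1 : ∀ j k, (p j : ℂ) * p k * ∑ a, ∑ b, (‖transition S Y j k a b‖ : ℂ) ^ 2 =
      ∑ a : Config S, ∑ b : Config S, ∑ c : Config {l // l ∉ S}, ∑ c' : Config {l // l ∉ S},
        (p j * p k : ℂ) * ((Y (glue S a c) j * star (Y (glue S b c) k)) *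
          star (Y (glue S a c') j * star (Y (glue S b c') k))) := by
    intro j k
    rw [Finset.mul_sum]
    refine Finset.sum_congr rfl fun a _ => ?_
    rw [Finset.mul_sum]
    refine Finset.sum_congr rfl fun b _ => ?_
    rw [← Complex.mul_conj', ← RCLike.star_def, transition_apply, star_sum, Finset.sum_mul_sum,
      Finset.mul_sum]
    exact Finset.sum_congr rfl fun c _ => Finset.mul_sum _ _ _
  have h2 : ∀ c c', (‖∑ a, mixture Y p (glue S a c) (glue S a c')‖ : ℂ) ^ 2 =
      ∑ a : Config S, ∑ b : Config S, ∑ j, ∑ k,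
        ((p j : ℂ) * (Y (glue S a c) j * star (Y (glue S a c') j))) *
          star ((p k : ℂ) * (Y (glue S b c) k * star (Y (glue S b c') k))) := by
    intro c c'
    rw [← Complex.mul_conj', ← RCLike.star_def, star_sum, Finset.sum_mul_sum]
    refine Finset.sum_congr rfl fun a _ => Finset.sum_congr rfl fun b _ => ?_
    rw [mixture_apply, mixture_apply, star_sum, Finset.sum_mul_sum]
  simp only [h1, h2]
  rw [sum_rearrange]
  refine Finset.sum_congr rfl fun c _ => Finset.sum_congr rfl fun c' _ =>
    Finset.sum_congr rfl fun a _ => Finset.sum_congr rfl fun b _ =>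
    Finset.sum_congr rfl fun j _ => Finset.sum_congr rfl fun k _ => ?_
  have h3 : ∀ k, star (p k : ℂ) = p k := fun k => Complex.conj_ofReal _
  simp only [star_mul', star_star, h3]
  ring

/-- By Cauchy–Schwarz, tracing out `S` increases the squared Hilbert–Schmidt norm by at most the
dimension `2 ^ |S|`. -/
theorem sum_transition_le {N : ℕ} (S : Finset (Fin N)) {Y : Op N} (hY : Yᴴ * Y = 1)
    (p : Config (Fin N) → ℝ) :
    ∑ j, ∑ k, p j * p k * ∑ a, ∑ b, ‖transition S Y j k a b‖ ^ 2 ≤ 2 ^ S.card * ∑ k, p k ^ 2 := by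
  rw [sum_transition_eq, ← sum_norm_sq_mixture hY]
  have hcard : (Fintype.card (Config S) : ℝ) = 2 ^ S.card := by simp
  calc ∑ c : Config {l // l ∉ S}, ∑ c' : Config {l // l ∉ S},
        ‖∑ a, mixture Y p (glue S a c) (glue S a c')‖ ^ 2
      ≤ ∑ c : Config {l // l ∉ S}, ∑ c' : Config {l // l ∉ S},
        2 ^ S.card * ∑ a, ‖mixture Y p (glue S a c) (glue S a c')‖ ^ 2 := by
        gcongr with c _ c' _
        calc ‖∑ a, mixture Y p (glue S a c) (glue S a c')‖ ^ 2
            ≤ (∑ a, ‖mixture Y p (glue S a c) (glue S a c')‖) ^ 2 := by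
              gcongr; exact norm_sum_le _ _
          _ ≤ _ := by
              have := sq_sum_le_card_mul_sum_sq (s := (Finset.univ : Finset (Config S)))
                (f := fun a => ‖mixture Y p (glue S a c) (glue S a c')‖)
              rwa [Finset.card_univ, hcard] at this
    _ = 2 ^ S.card * ∑ a, ∑ c : Config {l // l ∉ S}, ∑ c' : Config {l // l ∉ S},
          ‖mixture Y p (glue S a c) (glue S a c')‖ ^ 2 := by
        simp only [← Finset.mul_sum]
        congr 1
        symm
        rw [Finset.sum_comm]
        exact Finset.sum_congr rfl fun c _ => Finset.sum_comm
    -- The blocks with different configurations on `S`, absent from the partial trace, are added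
    -- back.
    _ ≤ 2 ^ S.card * ∑ s, ∑ t, ‖mixture Y p s t‖ ^ 2 := by
        gcongr
        rw [sum_glue S]
        gcongr with a _ c _
        rw [sum_glue S]
        exact Finset.single_le_sum (f := fun a' => ∑ c' : Config {l // l ∉ S},
          ‖mixture Y p (glue S a c) (glue S a' c')‖ ^ 2) (fun _ _ => by positivity)
          (Finset.mem_univ a)

/-- Equality of two ratios becomes equality of two pair products after cross-multiplication. Pairs
with equal members must be excluded, since they all have ratio `1`. -/
theorem mul_star_injective {κ : Type} {z : κ → ℂ} (hz : ∀ k, ‖z k‖ = 1) (hres : NoProductResonance z) :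
    Function.Injective fun q : {q : κ × κ // q.1 ≠ q.2} => z q.1.1 * star (z q.1.2) := by
  rintro ⟨⟨a, b⟩, hab⟩ ⟨⟨c, d⟩, hcd⟩ h
  simp only at h hab hcd
  have h1 : z a * z d = z c * z b := by
    calc z a * z d = (z a * star (z b)) * (z b * z d) := by
          linear_combination (-(z a * z d)) * mul_star_self_of_norm_one (hz b)
      _ = z c * z b := by
          rw [h]
          linear_combination (z c * z b) * mul_star_self_of_norm_one (hz d)
  rcases hres _ _ _ _ h1 with ⟨rfl, rfl⟩ | ⟨rfl, -⟩
  · rfl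
  · exact absurd rfl hab

theorem norm_transition_le {N : ℕ} (S : Finset (Fin N)) {Y : Op N} (hY : Yᴴ * Y = 1)
    (j k : Config (Fin N)) (a b : Config S) :
    ‖transition S Y j k a b‖ ≤ Fintype.card (Config {l // l ∉ S}) := by
  have h : ∀ c ∈ Finset.univ, ‖Y (glue S a c) j * star (Y (glue S b c) k)‖ ≤ (1 : ℝ) := by
    intro c _
    rw [norm_mul, norm_star]
    exact mul_le_one₀ (norm_entry_le_one_of_unitary hY _ _) (norm_nonneg _)
      (norm_entry_le_one_of_unitary hY _ _)
  simpa [transition] using norm_sum_le_of_le Finset.univ h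

theorem sum_ne_add_sum_diag {κ M : Type} [Fintype κ] [DecidableEq κ] [AddCommMonoid M]
    (f : κ × κ → M) :
    ∑ q : {q : κ × κ // q.1 ≠ q.2}, f q + ∑ k, f (k, k) = ∑ q, f q := by
  rw [← Fintype.sum_subtype_add_sum_subtype (fun q => q.1 ≠ q.2) f]
  congr 1
  refine Fintype.sum_bijective (fun k => ⟨(k, k), by simp⟩) ⟨?_, ?_⟩ _ _ fun _ => rfl
  · intro k l h
    simpa using h
  · rintro ⟨⟨k, l⟩, h⟩
    simp only [ne_eq, not_not] at h
    exact ⟨k, by simp [h]⟩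

/-- The deviation of the reduced state from the dephased one is a trigonometric sum. -/
theorem partialTrace_sub_mixture {N : ℕ} (S : Finset (Fin N)) {z : Config (Fin N) → ℂ}
    (hz : ∀ k, ‖z k‖ = 1) (Y : Op N) (c : Config (Fin N) → ℂ) (m : ℕ) (a b : Config S) :
    (partialTrace S (vecMulVec (Y *ᵥ fun k => z k ^ m * c k) (star (Y *ᵥ fun k => z k ^ m * c k))) -
      partialTrace S (mixture Y fun k => ‖c k‖ ^ 2)) a b =
    ∑ q : {q : Config (Fin N) × Config (Fin N) // q.1 ≠ q.2},
      (c q.1.1 * star (c q.1.2) * transition S Y q.1.1 q.1.2 a b) *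
        (z q.1.1 * star (z q.1.2)) ^ m := by
  set F : Config (Fin N) × Config (Fin N) → ℂ := fun q =>
    (c q.1 * star (c q.2) * transition S Y q.1 q.2 a b) * (z q.1 * star (z q.2)) ^ m
  have h1 : partialTrace S (vecMulVec (Y *ᵥ fun k => z k ^ m * c k)
      (star (Y *ᵥ fun k => z k ^ m * c k))) a b = ∑ q, F q := by
    have h3 : ∀ d : Config {l // l ∉ S}, vecMulVec (Y *ᵥ fun k => z k ^ m * c k)
        (star (Y *ᵥ fun k => z k ^ m * c k)) (glue S a d) (glue S b d) =
        ∑ q : Config (Fin N) × Config (Fin N), (Y (glue S a d) q.1 * (z q.1 ^ m * c q.1)) *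
          star (Y (glue S b d) q.2 * (z q.2 ^ m * c q.2)) := by
      intro d
      rw [vecMulVec_apply, Pi.star_apply, mulVec, mulVec, dotProduct, dotProduct, star_sum,
        Finset.sum_mul_sum, Fintype.sum_prod_type]
    simp only [partialTrace, h3]
    rw [Finset.sum_comm]
    refine Finset.sum_congr rfl fun q _ => ?_
    simp only [F]
    rw [transition_apply, Finset.mul_sum, Finset.sum_mul]
    refine Finset.sum_congr rfl fun d _ => ?_
    simp only [star_mul', star_pow]
    ring
  have h2 : partialTrace S (mixture Y fun k => ‖c k‖ ^ 2) a b = ∑ k, F (k, k) := by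
    simp only [partialTrace, mixture_apply]
    rw [Finset.sum_comm]
    refine Finset.sum_congr rfl fun q _ => ?_
    simp only [F]
    rw [transition_apply, Finset.mul_sum, Finset.sum_mul]
    refine Finset.sum_congr rfl fun d _ => ?_
    rw [mul_star_self_of_norm_one (hz q), one_pow]
    have := Complex.mul_conj' (c q)
    rw [RCLike.star_def, this]
    push_cast
    ring
  rw [Matrix.sub_apply, h1, h2, sub_eq_iff_eq_add,
    ← sum_ne_add_sum_diag F]

/-- Apply the trigonometric bound to each matrix element, then `sum_transition_le` with weights `‖c
k‖ ^ 2`. Choosing the constant before `Y` makes the bound uniform over the period, as needed for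
integration in `x`. -/
theorem sum_deviation_le {N : ℕ} (S : Finset (Fin N)) {z : Config (Fin N) → ℂ}
    (hz : ∀ k, ‖z k‖ = 1) (hres : NoProductResonance z) :
    ∃ C : ℝ, ∀ (Y : Op N) (c : Config (Fin N) → ℂ), Yᴴ * Y = 1 → ∑ k, ‖c k‖ ^ 2 = 1 → ∀ M : ℕ,
      ∑ m ∈ Finset.range M, ∑ a, ∑ b,
        ‖(partialTrace S
            (vecMulVec (Y *ᵥ fun k => z k ^ m * c k) (star (Y *ᵥ fun k => z k ^ m * c k))) -
          partialTrace S (mixture Y fun k => ‖c k‖ ^ 2)) a b‖ ^ 2 ≤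
      M * (2 ^ S.card * ∑ k, ‖c k‖ ^ 4) + C := by
  set Q := {q : Config (Fin N) × Config (Fin N) // q.1 ≠ q.2}
  obtain ⟨C, hC, h⟩ := sum_norm_sq_trigonometric_le
    (ζ := fun q : Q => z q.1.1 * star (z q.1.2))
    (fun q => by rw [norm_mul, norm_star, hz, hz, one_mul]) (mul_star_injective hz hres)
  refine ⟨∑ a : Config S, ∑ b : Config S,
    C * (∑ q : Q, (Fintype.card (Config {l // l ∉ S}) : ℝ)) ^ 2, fun Y c hY hc M => ?_⟩
  have hc1 : ∀ k, ‖c k‖ ≤ 1 := by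
    intro k
    have := Finset.single_le_sum (f := fun k => ‖c k‖ ^ 2) (fun _ _ => by positivity)
      (Finset.mem_univ k)
    rw [hc] at this
    exact (sq_le_one_iff₀ (norm_nonneg _)).1 this
  set g : Config S → Config S → Q → ℂ := fun a b q =>
    c q.1.1 * star (c q.1.2) * transition S Y q.1.1 q.1.2 a b
  have hg : ∀ a b q, ‖g a b q‖ ≤ Fintype.card (Config {l // l ∉ S}) := by
    intro a b q
    simp only [g]
    rw [norm_mul, norm_mul, norm_star]
    calc ‖c q.1.1‖ * ‖c q.1.2‖ * ‖transition S Y q.1.1 q.1.2 a b‖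
        ≤ 1 * 1 * Fintype.card (Config {l // l ∉ S}) := by
          gcongr
          exacts [hc1 _, hc1 _, norm_transition_le S hY _ _ _ _]
      _ = _ := by ring
  have hsum : ∑ a, ∑ b, ∑ q, ‖g a b q‖ ^ 2 ≤ 2 ^ S.card * ∑ k, ‖c k‖ ^ 4 := by
    have h4 := sum_transition_le S hY fun k => ‖c k‖ ^ 2
    have h5 : ∀ k, (‖c k‖ ^ 2) ^ 2 = ‖c k‖ ^ 4 := fun k => by ring
    simp only [h5] at h4
    refine le_trans ?_ h4
    calc ∑ a, ∑ b, ∑ q, ‖g a b q‖ ^ 2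
        ≤ ∑ a : Config S, ∑ b : Config S, ∑ q : Config (Fin N) × Config (Fin N),
            ‖c q.1‖ ^ 2 * ‖c q.2‖ ^ 2 * ‖transition S Y q.1 q.2 a b‖ ^ 2 := by
          gcongr with a _ b _
          simp only [g, norm_mul, norm_star, mul_pow]
          refine le_trans (le_add_of_nonneg_right ?_) (sum_ne_add_sum_diag
            fun q => ‖c q.1‖ ^ 2 * ‖c q.2‖ ^ 2 * ‖transition S Y q.1 q.2 a b‖ ^ 2).le
          positivity
      _ = _ := by
          simp only [Finset.mul_sum, ← Fintype.sum_prod_type']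
          exact Fintype.sum_equiv ⟨fun x => (x.2.2.1, x.2.2.2, x.1, x.2.1),
            fun x => (x.2.2.1, x.2.2.2, x.1, x.2.1), fun _ => rfl, fun _ => rfl⟩ _ _ fun _ => rfl
  calc _ = ∑ a, ∑ b, ∑ m ∈ Finset.range M, ‖∑ q, g a b q * (z q.1.1 * star (z q.1.2)) ^ m‖ ^ 2 := by
        simp only [partialTrace_sub_mixture S hz]
        rw [Finset.sum_comm]
        exact Finset.sum_congr rfl fun a _ => Finset.sum_comm
    _ ≤ ∑ a, ∑ b, (M * ∑ q, ‖g a b q‖ ^ 2 +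
          C * (∑ q : Q, (Fintype.card (Config {l // l ∉ S}) : ℝ)) ^ 2) := by
        gcongr with a _ b _
        refine (h M (g a b)).trans ?_
        gcongr with q _
        exact hg a b q
    _ ≤ _ := by
        simp only [Finset.sum_add_distrib, ← Finset.mul_sum]
        gcongr

/-! ### A criterion for approximate periodicity -/

-- Markov's inequality in `m`: `F` is a squared deviation with mean at most `X`, and `g` is compared
-- with `fbar` through the majorant `ε / 2 + L * F`. Only `F` has to be measurable, because the
-- upper integral accepts any measurable majorant.
open Filter in
theorem approxPeriodic_of_average {g fbar : ℝ → ℝ} {F : ℕ → ℝ → ℝ} {ε L X C : ℝ} (hε : 0 < ε)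
    (hL : 0 ≤ L) (hF : ∀ m, Measurable (F m)) (hF0 : ∀ m x, 0 ≤ F m x)
    (hg : ∀ m : ℕ, ∀ x ∈ Set.Ico (0 : ℝ) 1, |g (m + x) - fbar x| ^ 2 ≤ ε / 2 + L * F m x)
    (hav : ∀ x ∈ Set.Ico (0 : ℝ) 1, ∀ M : ℕ, ∑ m ∈ Finset.range M, F m x ≤ M * X + C)
    (hLX : 2 * (L * X) < ε ^ 2) : ApproxPeriodic ε g := by
  refine ⟨fbar, ?_⟩
  set w : ℕ → ENNReal := fun m => ∫⁻ x in Set.Ico (0 : ℝ) 1, ENNReal.ofReal (L * F m x)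
  have hvol : volume (Set.Ico (0 : ℝ) 1) = 1 := by simp
  have hmeas : ∀ m, Measurable fun x => ENNReal.ofReal (L * F m x) := fun m =>
    ((hF m).const_mul L).ennreal_ofReal
  have hsum : ∀ M : ℕ, ∑ m ∈ Finset.range M, w m ≤ ENNReal.ofReal (L * (M * X + C)) := by
    intro M
    rw [← lintegral_finsetSum _ fun m _ => hmeas m]
    calc ∫⁻ x in Set.Ico (0 : ℝ) 1, ∑ m ∈ Finset.range M, ENNReal.ofReal (L * F m x)
        ≤ ∫⁻ x in Set.Ico (0 : ℝ) 1, ENNReal.ofReal (L * (M * X + C)) := by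
          refine setLIntegral_mono' measurableSet_Ico fun x hx => ?_
          rw [← ENNReal.ofReal_sum_of_nonneg fun m _ => mul_nonneg hL (hF0 m x), ← Finset.mul_sum]
          exact ENNReal.ofReal_le_ofReal (mul_le_mul_of_nonneg_left (hav x hx M) hL)
      _ = _ := by simp
  have hle : ∀ m : ℕ, integralIco (fun x => ENNReal.ofReal (|g (m + x) - fbar x| ^ 2)) ≤
      ENNReal.ofReal (ε / 2) + w m := by
    intro m
    refine iInf_le_of_le (fun x => ENNReal.ofReal (ε / 2) + ENNReal.ofReal (L * F m x))
      (iInf_le_of_le (measurable_const.add (hmeas m)) (iInf_le_of_le (fun x hx => ?_) ?_))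
    · beta_reduce
      rw [← ENNReal.ofReal_add (by positivity) (mul_nonneg hL (hF0 m x))]
      exact ENNReal.ofReal_le_ofReal (hg m x hx)
    · rw [lintegral_add_left measurable_const, setLIntegral_const, hvol, mul_one]
  set good : ℕ → Set ℕ := fun M => {m : ℕ | m < M ∧
    integralIco (fun x => ENNReal.ofReal (|g (m + x) - fbar x| ^ 2)) ≤ ENNReal.ofReal ε}
  have hcard : ∀ M : ℕ, M - 2 * L * (M * X + C) / ε ≤ (good M).ncard := by
    intro M
    classical
    -- Outside `bad` the integral is at most `ε / 2 + ε / 2`. Summing over `bad` bounds its size by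
    -- `2 * L * (M * X + C) / ε`.
    set bad := (Finset.range M).filter fun m => ENNReal.ofReal (ε / 2) < w m
    have h1 : (bad.card : ℝ) * (ε / 2) ≤ L * (M * X + C) := by
      have h0 : 0 ≤ L * (M * X + C) := mul_nonneg hL
        ((Finset.sum_nonneg fun m _ => hF0 m 0).trans (hav 0 (by simp) M))
      rw [← ENNReal.ofReal_le_ofReal_iff h0, ENNReal.ofReal_mul (by positivity),
        ENNReal.ofReal_natCast, ← nsmul_eq_mul]
      refine (Finset.card_nsmul_le_sum bad w _ fun m hm => (Finset.mem_filter.1 hm).2.le).trans ?_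
      exact (Finset.sum_le_sum_of_subset (Finset.filter_subset _ _)).trans (hsum M)
    have h2 : ((Finset.range M \ bad : Finset ℕ) : Set ℕ) ⊆ good M := by
      intro m hm
      simp only [bad, Finset.coe_sdiff, Finset.coe_range, Finset.coe_filter, Finset.mem_range,
        Set.mem_sdiff, Set.mem_Iio, Set.mem_ofPred_eq, not_and, not_lt] at hm
      refine ⟨hm.1, (hle m).trans ((add_le_add_right (hm.2 hm.1) _).trans ?_)⟩
      rw [← ENNReal.ofReal_add (by positivity) (by positivity), add_halves]
    have h3 := Set.ncard_le_ncard h2 ((Set.finite_lt_nat M).subset fun m hm => hm.1)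
    rw [Set.ncard_coe_finset] at h3
    have h4 : M ≤ (Finset.range M \ bad).card + bad.card := by
      have := Finset.le_card_sdiff bad (Finset.range M)
      rw [Finset.card_range] at this
      omega
    have h5 : (M : ℝ) ≤ (good M).ncard + bad.card := by exact_mod_cast h4.trans (by omega)
    have h6 : (bad.card : ℝ) ≤ 2 * L * (M * X + C) / ε := by
      rw [le_div_iff₀ hε]
      linarith
    linarith
  have hgood : ∀ M : ℕ, ((good M).ncard : ℝ) ≤ M := by
    intro M
    have h := Set.ncard_le_ncard (s := good M) (t := (Finset.range M : Set ℕ))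
      (fun m hm => by simpa using hm.1) (Finset.finite_toSet _)
    rw [Set.ncard_coe_finset, Finset.card_range] at h
    exact_mod_cast h
  -- A real liminf is meaningful only for bounded sequences; the counted fractions are at most `1`.
  refine le_liminf_of_le ?_ ?_
  · refine IsBoundedUnder.isCoboundedUnder_ge (isBoundedUnder_of ⟨1, fun M => ?_⟩)
    exact div_le_one_of_le₀ (hgood M) (by positivity)
  · have hD : 0 < ε ^ 2 - 2 * (L * X) := by linarith
    filter_upwards [tendsto_natCast_atTop_atTop.eventually_ge_atTop
      (2 * L * C / (ε ^ 2 - 2 * (L * X))), eventually_gt_atTop 0] with M hM hM0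
    have hM0' : (0 : ℝ) < M := by exact_mod_cast hM0
    rw [div_le_iff₀ hD] at hM
    rw [le_div_iff₀ hM0']
    refine le_trans ?_ (hcard M)
    have : 2 * L * (M * X + C) / ε ≤ ε * M := by
      rw [div_le_iff₀ hε]
      linarith
    linarith

/-! ### The dephased state -/

/-- The dephased state is a convex combination of reduced pure states, so `f` can be evaluated on
it. -/
theorem dephased_density {N : ℕ} (S : Finset (Fin N)) {Y : Op N} (hY : Yᴴ * Y = 1)
    {c : Config (Fin N) → ℂ} (hc : ∑ k, ‖c k‖ ^ 2 = 1) :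
    (partialTrace S (mixture Y fun k => ‖c k‖ ^ 2)).PosSemidef ∧
      (partialTrace S (mixture Y fun k => ‖c k‖ ^ 2)).trace = 1 := by
  have h1 : ∀ k, star (fun s => Y s k) ⬝ᵥ (fun s => Y s k) = 1 := by
    intro k
    have := congrFun (congrFun hY k) k
    rwa [mul_apply, one_apply_eq] at this
  have h2 : partialTrace S (mixture Y fun k => ‖c k‖ ^ 2) =
      ∑ k, ((‖c k‖ ^ 2 : ℝ) : ℂ) •
        partialTrace S (vecMulVec (fun s => Y s k) (star fun s => Y s k)) := by
    ext a b
    rw [Matrix.sum_apply]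
    simp only [partialTrace, mixture_apply, Matrix.smul_apply, smul_eq_mul, Finset.mul_sum]
    rw [Finset.sum_comm]
    rfl
  constructor
  · rw [h2]
    refine posSemidef_sum _ fun k _ => (partialTrace_density S _ (h1 k)).1.smul ?_
    exact_mod_cast sq_nonneg ‖c k‖
  · rw [h2, trace_sum]
    simp only [trace_smul, (partialTrace_density S _ (h1 _)).2, smul_eq_mul, mul_one]
    exact_mod_cast hc

section Continuity

attribute [local instance] Matrix.linftyOpNormedRing Matrix.linftyOpNormedAlgebra

theorem continuous_partialEvolution (E : Ensemble) {N : ℕ} (p : Params E.n N) :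
    Continuous fun x => E.partialEvolution p x := by
  have h : ∀ x, E.partialEvolution p x = ((List.ofFn fun (j : Fin E.n) (x : ℝ) =>
      NormedSpace.exp ((-Complex.I * (E.elapsed x j : ℂ)) • E.hamiltonian p j)).reverse.map
      fun f => f x).prod := by
    intro x
    rw [Ensemble.partialEvolution, List.map_reverse, List.map_ofFn]
    rfl
  simp only [h]
  refine continuous_list_prod _ fun f hf => ?_
  rw [List.mem_reverse, List.mem_ofFn] at hf
  obtain ⟨j, rfl⟩ := hf
  refine (NormedSpace.exp_continuous (𝔸 := Op N)).comp ?_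
  have : Continuous fun x => E.elapsed x j := by
    unfold Ensemble.elapsed
    fun_prop
  fun_prop

end Continuity

theorem stateAt_nat_add {E : Ensemble} {N : ℕ} {p : Params E.n N} {V : Op N}
    {z : Config (Fin N) → ℂ} (hV : Diagonalizes V z (E.floquetOp p)) (φ : Fin N → QubitState)
    (m : ℕ) {x : ℝ} (hx : x ∈ Set.Ico (0 : ℝ) 1) :
    E.stateAt p φ (m + x) =
      (E.partialEvolution p x * V) *ᵥ fun k => z k ^ m * (Vᴴ *ᵥ productState φ) k := by
  have h1 : Int.fract ((m : ℝ) + x) = x := by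
    rw [Int.fract_natCast_add, Int.fract_eq_self.2 hx]
  have h2 : ⌊(m : ℝ) + x⌋₊ = m := by
    rw [add_comm, Nat.floor_add_natCast hx.1, Nat.floor_eq_zero.2 hx.2, zero_add]
  rw [Ensemble.stateAt, Ensemble.evolution, h1, h2, (hV.pow m).2]
  have h3 : (fun k => z k ^ m * (Vᴴ *ᵥ productState φ) k) =
      diagonal (fun k => z k ^ m) *ᵥ (Vᴴ *ᵥ productState φ) := by
    ext k
    rw [mulVec_diagonal]
  rw [h3, mulVec_mulVec, mulVec_mulVec]
  simp only [Matrix.mul_assoc]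

/-- The hypothesis `hX` is the average deviation bound after the loss `2 ^ |S|` from Hilbert–Schmidt
to trace norm and the loss `R ^ 2 / δ ^ 2` from the times at which the trace distance exceeds `δ`.
-/
theorem approxPeriodic_reducedState {E : Ensemble} {N : ℕ} {p : Params E.n N} {V : Op N}
    {z : Config (Fin N) → ℂ} (hV : Diagonalizes V z (E.floquetOp p)) (hz : ∀ k, ‖z k‖ = 1)
    (hres : NoProductResonance z) (S : Finset (Fin N)) (φ : Fin N → QubitState)
    {f : Density (Config S) → ℝ} {δ η R ε : ℝ} (hδ : 0 < δ) (hε : 0 < ε)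
    (hf : ∀ ρ₁ ρ₂ : Density (Config S), traceNorm (ρ₁.1 - ρ₂.1) ≤ δ → |f ρ₁ - f ρ₂| ≤ η)
    (hR : ∀ ρ₁ ρ₂ : Density (Config S), |f ρ₁ - f ρ₂| ≤ R) (hηε : η ^ 2 ≤ ε / 2)
    (hX : 2 * ((R ^ 2 / δ ^ 2 * 2 ^ S.card) *
      (2 ^ S.card * ∑ k, ‖(Vᴴ *ᵥ productState φ) k‖ ^ 4)) < ε ^ 2) :
    ApproxPeriodic ε fun t => f (E.reducedState p φ S t) := by
  set c := Vᴴ *ᵥ productState φ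
  have hVV : (Vᴴ)ᴴ * Vᴴ = 1 := by rw [conjTranspose_conjTranspose]; exact hV.mul_conjTranspose
  have hc : ∑ k, ‖c k‖ ^ 2 = 1 := by
    have h1 := sum_norm_sq_mulVec hVV (productState φ)
    have h2 := star_dotProduct_self_eq (productState φ)
    rw [productState_normalized] at h2
    rw [h1]
    exact_mod_cast h2.symm
  set Y : ℝ → Op N := fun x => E.partialEvolution p x * V
  have hY : ∀ x, (Y x)ᴴ * Y x = 1 := by
    intro x
    have h1 : (E.partialEvolution p x)ᴴ * E.partialEvolution p x = 1 :=
      (partialEvolution_unitary E p x).1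
    simp only [Y]
    rw [conjTranspose_mul, Matrix.mul_assoc, ← Matrix.mul_assoc (E.partialEvolution p x)ᴴ, h1,
      Matrix.one_mul, hV.1]
  have hYc : ∀ s k, Continuous fun x => Y x s k := fun s k =>
    ((continuous_partialEvolution E p).matrix_mul continuous_const).matrix_elem s k
  obtain ⟨C, hC⟩ := sum_deviation_le S hz hres
  set F : ℕ → ℝ → ℝ := fun m x => ∑ a, ∑ b,
    ‖(partialTrace S
        (vecMulVec (Y x *ᵥ fun k => z k ^ m * c k) (star (Y x *ᵥ fun k => z k ^ m * c k))) -
      partialTrace S (mixture (Y x) fun k => ‖c k‖ ^ 2)) a b‖ ^ 2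
  have hFm : ∀ m, Measurable (F m) := by
    intro m
    refine Continuous.measurable ?_
    simp only [F, Matrix.sub_apply, partialTrace, vecMulVec_apply, mixture_apply, Pi.star_apply,
      mulVec, dotProduct]
    fun_prop
  refine approxPeriodic_of_average (F := F) (L := R ^ 2 / δ ^ 2 * 2 ^ S.card)
    (fbar := fun x => f ⟨_, dephased_density S (hY x) hc⟩) hε (by positivity) hFm
    (fun m x => by positivity) (fun m x hx => ?_) (fun x _ M => hC (Y x) c (hY x) hc M) hX
  set ρ₁ := E.reducedState p φ S (m + x)
  set ρ₂ : Density (Config S) := ⟨_, dephased_density S (hY x) hc⟩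
  have hF : traceNorm (ρ₁.1 - ρ₂.1) ^ 2 ≤ 2 ^ S.card * F m x := by
    have h1 := traceNorm_sq_le (ρ₁.1 - ρ₂.1)
    have h2 : (Fintype.card (Config S) : ℝ) = 2 ^ S.card := by simp
    have h3 : ρ₁.1 = partialTrace S
        (vecMulVec (Y x *ᵥ fun k => z k ^ m * c k) (star (Y x *ᵥ fun k => z k ^ m * c k))) := by
      simp only [ρ₁, Ensemble.reducedState]
      rw [stateAt_nat_add hV φ m hx]
    rw [h2, h3] at h1
    rw [h3]
    exact h1
  -- Small deviations use the local modulus `η`. For large ones the squared deviation over `δ ^ 2`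
  -- is at least `1` and multiplies the trivial bound `R ^ 2`.
  rcases le_or_gt (traceNorm (ρ₁.1 - ρ₂.1)) δ with h | h
  · have h1 : |f ρ₁ - f ρ₂| ^ 2 ≤ η ^ 2 := by
      gcongr
      exact hf _ _ h
    have h2 : 0 ≤ R ^ 2 / δ ^ 2 * 2 ^ S.card * F m x := by positivity
    linarith
  · have h1 : |f ρ₁ - f ρ₂| ^ 2 ≤ R ^ 2 := by
      gcongr
      exact hR _ _
    have h2 : δ ^ 2 ≤ 2 ^ S.card * F m x := by
      refine le_trans ?_ hF
      gcongr
    have h3 : R ^ 2 ≤ R ^ 2 / δ ^ 2 * 2 ^ S.card * F m x := by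
      calc R ^ 2 = R ^ 2 / δ ^ 2 * δ ^ 2 := by field_simp
        _ ≤ R ^ 2 / δ ^ 2 * (2 ^ S.card * F m x) := by gcongr
        _ = _ := by ring
    linarith

/-- The inverse participation ratio of a random product state in a basis is rarely large. -/
theorem haarProduct_participation_le {N : ℕ} {V : Op N} (hV : Vᴴ * V = 1) {θ : ℝ} (hθ : 0 < θ) :
    haarProduct N {φ | θ ≤ ∑ k, ‖(Vᴴ *ᵥ productState φ) k‖ ^ 4} ≤
      ENNReal.ofReal ((2 / 3) ^ N / θ) := by
  set X : (Fin N → QubitState) → ENNReal := fun φ =>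
    ∑ k, ENNReal.ofReal (‖(Vᴴ *ᵥ productState φ) k‖ ^ 4)
  have hm : ∀ k, Measurable fun φ : Fin N → QubitState =>
      ENNReal.ofReal (‖(Vᴴ *ᵥ productState φ) k‖ ^ 4) := by
    intro k
    simp only [mulVec, dotProduct]
    have := fun s => measurable_productState (N := N) s
    fun_prop
  have hXm : Measurable X := Finset.measurable_sum _ fun k _ => hm k
  have hint : ∫⁻ φ, X φ ∂haarProduct N ≤ ENNReal.ofReal ((2 / 3) ^ N) := by
    simp only [X]
    rw [lintegral_finsetSum _ fun k _ => hm k]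
    calc ∑ k, ∫⁻ φ, ENNReal.ofReal (‖(Vᴴ *ᵥ productState φ) k‖ ^ 4) ∂haarProduct N
        -- Each of the `2 ^ N` eigenvectors is a unit vector and contributes at most `3 ^ (-N)`.
        ≤ ∑ _k : Config (Fin N), ENNReal.ofReal ((1 / 3) ^ N) := by
          refine Finset.sum_le_sum fun k _ => ?_
          refine (lintegral_overlap_pow_four_le N (Vᴴ k)).trans (ENNReal.ofReal_le_ofReal ?_)
          have h1 : ∑ s, ‖Vᴴ k s‖ ^ 2 = 1 := by
            simpa [conjTranspose_apply] using sum_sq_col_of_unitary hV k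
          rw [h1, one_pow, mul_one]
      _ = ENNReal.ofReal ((2 / 3) ^ N) := by
          rw [Finset.sum_const, Finset.card_univ, nsmul_eq_mul, ← ENNReal.ofReal_natCast,
            ← ENNReal.ofReal_mul (by positivity)]
          congr 1
          simp [div_pow]
          ring
  have hset : {φ | θ ≤ ∑ k, ‖(Vᴴ *ᵥ productState φ) k‖ ^ 4} = {φ | ENNReal.ofReal θ ≤ X φ} := by
    ext φ
    simp only [X, Set.mem_ofPred_eq]
    rw [← ENNReal.ofReal_sum_of_nonneg fun k _ => by positivity,
      ENNReal.ofReal_le_ofReal_iff (by positivity)]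
  rw [hset, ENNReal.ofReal_div_of_pos hθ]
  refine (meas_ge_le_lintegral_div hXm.aemeasurable (by simpa using hθ) (by simp)).trans ?_
  gcongr

/-! ### Choice of constants and conclusion -/

set_option exponentiation.threshold 5000 in
theorem log_two_lt_log_three_halves : 0.58496 * Real.log 2 < Real.log (3 / 2) := by
  -- Since `0.58496 = 1828 / 3125`, the claim amounts to `2 ^ 4953 < 3 ^ 3125`.
  have h1 : (3125 : ℝ) * Real.log 3 > 4953 * Real.log 2 := by
    have h2 : Real.log ((2 : ℝ) ^ 4953) < Real.log ((3 : ℝ) ^ 3125) := by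
      apply Real.log_lt_log (by positivity)
      have : (2 : ℕ) ^ 4953 < 3 ^ 3125 := by norm_num
      exact_mod_cast this
    rw [Real.log_pow, Real.log_pow] at h2
    exact_mod_cast h2
  rw [Real.log_div (by norm_num) (by norm_num)]
  linarith

/-- The exponent is where the size `0.29248 * N` enters: both factors `2 ^ |S|` together cost
`0.58496 * N * log 2`, just less than the gain `N * log (3 / 2)`. -/
theorem two_pow_card_le {N : ℕ} {S : Finset (Fin N)} (hS : Small S) :
    (2 ^ S.card : ℝ) * 2 ^ S.card * (2 / 3) ^ N ≤
      Real.exp (-(Real.log (3 / 2) - 0.58496 * Real.log 2) * N) := by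
  have h2 : (2 : ℝ) ^ S.card = Real.exp (S.card * Real.log 2) := by
    rw [mul_comm, Real.exp_mul, Real.exp_log (by norm_num), Real.rpow_natCast]
  have h3 : ((2 : ℝ) / 3) ^ N = Real.exp (-(Real.log (3 / 2)) * N) := by
    rw [Real.exp_mul, ← Real.log_inv, Real.exp_log (by norm_num), Real.rpow_natCast]
    norm_num
  rw [h2, h3, ← Real.exp_add, ← Real.exp_add]
  apply Real.exp_le_exp.2
  have h4 : 0 < Real.log 2 := Real.log_pos (by norm_num)
  have h5 := mul_le_mul_of_nonneg_right hS h4.le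
  linarith

theorem almostAlwaysPeriodic_of_expContinuous {f : StateFunction} (hf : ExpContinuous f) :
    AlmostAlwaysPeriodic f := by
  set κ : ℝ := Real.log (3 / 2) - 0.58496 * Real.log 2 with hκdef
  have hκ : 0 < κ := sub_pos.2 log_two_lt_log_three_halves
  obtain ⟨c', hc', N₁, hN₁⟩ := hf (κ / 32) (by positivity)
  -- `c ≤ c'` lets `ε` dominate `η`, and `c ≤ κ / 16` makes `ε ^ 2` at least `exp (-(κ / 8) * N)`.
  -- The thresholds on `N` yield `η ≤ 1 / 2` and absorb the numerical factor `18`.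
  refine ⟨min c' (κ / 16), by positivity, max N₁ (⌈72 / κ⌉₊ + ⌈1 / c'⌉₊ + 1), ?_⟩
  intro N hN S hS E hαx hαz hγ
  set c := min c' (κ / 16)
  have hcc' : c ≤ c' := min_le_left _ _
  have hcκ : c ≤ κ / 16 := min_le_right _ _
  have hN1 : N₁ ≤ N := (le_max_left _ _).trans hN
  have hN2 : ⌈72 / κ⌉₊ + ⌈1 / c'⌉₊ + 1 ≤ N := (le_max_right _ _).trans hN
  have hNκ : 72 ≤ κ * N := by
    have h1 : (⌈72 / κ⌉₊ : ℝ) ≤ N := by exact_mod_cast (by omega : ⌈72 / κ⌉₊ ≤ N)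
    have h2 := (Nat.le_ceil _).trans h1
    rw [div_le_iff₀ hκ] at h2
    linarith
  have hNc' : 1 ≤ c' * N := by
    have h1 : (⌈1 / c'⌉₊ : ℝ) ≤ N := by exact_mod_cast (by omega : ⌈1 / c'⌉₊ ≤ N)
    have h2 := (Nat.le_ceil _).trans h1
    rw [div_le_iff₀ hc'] at h2
    linarith
  have hN0 : (0 : ℝ) ≤ N := by positivity
  set δ := Real.exp (-(κ / 32) * N) with hδdef
  set η := Real.exp (-c' * N) with hηdef
  set ε := Real.exp (-c * N) with hεdef
  have hδ : 0 < δ := Real.exp_pos _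
  have hη : 0 < η := Real.exp_pos _
  have hε : 0 < ε := Real.exp_pos _
  have hδ1 : δ ≤ 1 := Real.exp_le_one_iff.2 (by nlinarith)
  have hη1 : η ≤ 1 := Real.exp_le_one_iff.2 (by nlinarith)
  have hloc := hN₁ N hN1 S hS
  -- About `2 / δ` steps of size `δ` join any two states and each changes `f` by at most `η ≤ 1`;
  -- rounding up costs at most `1 / δ`.
  have hR : ∀ ρ₁ ρ₂ : Density (Config S), |f N S ρ₁ - f N S ρ₂| ≤ 3 / δ := by
    intro ρ₁ ρ₂
    have hK : (0 : ℝ) < ⌈2 / δ⌉₊ := lt_of_lt_of_le (by positivity) (Nat.le_ceil (2 / δ))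
    have h1 := abs_sub_le_of_local hloc (K := ⌈2 / δ⌉₊) (by exact_mod_cast hK)
      (by
        rw [div_le_iff₀ hK]
        have := Nat.le_ceil (2 / δ)
        rw [div_le_iff₀ hδ] at this
        linarith) ρ₁ ρ₂
    have h2 : (⌈2 / δ⌉₊ : ℝ) < 2 / δ + 1 := Nat.ceil_lt_add_one (by positivity)
    have h3 : 1 ≤ 1 / δ := by rwa [le_div_iff₀ hδ, one_mul]
    have h4 : 3 / δ = 2 / δ + 1 / δ := by ring
    nlinarith
  have hηε : η ^ 2 ≤ ε / 2 := by
    have h1 : η ≤ ε := Real.exp_le_exp.2 (by nlinarith)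
    have h2 : η ≤ 1 / 2 := by
      have h3 : 2 ≤ Real.exp (c' * N) := by linarith [Real.add_one_le_exp (c' * N)]
      rw [hηdef, neg_mul, Real.exp_neg, one_div]
      exact inv_anti₀ (by norm_num) h3
    nlinarith
  -- A Markov threshold halfway in the exponent: it fails with probability at most `exp (-(κ / 2) *
  -- N)` and still leaves `exp (-(κ / 2) * N)` after the dimension factors. The oscillation cost `9
  -- * exp (κ / 8 * N)` fits into this margin.
  set θ : ℝ := (2 / 3) ^ N * Real.exp (κ / 2 * N)
  have hθ : 0 < θ := by positivity
  have hbound : ∀ X : ℝ, X < θ →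
      2 * (((3 / δ) ^ 2 / δ ^ 2 * 2 ^ S.card) * (2 ^ S.card * X)) < ε ^ 2 := by
    intro X hX
    have h0 : ((3 / δ) ^ 2 / δ ^ 2) = 9 * Real.exp (κ / 8 * N) := by
      have : δ ^ 4 = (Real.exp (κ / 8 * N))⁻¹ := by
        rw [hδdef, ← Real.exp_nat_mul, ← Real.exp_neg]
        congr 1
        push_cast
        ring
      rw [div_pow, div_div, ← pow_add, this]
      field_simp
      norm_num
    have h1 := two_pow_card_le hS
    calc 2 * (((3 / δ) ^ 2 / δ ^ 2 * 2 ^ S.card) * (2 ^ S.card * X))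
        ≤ 2 * (((3 / δ) ^ 2 / δ ^ 2 * 2 ^ S.card) * (2 ^ S.card * θ)) := by gcongr
      _ = 18 * Real.exp (κ / 8 * N) * ((2 ^ S.card * 2 ^ S.card * (2 / 3) ^ N) *
            Real.exp (κ / 2 * N)) := by
          rw [h0]
          simp only [θ]
          ring
      _ ≤ 18 * Real.exp (κ / 8 * N) * (Real.exp (-κ * N) * Real.exp (κ / 2 * N)) := by gcongr
      _ = 18 * (Real.exp (-(κ / 8) * N) * Real.exp (-(κ / 4) * N)) := by
          rw [mul_assoc, ← Real.exp_add, ← Real.exp_add, ← Real.exp_add]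
          ring_nf
      _ < Real.exp (-(κ / 8) * N) := by
          have h3 : 18 < Real.exp (κ / 4 * N) := by linarith [Real.add_one_le_exp (κ / 4 * N)]
          rw [neg_mul (κ / 4), Real.exp_neg, mul_left_comm, ← div_eq_mul_inv]
          have h4 : 18 / Real.exp (κ / 4 * N) < 1 := (div_lt_one (Real.exp_pos _)).2 h3
          exact mul_lt_of_lt_one_right (Real.exp_pos _) h4
      _ ≤ ε ^ 2 := by
          rw [hεdef, ← Real.exp_nat_mul]
          apply Real.exp_le_exp.2
          push_cast
          nlinarith
  change ∀ᵐ p : Params E.n N, _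
  filter_upwards [ae_noProductResonance E hαx hαz hγ (by omega : 0 < N)] with p hp
  obtain ⟨V, z, hV, hz, hres⟩ := hp
  refine (measure_mono fun φ hφ => ?_).trans
    ((haarProduct_participation_le hV.1 hθ).trans (ENNReal.ofReal_le_ofReal ?_))
  · by_contra hlt
    exact hφ (approxPeriodic_reducedState hV hz hres S φ hδ hε hloc hR hηε
      (hbound _ (not_le.1 hlt)))
  · simp only [θ]
    rw [div_mul_cancel_left₀ (by positivity), ← Real.exp_neg]
    apply Real.exp_le_exp.2
    nlinarith

end Floquet

theorem corollary1 :
    (∀ f : StateFunction, ExpContinuous f → AlmostAlwaysPeriodic f) ∧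
      ExpContinuous entanglementEntropy ∧ AlmostAlwaysPeriodic entanglementEntropy :=
  ⟨fun _ => almostAlwaysPeriodic_of_expContinuous, expContinuous_entanglementEntropy,
    almostAlwaysPeriodic_of_expContinuous expContinuous_entanglementEntropy⟩
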